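/- Let $G$ be an infinite locally compact (Hausdorff) group with a fixed left Haar measure $dx$, and let $\omega:G\to[1,\infty)$ be a weight function, i.e. $\omega$ is continuous, $\omega(xy)\le\omega(x)\omega(y)$ for all $x,y\in G$, and $\omega(e)=1$. Notation. "Almost everywhere" on $G$, $G\times G$, $G\times G\times G$ means locally almost everywhere: the exceptional set meets every compact set in a Haar-null set (for $\sigma$-compact $G$ this is the usual notion). $L^1(G,\omega)$ is the Banach algebra, under convolution, of (classes of) functions $f:G\to\mathbb C$ with $\|f\|_\omega=\int_G|f|\,\omega\,dx<\infty$. $L^\infty(G,1/\omega)$ is the Banach space of Borel functions $h:G\to\mathbb C$, identified when equal almost everywhere, with $\|h\|=\operatorname{ess\,sup}|h|/\omega<\infty$; it is identified with the dual $L^1(G,\omega)$-bimodule $L^1(G,\omega)^*$ through $\langle h,f\rangle=\int_G f(x)h(x)\,dx$. For a Banach algebra $A$, a bounded derivation $D:A\to A^*$ is a bounded linear map with $D(ab)=D(a)\cdot b+a\cdot D(b)$, where $(\varphi\cdot a)(b)=\varphi(ab)$ and $(a\cdot\varphi)(b)=\varphi(ba)$; it is inner if $D(a)=z\cdot a-a\cdot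 z$ for some $z\in A^*$; $A$ is weakly amenable if every bounded derivation $A\to A^*$ is inner. A Borel function $p:G\times G\to\mathbb C$ is quasi-additive if $p(xy,z)=p(x,yz)+p(y,zx)$ for almost every $(x,y,z)$; a quasi-additive $p$ is inner if there is $h\in L^\infty(G,1/\omega)$ with $p(x,y)=h(xy)-h(yx)$ for almost every $(x,y)$, and non-inner otherwise. Put $C(p,\omega)=\sup_{x,y\in G}\frac{|p(x,y)|}{\omega(x)\omega(y)}\in[0,\infty]$. Let $D(G,\omega)$ be the set of quasi-additive $p$ with $C(p,\omega)<\infty$, and $I(G,\omega)$ the set of inner quasi-additive functions. Theorem. The following assertions are equivalent. (a) $L^1(G,\omega)$ is weakly amenable. (b) For every bounded derivation $D:L^1(G,\omega)\to L^\infty(G,1/\omega)$ there exists $h\in L^\infty(G,1/\omega)$ such that $\langle D(f),g\rangle=\int_G\int_G f(x)g(y)\,(h(xy)-h(yx))\,dx\,dy$ for all $f,g\in L^1(G,\omega)$. (c) For every $p\in D(G,\omega)$ there exists $h\in L^\infty(G,1/\omega)$ such that $p(x,y)=h(xy)-h(yx)$ for almost every $(x,y)\in G\times G$. (d) Every quasi-additive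 function $p$ with $C(p,\omega)<\infty$ is inner. (e) Every non-inner quasi-additive function $p$ is unbounded, i.e. $C(p,\omega)=\infty$. (f) $D(G,\omega)=I(G,\omega)$ as sets of classes modulo equality almost everywhere on $G\times G$. -/

import Mathlib

open MeasureTheory Filter Topology
open scoped ENNReal Pointwise

namespace Beurling

/-- A weight function: a continuous submultiplicative `ω : G → [1, ∞)` with `ω(e) = 1`. -/
structure Weight (G : Type*) [Group G] [TopologicalSpace G] where
  toFun : G → ℝ
  continuous' : Continuous toFun
  one_le' : ∀ x, 1 ≤ toFun x
  mul_le' : ∀ x y, toFun (x * y) ≤ toFun x * toFun y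
  map_one' : toFun 1 = 1

instance {G : Type*} [Group G] [TopologicalSpace G] : CoeFun (Weight G) (fun _ => G → ℝ) :=
  ⟨Weight.toFun⟩

theorem Weight.pos {G : Type*} [Group G] [TopologicalSpace G] (ω : Weight G) (x : G) :
    0 < ω x := lt_of_lt_of_le one_pos (ω.one_le' x)

/-- "Locally almost everywhere" on a locally compact group `X`: a property holds eventually along
this filter iff on every compact set it fails only on a set of Haar measure zero. The Haar measure
lives on the Borel sets of the topology of `X` (for `X = G × G` these may be more than the product
σ-algebra). For σ-compact `X` this is the usual almost everywhere filter of Haar measure. -/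
noncomputable def locallyAE (X : Type*) [Group X] [TopologicalSpace X] [IsTopologicalGroup X]
    [LocallyCompactSpace X] : Filter X :=
  letI : MeasurableSpace X := borel X
  haveI : BorelSpace X := ⟨rfl⟩
  ⨆ K : {K : Set X // IsCompact K}, ae ((Measure.haar : Measure X).restrict K.1)

/-- Borel measurability of complex functions on a topological space. -/
def BorelFun {X : Type*} [TopologicalSpace X] (f : X → ℂ) : Prop :=
  @Measurable X ℂ (borel X) (borel ℂ) f

section Generic

variable {A : Type*} [NonUnitalNormedRing A] [NormedSpace ℂ A] [IsScalarTower ℂ A A]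
  [SMulCommClass ℂ A A]

/-- The right action on the dual of a Banach algebra, `(φ · a)(b) = φ(ab)`. -/
noncomputable def dualRight (φ : StrongDual ℂ A) (a : A) : StrongDual ℂ A :=
  φ.comp (ContinuousLinearMap.mul ℂ A a)

/-- The left action on the dual of a Banach algebra, `(a · φ)(b) = φ(ba)`. -/
noncomputable def dualLeft (a : A) (φ : StrongDual ℂ A) : StrongDual ℂ A :=
  φ.comp ((ContinuousLinearMap.mul ℂ A).flip a)

/-- Bounded derivations into the dual: `D(ab) = D(a) · b + a · D(b)`. -/
def IsDerivation (D : A →L[ℂ] StrongDual ℂ A) : Prop :=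
  ∀ a b : A, D (a * b) = dualRight (D a) b + dualLeft a (D b)

/-- Inner derivations `ad_z(a) = z · a - a · z`. -/
def IsInnerDerivation (D : A →L[ℂ] StrongDual ℂ A) : Prop :=
  ∃ z : StrongDual ℂ A, ∀ a : A, D a = dualRight z a - dualLeft a z

/-- Weak amenability: every bounded derivation from `A` into its dual is inner. -/
def WeaklyAmenable (A : Type*) [NonUnitalNormedRing A] [NormedSpace ℂ A] [IsScalarTower ℂ A A]
    [SMulCommClass ℂ A A] : Prop :=
  ∀ D : A →L[ℂ] StrongDual ℂ A, IsDerivation D → IsInnerDerivation D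

end Generic

section Group

variable {G : Type*} [Group G] [TopologicalSpace G] [IsTopologicalGroup G] [LocallyCompactSpace G]

/-- A representative `h` of an element of `L^∞(G, 1/ω)`: Borel measurable with `h/ω`
essentially bounded (outside a locally null set). -/
def MemLinf (ω : Weight G) (h : G → ℂ) : Prop :=
  BorelFun h ∧ ∃ C : ℝ, ∀ᶠ x in locallyAE G, ‖h x‖ ≤ C * ω x

/-- Quasi-additive functions: `p` is Borel and `p(xy, z) = p(x, yz) + p(y, zx)` for (locally)
almost every `(x, y, z)`. -/
def QuasiAdditive (p : G × G → ℂ) : Prop :=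
  BorelFun p ∧ ∀ᶠ t in locallyAE (G × G × G),
    p (t.1 * t.2.1, t.2.2) = p (t.1, t.2.1 * t.2.2) + p (t.2.1, t.2.2 * t.1)

/-- The constant `C(p, ω) = sup |p(x, y)| / (ω(x) ω(y))`, in `[0, ∞]`. -/
noncomputable def supConst (ω : Weight G) (p : G × G → ℂ) : ℝ≥0∞ :=
  ⨆ (x : G) (y : G), ENNReal.ofReal (‖p (x, y)‖ / (ω x * ω y))

/-- The kernel identity `p(x, y) = h(xy) - h(yx)` almost everywhere. -/
def HasKernel (p : G × G → ℂ) (h : G → ℂ) : Prop :=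
  ∀ᶠ t in locallyAE (G × G), p t = h (t.1 * t.2) - h (t.2 * t.1)

/-- The set `D(G, ω)`. -/
def boundedQA (ω : Weight G) : Set (G × G → ℂ) :=
  {p | QuasiAdditive p ∧ supConst ω p < ∞}

/-- The set `I(G, ω)` of inner quasi-additive functions. -/
def innerQA (ω : Weight G) : Set (G × G → ℂ) :=
  {p | QuasiAdditive p ∧ ∃ h : G → ℂ, MemLinf ω h ∧ HasKernel p h}

/-- The classes of the functions in `S` modulo equality locally almost everywhere. -/
def classes (S : Set (G × G → ℂ)) : Set (Germ (locallyAE (G × G)) ℂ) :=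
  (fun p : G × G → ℂ => (p : Germ (locallyAE (G × G)) ℂ)) '' S

theorem BorelFun.add {X : Type*} [TopologicalSpace X] {f g : X → ℂ} (hf : BorelFun f)
    (hg : BorelFun g) : BorelFun (f + g) := by
  borelize X
  exact Measurable.add hf hg

theorem BorelFun.const_smul {X : Type*} [TopologicalSpace X] {f : X → ℂ} (hf : BorelFun f)
    (c : ℂ) : BorelFun (c • f) := by
  borelize X
  exact Measurable.const_smul hf c

theorem BorelFun.zero {X : Type*} [TopologicalSpace X] : BorelFun (0 : X → ℂ) := by
  borelize X
  exact measurable_const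

/-- `L^∞(G, 1/ω)` as a space of classes of functions modulo equality locally almost everywhere. -/
def linfSubmodule (ω : Weight G) : Submodule ℂ (Germ (locallyAE G) ℂ) where
  carrier := {φ | ∃ h : G → ℂ, MemLinf ω h ∧ (h : Germ (locallyAE G) ℂ) = φ}
  zero_mem' := ⟨0, ⟨BorelFun.zero, 0, by simp⟩, rfl⟩
  add_mem' := by
    rintro _ _ ⟨h, ⟨hm, C, hC⟩, rfl⟩ ⟨k, ⟨km, C', hC'⟩, rfl⟩
    refine ⟨h + k, ⟨hm.add km, C + C', ?_⟩, rfl⟩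
    filter_upwards [hC, hC'] with x h1 h2
    rw [add_mul]
    exact (norm_add_le _ _).trans (add_le_add h1 h2)
  smul_mem' := by
    rintro c _ ⟨h, ⟨hm, C, hC⟩, rfl⟩
    refine ⟨c • h, ⟨hm.const_smul c, ‖c‖ * C, ?_⟩, rfl⟩
    filter_upwards [hC] with x h1
    rw [Pi.smul_apply, norm_smul, mul_assoc]
    exact mul_le_mul_of_nonneg_left h1 (norm_nonneg _)

/-- The space `L^∞(G, 1/ω)`. -/
def Linf (ω : Weight G) : Type _ := linfSubmodule ω

noncomputable instance (ω : Weight G) : AddCommGroup (Linf ω) :=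
  inferInstanceAs (AddCommGroup (linfSubmodule ω))

noncomputable instance (ω : Weight G) : Module ℂ (Linf ω) :=
  inferInstanceAs (Module ℂ (linfSubmodule ω))

/-- A Borel function representing an element of `L^∞(G, 1/ω)`. -/
noncomputable def Linf.rep {ω : Weight G} (h : Linf ω) : G → ℂ :=
  Classical.choose (show linfSubmodule ω from h).2

noncomputable instance (ω : Weight G) : CoeFun (Linf ω) (fun _ => G → ℂ) := ⟨Linf.rep⟩

theorem Linf.memLinf {ω : Weight G} (h : Linf ω) : MemLinf ω h :=
  (Classical.choose_spec (show linfSubmodule ω from h).2).1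

theorem Linf.germ_rep {ω : Weight G} (h : Linf ω) :
    (h.rep : Germ (locallyAE G) ℂ) = (show linfSubmodule ω from h).1 :=
  (Classical.choose_spec (show linfSubmodule ω from h).2).2

theorem Linf.ext {ω : Weight G} {h k : Linf ω} (e : h.rep =ᶠ[locallyAE G] k.rep) : h = k :=
  Subtype.ext (((Linf.germ_rep h).symm.trans (Germ.coe_eq.2 e)).trans (Linf.germ_rep k))

/-- The class in `L^∞(G, 1/ω)` of a Borel function. -/
noncomputable def Linf.mk (ω : Weight G) (h : G → ℂ) (hh : MemLinf ω h) : Linf ω := ⟨h, h, hh, rfl⟩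

theorem Linf.coe_mk (ω : Weight G) {h : G → ℂ} (hh : MemLinf ω h) :
    (Linf.mk ω h hh).rep =ᶠ[locallyAE G] h :=
  Germ.coe_eq.1 (Linf.germ_rep (Linf.mk ω h hh))

theorem Linf.coe_add {ω : Weight G} (h k : Linf ω) :
    (h + k).rep =ᶠ[locallyAE G] h.rep + k.rep := by
  refine Germ.coe_eq.1 ((Linf.germ_rep _).trans ?_)
  rw [Germ.coe_add, Linf.germ_rep, Linf.germ_rep]
  rfl

theorem Linf.coe_smul {ω : Weight G} (c : ℂ) (h : Linf ω) :
    (c • h).rep =ᶠ[locallyAE G] c • h.rep := by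
  refine Germ.coe_eq.1 ((Linf.germ_rep _).trans ?_)
  rw [Germ.coe_smul, Linf.germ_rep]
  rfl

theorem Linf.coe_zero {ω : Weight G} : (0 : Linf ω).rep =ᶠ[locallyAE G] 0 :=
  Germ.coe_eq.1 (Linf.germ_rep _)

/-- The norm `‖h‖ = ess sup |h| / ω` (essential with respect to locally null sets). -/
noncomputable instance (ω : Weight G) : Norm (Linf ω) :=
  ⟨fun h => sInf {C : ℝ | 0 ≤ C ∧ ∀ᶠ x in locallyAE G, ‖h x‖ ≤ C * ω x}⟩

theorem Linf.norm_def {ω : Weight G} (h : Linf ω) :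
    ‖h‖ = sInf {C : ℝ | 0 ≤ C ∧ ∀ᶠ x in locallyAE G, ‖h x‖ ≤ C * ω x} := rfl

theorem Linf.norm_le {ω : Weight G} (h : Linf ω) {C : ℝ} (hC : 0 ≤ C)
    (hb : ∀ᶠ x in locallyAE G, ‖h x‖ ≤ C * ω x) : ‖h‖ ≤ C :=
  csInf_le ⟨0, fun _ hD => hD.1⟩ ⟨hC, hb⟩

theorem Linf.norm_nonneg' {ω : Weight G} (h : Linf ω) : 0 ≤ ‖h‖ :=
  Real.sInf_nonneg fun _ hC => hC.1

theorem eventually_locallyAE_nat {P : ℕ → G → Prop} (h : ∀ n, ∀ᶠ x in locallyAE G, P n x) :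
    ∀ᶠ x in locallyAE G, ∀ n, P n x := by
  borelize G
  simp only [locallyAE, eventually_iSup] at h ⊢
  exact fun K => eventually_countable_forall.2 fun n => h n K

theorem Linf.bound {ω : Weight G} (h : Linf ω) :
    ∀ᶠ x in locallyAE G, ‖h x‖ ≤ ‖h‖ * ω x := by
  have hne : {C : ℝ | 0 ≤ C ∧ ∀ᶠ x in locallyAE G, ‖h x‖ ≤ C * ω x}.Nonempty := by
    obtain ⟨C, hC⟩ := h.memLinf.2
    refine ⟨max C 0, le_max_right _ _, ?_⟩
    filter_upwards [hC] with x hx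
    exact hx.trans (mul_le_mul_of_nonneg_right (le_max_left _ _) (ω.pos x).le)
  have key : ∀ n : ℕ, ∀ᶠ x in locallyAE G, ‖h x‖ ≤ (‖h‖ + 1 / (n + 1 : ℝ)) * ω x := fun n => by
    obtain ⟨C, ⟨-, hC⟩, hlt⟩ := exists_lt_of_csInf_lt hne
      (lt_add_of_pos_right (sInf _) (show (0 : ℝ) < 1 / (n + 1 : ℝ) by positivity))
    filter_upwards [hC] with x hx
    exact hx.trans (mul_le_mul_of_nonneg_right hlt.le (ω.pos x).le)
  filter_upwards [eventually_locallyAE_nat key] with x hx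
  have hl : Tendsto (fun n : ℕ => (‖h‖ + 1 / (n + 1 : ℝ)) * ω x) atTop (𝓝 ((‖h‖ + 0) * ω x)) :=
    (tendsto_const_nhds.add tendsto_one_div_add_atTop_nhds_zero_nat).mul_const _
  rw [add_zero] at hl
  exact ge_of_tendsto' hl hx

theorem Linf.core (ω : Weight G) : NormedSpace.Core ℂ (Linf ω) where
  norm_nonneg := Linf.norm_nonneg'
  norm_smul c h := by
    have hle : ∀ (c : ℂ) (h : Linf ω), ‖c • h‖ ≤ ‖c‖ * ‖h‖ := fun c h => by
      refine Linf.norm_le _ (mul_nonneg (norm_nonneg _) h.norm_nonneg') ?_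
      filter_upwards [Linf.coe_smul c h, h.bound] with x h1 h2
      rw [h1, Pi.smul_apply, norm_smul, mul_assoc]
      exact mul_le_mul_of_nonneg_left h2 (norm_nonneg _)
    refine le_antisymm (hle c h) ?_
    rcases eq_or_ne c 0 with rfl | hc
    · simpa using Linf.norm_nonneg' _
    · have h1 := hle c⁻¹ (c • h)
      rw [inv_smul_smul₀ hc, norm_inv] at h1
      have hc' : 0 < ‖c‖ := norm_pos_iff.2 hc
      calc ‖c‖ * ‖h‖ ≤ ‖c‖ * (‖c‖⁻¹ * ‖c • h‖) := mul_le_mul_of_nonneg_left h1 hc'.le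
        _ = ‖c • h‖ := by field_simp
  norm_triangle h k := by
    refine Linf.norm_le _ (add_nonneg h.norm_nonneg' k.norm_nonneg') ?_
    filter_upwards [Linf.coe_add h k, h.bound, k.bound] with x h1 h2 h3
    rw [h1, Pi.add_apply, add_mul]
    exact (norm_add_le _ _).trans (add_le_add h2 h3)
  norm_eq_zero_iff h := by
    constructor
    · intro h0
      refine Linf.ext ?_
      filter_upwards [h.bound, Linf.coe_zero (ω := ω)] with x h1 h2
      rw [h0, zero_mul] at h1
      rw [h2, Pi.zero_apply]
      exact norm_le_zero_iff.1 h1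
    · rintro rfl
      refine le_antisymm (Linf.norm_le _ le_rfl ?_) (Linf.norm_nonneg' _)
      filter_upwards [Linf.coe_zero (ω := ω)] with x h2
      simp [h2]

noncomputable instance (ω : Weight G) : NormedAddCommGroup (Linf ω) :=
  NormedAddCommGroup.ofCore (Linf.core ω)

noncomputable instance (ω : Weight G) : NormedSpace ℂ (Linf ω) :=
  NormedSpace.ofCore (Linf.core ω)

variable [MeasurableSpace G] [BorelSpace G]

theorem eventually_locallyAE {P : G → Prop} :
    (∀ᶠ x in locallyAE G, P x) ↔
      ∀ K : Set G, IsCompact K → ∀ᵐ x ∂(Measure.haar : Measure G).restrict K, P x := by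
  obtain rfl : ‹MeasurableSpace G› = borel G := BorelSpace.measurable_eq
  simp [locallyAE, eventually_iSup]

/-- The measure `ω(x) dx`. -/
noncomputable def wMeasure (ω : Weight G) : Measure G :=
  (Measure.haar : Measure G).withDensity fun x => ENNReal.ofReal (ω x)

/-- `L^1(G, ω)`: (classes of) functions with `∫ |f| ω dx < ∞`, normed by `‖f‖ = ∫ |f| ω dx`. -/
def L1 (ω : Weight G) : Type _ := Lp ℂ 1 (wMeasure ω)

noncomputable instance (ω : Weight G) : NormedAddCommGroup (L1 ω) :=
  inferInstanceAs (NormedAddCommGroup (Lp ℂ 1 (wMeasure ω)))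

noncomputable instance (ω : Weight G) : NormedSpace ℂ (L1 ω) :=
  inferInstanceAs (NormedSpace ℂ (Lp ℂ 1 (wMeasure ω)))

instance (ω : Weight G) : CompleteSpace (L1 ω) :=
  inferInstanceAs (CompleteSpace (Lp ℂ 1 (wMeasure ω)))

/-- A function representing an element of `L^1(G, ω)`. -/
noncomputable def L1.rep {ω : Weight G} (f : L1 ω) : G → ℂ :=
  ((show Lp ℂ 1 (wMeasure ω) from f : Lp ℂ 1 (wMeasure ω)) : G → ℂ)

noncomputable instance (ω : Weight G) : CoeFun (L1 ω) (fun _ => G → ℂ) := ⟨L1.rep⟩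

/-- The class in `L^1(G, ω)` of an integrable function. -/
noncomputable def L1.mk (ω : Weight G) (f : G → ℂ) (hf : MemLp f 1 (wMeasure ω)) : L1 ω :=
  hf.toLp f

theorem L1.memLp {ω : Weight G} (f : L1 ω) : MemLp f 1 (wMeasure ω) :=
  Lp.memLp (show Lp ℂ 1 (wMeasure ω) from f)

theorem L1.coe_mk (ω : Weight G) {f : G → ℂ} (hf : MemLp f 1 (wMeasure ω)) :
    L1.mk ω f hf =ᵐ[wMeasure ω] f := hf.coeFn_toLp

theorem L1.ext {ω : Weight G} {f g : L1 ω} (h : f =ᵐ[wMeasure ω] g) : f = g :=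
  Lp.ext (f := (show Lp ℂ 1 (wMeasure ω) from f)) (g := (show Lp ℂ 1 (wMeasure ω) from g)) h

theorem L1.coe_add {ω : Weight G} (f g : L1 ω) : (f + g).rep =ᵐ[wMeasure ω] f.rep + g.rep :=
  Lp.coeFn_add (show Lp ℂ 1 (wMeasure ω) from f) (show Lp ℂ 1 (wMeasure ω) from g)

theorem L1.coe_sub {ω : Weight G} (f g : L1 ω) : (f - g).rep =ᵐ[wMeasure ω] f.rep - g.rep :=
  Lp.coeFn_sub (show Lp ℂ 1 (wMeasure ω) from f) (show Lp ℂ 1 (wMeasure ω) from g)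

theorem L1.coe_smul {ω : Weight G} (c : ℂ) (f : L1 ω) :
    (c • f).rep =ᵐ[wMeasure ω] c • f.rep :=
  Lp.coeFn_smul c (show Lp ℂ 1 (wMeasure ω) from f)

theorem L1.norm_eq {ω : Weight G} (f : L1 ω) : ‖f‖ = (eLpNorm f.rep 1 (wMeasure ω)).toReal :=
  Lp.norm_def (show Lp ℂ 1 (wMeasure ω) from f)

theorem L1.norm_mk (ω : Weight G) {f : G → ℂ} (hf : MemLp f 1 (wMeasure ω)) :
    ‖L1.mk ω f hf‖ = (eLpNorm f 1 (wMeasure ω)).toReal := by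
  rw [L1.norm_eq, eLpNorm_congr_ae (L1.coe_mk ω hf)]

theorem Weight.measurable_ofReal {G : Type*} [Group G] [TopologicalSpace G] [MeasurableSpace G]
    [BorelSpace G] (ω : Weight G) : Measurable fun x => ENNReal.ofReal (ω x) :=
  ω.continuous'.measurable.ennreal_ofReal

theorem ae_wMeasure (ω : Weight G) : ae (wMeasure ω) = ae (Measure.haar : Measure G) := by
  ext s
  have h := ae_withDensity_iff (μ := (Measure.haar : Measure G)) (p := fun x => x ∈ s) ω.measurable_ofReal
  have : ∀ x, ENNReal.ofReal (ω x) ≠ 0 := fun x => by simpa using ω.pos x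
  simp only [this, ne_eq, not_false_eq_true, true_imp_iff] at h
  exact h

theorem map_wMeasure_le (ω : Weight G) (y : G) :
    (wMeasure ω).map (fun x => y⁻¹ * x) ≤ ENNReal.ofReal (ω y) • wMeasure ω := by
  have hm : Measurable fun x : G => y⁻¹ * x := (continuous_const_mul y⁻¹).measurable
  refine Measure.le_iff.2 fun s hs => ?_
  rw [Measure.map_apply hm hs, Measure.smul_apply, wMeasure, withDensity_apply _ (hm hs),
    withDensity_apply _ hs, ← lintegral_indicator (hm hs), ← lintegral_indicator hs,
    ← lintegral_mul_left_eq_self _ y, smul_eq_mul,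
    ← lintegral_const_mul _ (ω.measurable_ofReal.indicator hs)]
  refine lintegral_mono fun x => ?_
  by_cases hx : x ∈ s
  · simp only [Set.indicator, Set.mem_preimage, inv_mul_cancel_left, hx, if_true]
    rw [← ENNReal.ofReal_mul (ω.pos y).le]
    exact ENNReal.ofReal_le_ofReal (ω.mul_le' y x)
  · simp [Set.indicator, hx]

theorem memLp_translate (ω : Weight G) (y : G) {g : G → ℂ} (hg : MemLp g 1 (wMeasure ω)) :
    MemLp (fun x => g (y⁻¹ * x)) 1 (wMeasure ω) :=
  (hg.of_measure_le_smul ENNReal.ofReal_ne_top (map_wMeasure_le ω y)).comp_of_map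
    (continuous_const_mul y⁻¹).measurable.aemeasurable

theorem eLpNorm_translate_le (ω : Weight G) (y : G) {g : G → ℂ} (hg : MemLp g 1 (wMeasure ω)) :
    eLpNorm (fun x => g (y⁻¹ * x)) 1 (wMeasure ω) ≤
      ENNReal.ofReal (ω y) * eLpNorm g 1 (wMeasure ω) := by
  have h1 := hg.of_measure_le_smul ENNReal.ofReal_ne_top (map_wMeasure_le ω y)
  have h2 := eLpNorm_map_measure (p := 1) h1.aestronglyMeasurable
    (continuous_const_mul y⁻¹).measurable.aemeasurable
  have h3 := eLpNorm_le_of_measure_le_smul (f := g) (p := 1) (map_wMeasure_le ω y)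
  rw [h2] at h3
  simpa [Function.comp_def] using h3

theorem tendsto_translate_ae (ω : Weight G) (y : G) :
    Tendsto (fun x => y⁻¹ * x) (ae (wMeasure ω)) (ae (wMeasure ω)) := by
  rw [ae_wMeasure]
  exact (measurePreserving_mul_left (Measure.haar : Measure G) y⁻¹).quasiMeasurePreserving.tendsto_ae

/-- Left translation `(L_y g)(x) = g(y⁻¹ x)` on `L^1(G, ω)`, as a function. -/
noncomputable def translateFun (ω : Weight G) (y : G) (g : L1 ω) : L1 ω :=
  L1.mk ω (fun x => g (y⁻¹ * x)) (memLp_translate ω y g.memLp)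

theorem translateFun_add (ω : Weight G) (y : G) (f g : L1 ω) :
    translateFun ω y (f + g) = translateFun ω y f + translateFun ω y g := by
  refine L1.ext ?_
  have h1 : (translateFun ω y f).rep =ᵐ[wMeasure ω] fun x => f (y⁻¹ * x) := L1.coe_mk ω _
  have h2 : (translateFun ω y g).rep =ᵐ[wMeasure ω] fun x => g (y⁻¹ * x) := L1.coe_mk ω _
  have h3 : (translateFun ω y (f + g)).rep =ᵐ[wMeasure ω] fun x => (f + g).rep (y⁻¹ * x) :=
    L1.coe_mk ω _
  have h4 := (tendsto_translate_ae ω y).eventually (L1.coe_add f g)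
  have h5 := L1.coe_add (translateFun ω y f) (translateFun ω y g)
  filter_upwards [h1, h2, h3, h4, h5] with x h1 h2 h3 h4 h5
  rw [h3, h4, h5, Pi.add_apply, Pi.add_apply, h1, h2]

theorem translateFun_smul (ω : Weight G) (y : G) (c : ℂ) (f : L1 ω) :
    translateFun ω y (c • f) = c • translateFun ω y f := by
  refine L1.ext ?_
  have h1 : (translateFun ω y f).rep =ᵐ[wMeasure ω] fun x => f (y⁻¹ * x) := L1.coe_mk ω _
  have h3 : (translateFun ω y (c • f)).rep =ᵐ[wMeasure ω] fun x => (c • f).rep (y⁻¹ * x) :=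
    L1.coe_mk ω _
  have h4 := (tendsto_translate_ae ω y).eventually (L1.coe_smul c f)
  have h5 := L1.coe_smul c (translateFun ω y f)
  filter_upwards [h1, h3, h4, h5] with x h1 h3 h4 h5
  rw [h3, h4, h5, Pi.smul_apply, Pi.smul_apply, h1]

theorem norm_translateFun_le (ω : Weight G) (y : G) (g : L1 ω) :
    ‖translateFun ω y g‖ ≤ ω y * ‖g‖ := by
  have h2 := ENNReal.toReal_mono
    (ENNReal.mul_ne_top ENNReal.ofReal_ne_top g.memLp.eLpNorm_ne_top)
    (eLpNorm_translate_le ω y g.memLp)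
  rw [ENNReal.toReal_mul, ENNReal.toReal_ofReal (ω.pos y).le, ← L1.norm_eq] at h2
  exact (le_of_eq (L1.norm_mk ω _)).trans h2

/-- Left translation `(L_y g)(x) = g(y⁻¹ x)` as a bounded operator on `L^1(G, ω)`. -/
noncomputable def translate (ω : Weight G) (y : G) : L1 ω →L[ℂ] L1 ω :=
  LinearMap.mkContinuous
    { toFun := translateFun ω y
      map_add' := translateFun_add ω y
      map_smul' := translateFun_smul ω y }
    (ω y) (norm_translateFun_le ω y)

theorem coe_translate (ω : Weight G) (y : G) (g : L1 ω) :
    translate ω y g =ᵐ[wMeasure ω] fun x => g (y⁻¹ * x) :=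
  L1.coe_mk ω (memLp_translate ω y g.memLp)

theorem norm_translate_le (ω : Weight G) (y : G) (g : L1 ω) :
    ‖translate ω y g‖ ≤ ω y * ‖g‖ :=
  norm_translateFun_le ω y g

theorem translate_mul (ω : Weight G) (y z : G) (g : L1 ω) :
    translate ω (y * z) g = translate ω y (translate ω z g) := by
  refine L1.ext ?_
  filter_upwards [coe_translate ω (y * z) g, coe_translate ω y (translate ω z g),
    (tendsto_translate_ae ω y).eventually (coe_translate ω z g)] with x h1 h2 h3
  rw [h1, h2, h3, mul_inv_rev, mul_assoc]

/-- `f ∈ L^1(G, ω)` iff `ω f ∈ L^1(G)`. -/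
theorem memLp_iff (ω : Weight G) (f : G → ℂ) :
    MemLp f 1 (wMeasure ω) ↔ Integrable (fun x => (ω x : ℂ) * f x) (Measure.haar : Measure G) := by
  rw [memLp_one_iff_integrable, wMeasure]
  have := integrable_withDensity_iff_integrable_smul (μ := (Measure.haar : Measure G))
    (f := fun x => (ω x).toNNReal) ω.continuous'.measurable.real_toNNReal (g := f)
  refine this.trans (integrable_congr (Eventually.of_forall fun x => ?_))
  simp [NNReal.smul_def, Real.coe_toNNReal _ (ω.pos x).le]

theorem L1.norm_eq_integral {ω : Weight G} (f : L1 ω) :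
    ‖f‖ = ∫ x, ω x * ‖f x‖ ∂(Measure.haar : Measure G) := by
  have h := memLp_one_iff_integrable.1 f.memLp
  rw [L1.norm_eq, eLpNorm_one_eq_lintegral_enorm, ← integral_norm_eq_lintegral_enorm h.1]
  have := integral_withDensity_eq_integral_smul (μ := (Measure.haar : Measure G))
    (f := fun x => (ω x).toNNReal) ω.continuous'.measurable.real_toNNReal (fun x => ‖f x‖)
  refine this.trans (integral_congr_ae (Eventually.of_forall fun x => ?_))
  simp [NNReal.smul_def, Real.coe_toNNReal _ (ω.pos x).le]

/-- Compactly supported continuous functions are dense in `L^1(G)`. -/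
theorem exists_compactSupport_haar {f : G → ℂ} (hf : Integrable f (Measure.haar : Measure G))
    {ε : ℝ} (hε : 0 < ε) :
    ∃ g : G → ℂ, HasCompactSupport g ∧ ∫ x, ‖f x - g x‖ ∂(Measure.haar : Measure G) ≤ ε ∧
      Continuous g ∧ Integrable g (Measure.haar : Measure G) := by
  have hε' : ENNReal.ofReal ε ≠ 0 := by simpa using hε
  have h0P : ∀ (c : ℂ) ⦃s : Set G⦄, MeasurableSet s → (Measure.haar : Measure G) s < ∞ →
      ∀ {ε : ℝ≥0∞}, ε ≠ 0 → ∃ g : G → ℂ,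
        eLpNorm (g - s.indicator fun _ => c) 1 (Measure.haar : Measure G) ≤ ε ∧
          (Continuous g ∧ HasCompactSupport g) := by
    intro c s hs hμ δ hδ
    obtain ⟨η, ηpos, hη⟩ := exists_eLpNorm_indicator_le (μ := (Measure.haar : Measure G))
      ENNReal.one_ne_top c hδ
    have hη2 : (η : ℝ≥0∞) / 2 ≠ 0 := by simpa using ηpos.ne'
    obtain ⟨K, hKs, hK, hKc, hμK⟩ := hs.exists_isCompact_isClosed_sdiff_lt hμ.ne hη2
    have hKfin : (Measure.haar : Measure G) K ≠ ∞ := hK.measure_lt_top.ne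
    obtain ⟨U, hKU, hU, -, hμU⟩ := hKc.measurableSet.exists_isOpen_sdiff_lt hKfin hη2
    obtain ⟨u, hf1, hf0, hfs, hf⟩ := exists_continuous_one_zero_of_isCompact hK hU.isClosed_compl
      (Set.disjoint_compl_right_iff_subset.2 hKU)
    refine ⟨fun x => (u x : ℂ) * c, ?_, ?_, ?_⟩
    · refine le_trans (eLpNorm_mono fun x => ?_) (hη ((U \ K) ∪ (s \ K)) ?_)
      · have h01 := hf x
        by_cases hxK : x ∈ K
        · have h1 : x ∉ (U \ K) ∪ (s \ K) := by simp [hxK]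
          rw [Set.indicator_of_notMem h1, Pi.sub_apply, Set.indicator_of_mem (hKs hxK)]
          simp [hf1 hxK]
        · by_cases hxU : x ∈ U <;> by_cases hxs : x ∈ s
          · have h1 : x ∈ (U \ K) ∪ (s \ K) := Or.inl ⟨hxU, hxK⟩
            have h2 : (u x : ℂ) * c - c = ((u x - 1 : ℝ) : ℂ) * c := by push_cast; ring
            rw [Set.indicator_of_mem h1, Pi.sub_apply, Set.indicator_of_mem hxs, h2, norm_mul,
              Complex.norm_real, Real.norm_eq_abs]
            exact mul_le_of_le_one_left (norm_nonneg _)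
              (abs_le.2 ⟨by linarith [h01.1], by linarith [h01.2]⟩)
          · have h1 : x ∈ (U \ K) ∪ (s \ K) := Or.inl ⟨hxU, hxK⟩
            rw [Set.indicator_of_mem h1, Pi.sub_apply, Set.indicator_of_notMem hxs, sub_zero,
              norm_mul, Complex.norm_real, Real.norm_eq_abs]
            exact mul_le_of_le_one_left (norm_nonneg _)
              (abs_le.2 ⟨by linarith [h01.1], h01.2⟩)
          · have h1 : x ∈ (U \ K) ∪ (s \ K) := Or.inr ⟨hxs, hxK⟩
            rw [Set.indicator_of_mem h1, Pi.sub_apply, Set.indicator_of_mem hxs]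
            simp [hf0 hxU]
          · have h1 : x ∉ (U \ K) ∪ (s \ K) := by simp [hxU, hxs]
            rw [Set.indicator_of_notMem h1, Pi.sub_apply, Set.indicator_of_notMem hxs]
            simp [hf0 hxU]
      · refine (measure_union_le _ _).trans ?_
        rw [← ENNReal.add_halves (η : ℝ≥0∞)]
        exact add_le_add hμU.le hμK.le
    · exact (Complex.continuous_ofReal.comp u.continuous).mul continuous_const
    · exact (hfs.comp_left (g := fun t : ℝ => (t : ℂ)) Complex.ofReal_zero).mul_right
  obtain ⟨g, hg, hgc, hgs⟩ := (memLp_one_iff_integrable.2 hf).induction_dense ENNReal.one_ne_top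
    (fun g : G → ℂ => Continuous g ∧ HasCompactSupport g) h0P
    (fun f g hf hg => ⟨hf.1.add hg.1, hf.2.add hg.2⟩)
    (fun f hf => (hf.1.stronglyMeasurable_of_hasCompactSupport hf.2).aestronglyMeasurable) hε'
  have hgi : Integrable g (Measure.haar : Measure G) := hgc.integrable_of_hasCompactSupport hgs
  refine ⟨g, hgs, ?_, hgc, hgi⟩
  rw [eLpNorm_one_eq_lintegral_enorm] at hg
  have h2 := ENNReal.toReal_mono ENNReal.ofReal_ne_top hg
  rw [ENNReal.toReal_ofReal hε.le] at h2
  rwa [← integral_norm_eq_lintegral_enorm (hf.sub hgi).1] at h2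

/-- An integrable function is an almost everywhere limit of compactly supported continuous ones. -/
theorem exists_seq_compactSupport {F : G → ℂ} (hF : Integrable F (Measure.haar : Measure G)) :
    ∃ k : ℕ → G → ℂ, (∀ n, Continuous (k n)) ∧ (∀ n, HasCompactSupport (k n)) ∧
      ∀ᵐ x ∂(Measure.haar : Measure G), Tendsto (fun n => k n x) atTop (𝓝 (F x)) := by
  choose k hks hk1 hkc hki using fun n : ℕ =>
    exists_compactSupport_haar hF (ε := 1 / (n + 1 : ℝ)) (by positivity)
  have hlim : Tendsto (fun n => eLpNorm (k n - F) 1 (Measure.haar : Measure G)) atTop (𝓝 0) := by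
    refine tendsto_of_tendsto_of_tendsto_of_le_of_le tendsto_const_nhds
      (h := fun n : ℕ => ENNReal.ofReal (1 / (n + 1 : ℝ))) ?_ (fun _ => bot_le) fun n => ?_
    · simpa using ENNReal.tendsto_ofReal tendsto_one_div_add_atTop_nhds_zero_nat
    · have hi : Integrable (fun y => F y - k n y) (Measure.haar : Measure G) := hF.sub (hki n)
      have e : k n - F = -(fun y => F y - k n y) := by
        funext y; simp
      rw [e, eLpNorm_neg, eLpNorm_one_eq_lintegral_enorm,
        ← ofReal_integral_norm_eq_lintegral_enorm hi]
      exact ENNReal.ofReal_le_ofReal (hk1 n)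
  obtain ⟨φ, -, hφ⟩ := (tendstoInMeasure_of_tendsto_eLpNorm one_ne_zero
    (fun n => (hki n).1) hF.1 hlim).exists_seq_tendsto_ae
  exact ⟨fun n => k (φ n), fun n => hkc _, fun n => hks _, hφ⟩

/-- A property that holds locally almost everywhere holds almost everywhere on the set where an
element of `L^1(G, ω)` does not vanish. -/
theorem L1.ae_of_locallyAE {ω : Weight G} (f : L1 ω) {P : G → Prop}
    (hP : ∀ᶠ x in locallyAE G, P x) : ∀ᵐ x ∂(Measure.haar : Measure G), f x ≠ 0 → P x := by
  obtain ⟨k, -, hks, hk⟩ := exists_seq_compactSupport ((memLp_iff ω f).1 f.memLp)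
  have h1 : ∀ᵐ x ∂(Measure.haar : Measure G), ∀ n, x ∈ tsupport (k n) → P x :=
    ae_all_iff.2 fun n => (ae_restrict_iff' (isClosed_tsupport _).measurableSet).1
      (eventually_locallyAE.1 hP _ (hks n))
  filter_upwards [hk, h1] with x hx h1x hfx
  by_contra hPx
  have h0 : ∀ n, k n x = 0 := fun n => by
    by_contra hn
    exact hPx (h1x n (subset_tsupport _ hn))
  simp only [h0] at hx
  have := tendsto_nhds_unique hx tendsto_const_nhds
  have hne : (ω x : ℂ) ≠ 0 := by exact_mod_cast (ω.pos x).ne'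
  exact (mul_ne_zero hne hfx) this

theorem exists_compactSupport (ω : Weight G) (f : L1 ω) {ε : ℝ} (hε : 0 < ε) :
    ∃ k : G → ℂ, ∃ hk : MemLp k 1 (wMeasure ω), Continuous k ∧ HasCompactSupport k ∧
      ‖f - L1.mk ω k hk‖ ≤ ε := by
  obtain ⟨g, hgc, hg1, hgcont, hgi⟩ :=
    exists_compactSupport_haar ((memLp_iff ω f).1 f.memLp) hε
  have hne : ∀ x, (ω x : ℂ) ≠ 0 := fun x => by exact_mod_cast (ω.pos x).ne'
  have hk : MemLp (fun x => (ω x : ℂ)⁻¹ * g x) 1 (wMeasure ω) := by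
    rw [memLp_iff]
    simpa [mul_inv_cancel_left₀ (hne _)] using hgi
  refine ⟨_, hk, ?_, hgc.mul_left, ?_⟩
  · exact ((Complex.continuous_ofReal.comp ω.continuous').inv₀ hne).mul hgcont
  · rw [L1.norm_eq_integral]
    refine le_trans (le_of_eq (integral_congr_ae ?_)) hg1
    have h1 := L1.coe_sub f (L1.mk ω _ hk)
    have h2 := L1.coe_mk ω hk
    rw [EventuallyEq, ae_wMeasure] at h1 h2
    filter_upwards [h1, h2] with x h1 h2
    rw [h1, Pi.sub_apply, h2]
    have : ω x = ‖(ω x : ℂ)‖ := by simp [abs_of_pos (ω.pos x)]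
    nth_rewrite 1 [this]
    rw [← norm_mul, mul_sub, mul_inv_cancel_left₀ (hne _)]

theorem continuous_translate_mk (ω : Weight G) {k : G → ℂ} (hk : MemLp k 1 (wMeasure ω))
    (hc : Continuous k) (hs : HasCompactSupport k) :
    Continuous fun y => translate ω y (L1.mk ω k hk) := by
  refine continuous_iff_continuousAt.2 fun z => ?_
  obtain ⟨S, hS, hzS⟩ := exists_compact_mem_nhds z
  set T : Set G := S * tsupport k with hT
  have hTc : IsCompact T := hS.mul hs
  have hz : z ∈ S := mem_of_mem_nhds hzS
  have hout : ∀ y ∈ S, ∀ x, x ∉ T → k (y⁻¹ * x) = 0 := fun y hy x hx => by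
    by_contra h
    exact hx ⟨y, hy, y⁻¹ * x, subset_tsupport k h, by simp⟩
  have hF := continuousOn_integral_of_compact_support
    (f := fun y x => ω x * ‖k (y⁻¹ * x) - k (z⁻¹ * x)‖) (μ := (Measure.haar : Measure G)) hTc (s := S)
    (by
      refine Continuous.continuousOn ?_
      have := ω.continuous'
      unfold Function.uncurry
      fun_prop)
    (fun y x hy hx => by simp [hout y hy x hx, hout z hz x hx])
  have hF' := hF.continuousAt hzS
  rw [ContinuousAt] at hF'
  rw [ContinuousAt, tendsto_iff_norm_sub_tendsto_zero]
  simp only [sub_self, norm_zero, mul_zero, integral_zero] at hF'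
  refine hF'.congr fun y => ?_
  rw [L1.norm_eq_integral]
  refine integral_congr_ae ?_
  have h0 := L1.coe_mk ω hk
  have h1 := L1.coe_sub (translate ω y (L1.mk ω k hk)) (translate ω z (L1.mk ω k hk))
  have h2 := coe_translate ω y (L1.mk ω k hk)
  have h3 := coe_translate ω z (L1.mk ω k hk)
  have h4 := (tendsto_translate_ae ω y).eventually h0
  have h5 := (tendsto_translate_ae ω z).eventually h0
  rw [← ae_wMeasure ω]
  filter_upwards [h1, h2, h3, h4, h5] with x h1 h2 h3 h4 h5
  rw [h1, Pi.sub_apply, h2, h3, h4, h5]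

theorem continuous_translate (ω : Weight G) (g : L1 ω) : Continuous fun y => translate ω y g := by
  refine continuous_iff_continuousAt.2 fun z => ?_
  have hb : ∀ᶠ y in 𝓝 z, ω y < ω z + 1 :=
    ω.continuous'.continuousAt.eventually_lt continuousAt_const (by linarith)
  rw [Metric.continuousAt_iff']
  intro ε hε
  have hM : 0 < ω z + 1 := by linarith [ω.pos z]
  obtain ⟨k, hk, hc, hs, hle⟩ := exists_compactSupport ω g (ε := ε / (4 * (ω z + 1))) (by positivity)
  have hkc := Metric.continuousAt_iff'.1
    ((continuous_translate_mk ω hk hc hs).continuousAt (x := z)) (ε / 2) (by positivity)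
  have key : ∀ y, ω y ≤ ω z + 1 → ‖translate ω y (g - L1.mk ω k hk)‖ ≤ ε / 4 := fun y hy => by
    refine (norm_translate_le ω y _).trans ?_
    refine (mul_le_mul hy hle (norm_nonneg _) hM.le).trans (le_of_eq ?_)
    field_simp
  filter_upwards [hb, hkc] with y hy hyk
  have h1 := key y hy.le
  have h2 := key z (by linarith)
  rw [dist_eq_norm] at hyk ⊢
  have : translate ω y g - translate ω z g = translate ω y (g - L1.mk ω k hk)
      + (translate ω y (L1.mk ω k hk) - translate ω z (L1.mk ω k hk))
      - translate ω z (g - L1.mk ω k hk) := by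
    simp only [map_sub]; abel
  rw [this]
  refine (norm_sub_le _ _).trans_lt ?_
  have := norm_add_le (translate ω y (g - L1.mk ω k hk))
    (translate ω y (L1.mk ω k hk) - translate ω z (L1.mk ω k hk))
  linarith

theorem integrable_smul_translate (ω : Weight G) (f g : L1 ω) :
    Integrable (fun y => f y • translate ω y g) (Measure.haar : Measure G) := by
  have hω := (memLp_iff ω f).1 f.memLp
  have hne : ∀ x, (ω x : ℂ) ≠ 0 := fun x => by exact_mod_cast (ω.pos x).ne'
  have hcont := continuous_translate ω g
  have hωc := ω.continuous'
  have hmeas : AEStronglyMeasurable (fun y => ((ω y : ℂ) * f y) • ((ω y : ℂ)⁻¹ • translate ω y g))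
      (Measure.haar : Measure G) := by
    have hq : Continuous fun y => (ω y : ℂ)⁻¹ • translate ω y g :=
      ((Complex.continuous_ofReal.comp ω.continuous').inv₀ hne).smul hcont
    obtain ⟨k, hkc, hks, hφ⟩ := exists_seq_compactSupport hω
    refine aestronglyMeasurable_of_tendsto_ae atTop
      (f := fun n y => k n y • ((ω y : ℂ)⁻¹ • translate ω y g)) (fun n => ?_) ?_
    · exact (((hkc _).smul hq).stronglyMeasurable_of_hasCompactSupport
        ((hks _).smul_right)).aestronglyMeasurable
    · filter_upwards [hφ] with y hy
      exact hy.smul_const _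
  have heq : (fun y => ((ω y : ℂ) * f y) • ((ω y : ℂ)⁻¹ • translate ω y g))
      = fun y => f y • translate ω y g := by
    funext y
    rw [smul_smul, mul_comm (ω y : ℂ), mul_assoc, mul_inv_cancel₀ (hne y), mul_one]
  rw [heq] at hmeas
  refine (hω.norm.mul_const ‖g‖).mono' hmeas (Eventually.of_forall fun y => ?_)
  rw [norm_smul, norm_mul, Complex.norm_real, Real.norm_eq_abs, abs_of_pos (ω.pos y)]
  nlinarith [norm_translate_le ω y g, norm_nonneg (f y)]

/-- Convolution `f * g = ∫ f(y) L_y g dy`, i.e. `(f * g)(x) = ∫ f(y) g(y⁻¹ x) dy`; the integral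
is an absolutely convergent Bochner integral in the Banach space `L^1(G, ω)`. -/
noncomputable def conv {ω : Weight G} (f g : L1 ω) : L1 ω :=
  ∫ y, f y • translate ω y g ∂(Measure.haar : Measure G)

theorem conv_add {ω : Weight G} (f g k : L1 ω) : conv f (g + k) = conv f g + conv f k := by
  unfold conv
  simp only [map_add, smul_add]
  exact integral_add (integrable_smul_translate ω f g) (integrable_smul_translate ω f k)

theorem add_conv {ω : Weight G} (f g k : L1 ω) : conv (f + g) k = conv f k + conv g k := by
  unfold conv
  rw [← integral_add (integrable_smul_translate ω f k) (integrable_smul_translate ω g k)]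
  refine integral_congr_ae ?_
  have h := L1.coe_add f g
  rw [EventuallyEq, ae_wMeasure] at h
  filter_upwards [h] with y hy
  rw [hy, Pi.add_apply, add_smul]

theorem conv_smul {ω : Weight G} (c : ℂ) (f g : L1 ω) : conv f (c • g) = c • conv f g := by
  unfold conv
  simp only [map_smul, smul_comm _ c]
  exact integral_smul c _

theorem smul_conv {ω : Weight G} (c : ℂ) (f g : L1 ω) : conv (c • f) g = c • conv f g := by
  unfold conv
  rw [← integral_smul]
  refine integral_congr_ae ?_
  have h := L1.coe_smul c f
  rw [EventuallyEq, ae_wMeasure] at h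
  filter_upwards [h] with y hy
  rw [hy, Pi.smul_apply, smul_assoc]

theorem norm_conv_le {ω : Weight G} (f g : L1 ω) : ‖conv f g‖ ≤ ‖f‖ * ‖g‖ := by
  unfold conv
  have hω := (memLp_iff ω f).1 f.memLp
  rw [L1.norm_eq_integral f, ← integral_mul_const]
  have h1 : Integrable (fun y => ω y * ‖f y‖) (Measure.haar : Measure G) := by
    refine hω.norm.congr (Eventually.of_forall fun y => ?_)
    simp [abs_of_pos (ω.pos y)]
  refine norm_integral_le_of_norm_le (h1.mul_const ‖g‖) (Eventually.of_forall fun y => ?_)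
  rw [norm_smul]
  nlinarith [norm_translate_le ω y g, norm_nonneg (f y)]

theorem translate_conv {ω : Weight G} (y : G) (f g : L1 ω) :
    translate ω y (conv f g) = conv (translate ω y f) g := by
  unfold conv
  rw [← ContinuousLinearMap.integral_comp_comm _ (integrable_smul_translate ω f g)]
  have h := coe_translate ω y f
  rw [EventuallyEq, ae_wMeasure] at h
  rw [integral_congr_ae (f := fun z => translate ω y f z • translate ω z g)
    (g := fun z => f (y⁻¹ * z) • translate ω z g)
    (by filter_upwards [h] with z hz; rw [hz])]
  rw [← integral_mul_left_eq_self (fun z => f (y⁻¹ * z) • translate ω z g) y]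
  simp only [map_smul, translate_mul, inv_mul_cancel_left]

/-- Right convolution by `g` as a bounded operator. -/
noncomputable def convRight {ω : Weight G} (g : L1 ω) : L1 ω →L[ℂ] L1 ω :=
  LinearMap.mkContinuous
    { toFun := fun f => conv f g
      map_add' := fun f k => add_conv f k g
      map_smul' := fun c f => smul_conv c f g }
    ‖g‖ (fun f => by rw [mul_comm]; exact norm_conv_le f g)

theorem conv_assoc {ω : Weight G} (f g k : L1 ω) : conv (conv f g) k = conv f (conv g k) := by
  change convRight k (conv f g) = _
  unfold conv
  rw [← ContinuousLinearMap.integral_comp_comm _ (integrable_smul_translate ω f g)]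
  refine integral_congr_ae (Eventually.of_forall fun y => ?_)
  change convRight k (f y • translate ω y g) = f y • translate ω y (conv g k)
  rw [map_smul, translate_conv]
  rfl

/-- The Banach algebra structure of `L^1(G, ω)`, with convolution as product. -/
noncomputable instance (ω : Weight G) : NonUnitalNormedRing (L1 ω) :=
  { (inferInstance : NormedAddCommGroup (L1 ω)) with
    mul := conv
    left_distrib := conv_add
    right_distrib := add_conv
    zero_mul := fun f => (convRight f).map_zero
    mul_zero := fun f => by
      have h := conv_smul 0 f 0
      rw [zero_smul, zero_smul] at h
      exact h
    mul_assoc := conv_assoc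
    norm_mul_le := norm_conv_le }

instance (ω : Weight G) : IsScalarTower ℂ (L1 ω) (L1 ω) := ⟨fun c f g => smul_conv c f g⟩

instance (ω : Weight G) : SMulCommClass ℂ (L1 ω) (L1 ω) := ⟨fun c f g => (conv_smul c f g).symm⟩

theorem integrable_mul_linf {ω : Weight G} (h : Linf ω) (f : L1 ω) :
    Integrable (fun x => f x * h x) (Measure.haar : Measure G) ∧
      ∀ᵐ x ∂(Measure.haar : Measure G), ‖f x * h x‖ ≤ ‖h‖ * (ω x * ‖f x‖) := by
  have hω := (memLp_iff ω f).1 f.memLp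
  have hb : ∀ᵐ x ∂(Measure.haar : Measure G), ‖f x * h x‖ ≤ ‖h‖ * (ω x * ‖f x‖) := by
    filter_upwards [f.ae_of_locallyAE h.bound] with x hx
    rcases eq_or_ne (f x) 0 with h0 | h0
    · simp [h0]
    · rw [norm_mul]
      nlinarith [hx h0, norm_nonneg (f x)]
  have h1 : Integrable (fun y => ω y * ‖f y‖) (Measure.haar : Measure G) := by
    refine hω.norm.congr (Eventually.of_forall fun y => ?_)
    simp [abs_of_pos (ω.pos y)]
  have hfm : AEStronglyMeasurable f.rep (Measure.haar : Measure G) := by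
    have hne : ∀ x, (ω x : ℂ) ≠ 0 := fun x => by exact_mod_cast (ω.pos x).ne'
    have hi : Continuous fun x => (ω x : ℂ)⁻¹ :=
      (Complex.continuous_ofReal.comp ω.continuous').inv₀ hne
    refine (hi.measurable.aestronglyMeasurable.mul hω.1).congr (Eventually.of_forall fun x => ?_)
    simp [inv_mul_cancel_left₀ (hne x)]
  have hhm : Measurable h.rep := by
    obtain rfl : ‹MeasurableSpace G› = borel G := BorelSpace.measurable_eq
    exact h.memLinf.1
  exact ⟨(h1.const_mul ‖h‖).mono' (hfm.mul hhm.aestronglyMeasurable) hb, hb⟩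

/-- The duality between `L^∞(G, 1/ω)` and `L^1(G, ω)`. -/
noncomputable def pairing {ω : Weight G} (h : Linf ω) (f : L1 ω) : ℂ :=
  ∫ x, f x * h x ∂(Measure.haar : Measure G)

theorem pairing_add {ω : Weight G} (h : Linf ω) (f g : L1 ω) :
    pairing h (f + g) = pairing h f + pairing h g := by
  unfold pairing
  rw [← integral_add (integrable_mul_linf h f).1 (integrable_mul_linf h g).1]
  refine integral_congr_ae ?_
  have e := L1.coe_add f g
  rw [EventuallyEq, ae_wMeasure] at e
  filter_upwards [e] with y hy
  rw [hy, Pi.add_apply, add_mul]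

theorem pairing_smul {ω : Weight G} (h : Linf ω) (c : ℂ) (f : L1 ω) :
    pairing h (c • f) = c • pairing h f := by
  rw [smul_eq_mul]
  unfold pairing
  rw [← integral_const_mul]
  refine integral_congr_ae ?_
  have e := L1.coe_smul c f
  rw [EventuallyEq, ae_wMeasure] at e
  filter_upwards [e] with y hy
  rw [hy, Pi.smul_apply, smul_eq_mul, mul_assoc]

theorem pairing_eq {ω : Weight G} {h : Linf ω} {k : G → ℂ} (e : h.rep =ᶠ[locallyAE G] k)
    (f : L1 ω) : pairing h f = ∫ x, f x * k x ∂(Measure.haar : Measure G) := by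
  refine integral_congr_ae ?_
  filter_upwards [f.ae_of_locallyAE e] with x hx
  rcases eq_or_ne (f x) 0 with h0 | h0
  · simp [h0]
  · rw [hx h0]

theorem add_pairing {ω : Weight G} (h k : Linf ω) (f : L1 ω) :
    pairing (h + k) f = pairing h f + pairing k f := by
  rw [pairing_eq (Linf.coe_add h k)]
  unfold pairing
  rw [← integral_add (integrable_mul_linf h f).1 (integrable_mul_linf k f).1]
  simp [mul_add]

theorem smul_pairing {ω : Weight G} (c : ℂ) (h : Linf ω) (f : L1 ω) :
    pairing (c • h) f = c • pairing h f := by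
  rw [pairing_eq (Linf.coe_smul c h), smul_eq_mul]
  unfold pairing
  rw [← integral_const_mul]
  simp [mul_left_comm]

theorem norm_pairing_le {ω : Weight G} (h : Linf ω) (f : L1 ω) :
    ‖pairing h f‖ ≤ ‖h‖ * ‖f‖ := by
  have hω := (memLp_iff ω f).1 f.memLp
  have h1 : Integrable (fun y => ω y * ‖f y‖) (Measure.haar : Measure G) := by
    refine hω.norm.congr (Eventually.of_forall fun y => ?_)
    simp [abs_of_pos (ω.pos y)]
  rw [L1.norm_eq_integral f, ← integral_const_mul]
  exact norm_integral_le_of_norm_le (h1.const_mul ‖h‖) (integrable_mul_linf h f).2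

/-- The canonical map `L^∞(G, 1/ω) → L^1(G, ω)^*`, `⟨h, f⟩ = ∫ f(x) h(x) dx`. -/
noncomputable def toDual (ω : Weight G) : Linf ω →L[ℂ] StrongDual ℂ (L1 ω) :=
  LinearMap.mkContinuous₂
    (LinearMap.mk₂ ℂ pairing add_pairing smul_pairing pairing_add
      fun c h f => pairing_smul h c f) 1
    (fun h f => by rw [one_mul]; exact norm_pairing_le h f)

theorem toDual_apply {ω : Weight G} (h : Linf ω) (f : L1 ω) :
    toDual ω h f = ∫ x, f x * h x ∂(Measure.haar : Measure G) := rfl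

/-- The product of `L^1(G, ω)` in terms of the duality: `⟨h, f * g⟩ = ∫∫ f(y) g(x) h(yx) dx dy`. -/
theorem toDual_mul {ω : Weight G} (h : Linf ω) (f g : L1 ω) :
    toDual ω h (f * g) = ∫ y, f y * ∫ x, g x * h (y * x) ∂(Measure.haar : Measure G)
      ∂(Measure.haar : Measure G) := by
  have h1 : f * g = ∫ y, f y • translate ω y g ∂(Measure.haar : Measure G) := rfl
  rw [h1, ← ContinuousLinearMap.integral_comp_comm _ (integrable_smul_translate ω f g)]
  refine integral_congr_ae (Eventually.of_forall fun y => ?_)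
  simp only [map_smul, smul_eq_mul, toDual_apply]
  congr 1
  have e := coe_translate ω y g
  rw [EventuallyEq, ae_wMeasure] at e
  rw [integral_congr_ae (g := fun x => g (y⁻¹ * x) * h x)
    (by filter_upwards [e] with x hx; rw [hx]),
    ← integral_mul_left_eq_self (fun x => g (y⁻¹ * x) * h x) y]
  simp only [inv_mul_cancel_left]

end Group

end Beurling

/-
A bounded bilinear form on `L^1(G, ω)` is integration against a Borel kernel `p(x, y)` that is
bounded by a multiple of `ω(x) ω(y)`: smear the form with an approximate identity in each variable,
translate, and pass to a cluster point in the dual of `L^1(G × G, ω × ω)`. Under this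
correspondence the derivation identity is quasi-additivity of `p`, and a derivation is inner exactly
when `p(x, y) = h(xy) - h(yx)`, because `L^1(G, ω)^*` is `L^∞(G, 1/ω)`.

No σ-compactness is assumed. The dual is computed on the cosets of an open σ-compact subgroup and
the densities are glued. Since the Borel σ-algebra of `G × G` may exceed the product σ-algebra,
Haar measure there is compared, inside rectangles of σ-compact sets, with the iterated integral,
whose uniqueness up to a constant replaces the theorem of Fubini.
-/

open scoped ProbabilityTheory

namespace Beurling

/-- The product of two topological spaces, carrying the Borel σ-algebra of the product topology.
Without countability assumptions this is larger than the product of the two Borel σ-algebras. -/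
def BProd (G H : Type*) : Type _ := G × H

namespace BProd

variable {G H : Type*}

instance [Group G] [Group H] : Group (BProd G H) := inferInstanceAs (Group (G × H))

instance [TopologicalSpace G] [TopologicalSpace H] : TopologicalSpace (BProd G H) :=
  inferInstanceAs (TopologicalSpace (G × H))

instance [Group G] [TopologicalSpace G] [IsTopologicalGroup G] [Group H] [TopologicalSpace H]
    [IsTopologicalGroup H] : IsTopologicalGroup (BProd G H) :=
  inferInstanceAs (IsTopologicalGroup (G × H))

instance [TopologicalSpace G] [LocallyCompactSpace G] [TopologicalSpace H]
    [LocallyCompactSpace H] : LocallyCompactSpace (BProd G H) :=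
  inferInstanceAs (LocallyCompactSpace (G × H))

instance [TopologicalSpace G] [T2Space G] [TopologicalSpace H] [T2Space H] :
    T2Space (BProd G H) := inferInstanceAs (T2Space (G × H))

instance [TopologicalSpace G] [TopologicalSpace H] : MeasurableSpace (BProd G H) :=
  borel (BProd G H)

instance [TopologicalSpace G] [TopologicalSpace H] : BorelSpace (BProd G H) := ⟨rfl⟩

/-- The pair `(x, y)` as a point of the Borel product. -/
def mk (x : G) (y : H) : BProd G H := (x, y)

/-- The first coordinate of a point of the Borel product. -/
def fst (p : BProd G H) : G := Prod.fst p

/-- The second coordinate of a point of the Borel product. -/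
def snd (p : BProd G H) : H := Prod.snd p

@[simp] theorem fst_mk (x : G) (y : H) : (mk x y).fst = x := rfl

@[simp] theorem snd_mk (x : G) (y : H) : (mk x y).snd = y := rfl

variable [TopologicalSpace G] [TopologicalSpace H]

theorem continuous_fst : Continuous (fst : BProd G H → G) := _root_.continuous_fst

theorem continuous_snd : Continuous (snd : BProd G H → H) := _root_.continuous_snd

theorem continuous_mk {X : Type*} [TopologicalSpace X] {f : X → G} {g : X → H}
    (hf : Continuous f) (hg : Continuous g) : Continuous fun x => mk (f x) (g x) :=
  hf.prodMk hg

/-- The exchange of coordinates, as a homeomorphism of Borel products. -/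
def swap : BProd G H ≃ₜ BProd H G := Homeomorph.prodComm G H

theorem measurable_fst [MeasurableSpace G] [BorelSpace G] : Measurable (fst : BProd G H → G) :=
  continuous_fst.measurable

theorem measurable_snd [MeasurableSpace H] [BorelSpace H] : Measurable (snd : BProd G H → H) :=
  continuous_snd.measurable

theorem measurable_mk_left [MeasurableSpace H] [BorelSpace H] (x : G) :
    Measurable (mk x : H → BProd G H) :=
  (continuous_mk continuous_const continuous_id).measurable

end BProd

section Rect

variable {G H : Type*}

/-- The product of two subsets, as a subset of the Borel product. -/
def rect (S : Set G) (T : Set H) : Set (BProd G H) := {p | p.fst ∈ S ∧ p.snd ∈ T}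

theorem mem_rect {S : Set G} {T : Set H} {p : BProd G H} :
    p ∈ rect S T ↔ p.fst ∈ S ∧ p.snd ∈ T := Iff.rfl

theorem subset_rect_image (Q : Set (BProd G H)) :
    Q ⊆ rect (BProd.fst '' Q) (BProd.snd '' Q) :=
  fun p hp => ⟨⟨p, hp, rfl⟩, ⟨p, hp, rfl⟩⟩

variable [TopologicalSpace G] [TopologicalSpace H]

theorem isCompact_rect {S : Set G} {T : Set H} (hS : IsCompact S) (hT : IsCompact T) :
    IsCompact (rect S T) := hS.prod hT

theorem isOpen_rect {S : Set G} {T : Set H} (hS : IsOpen S) (hT : IsOpen T) :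
    IsOpen (rect S T) := hS.prod hT

theorem measurableSet_rect [MeasurableSpace G] [BorelSpace G] [MeasurableSpace H]
    [BorelSpace H] {S : Set G} {T : Set H} (hS : MeasurableSet S) (hT : MeasurableSet T) :
    MeasurableSet (rect S T) :=
  (BProd.measurable_fst hS).inter (BProd.measurable_snd hT)

end Rect

section CompactlyCovered

variable {X : Type*} [TopologicalSpace X] [MeasurableSpace X]

/-- A measurable set covered by countably many compact sets: the sets on which a Borel measure
finite on compact sets is controlled by its values inside compact sets. -/
structure CompactlyCovered (T : Set X) : Prop where
  measurableSet : MeasurableSet T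
  cover : ∃ K : ℕ → Set X, (∀ n, IsCompact (K n)) ∧ T ⊆ ⋃ n, K n

theorem CompactlyCovered.of_isCompact [T2Space X] [BorelSpace X] {K : Set X} (hK : IsCompact K) :
    CompactlyCovered K :=
  ⟨hK.measurableSet, fun _ => K, fun _ => hK, Set.subset_iUnion (fun _ : ℕ => K) 0⟩

theorem CompactlyCovered.inter {S T : Set X} (hS : CompactlyCovered S) (hT : MeasurableSet T) :
    CompactlyCovered (S ∩ T) :=
  let ⟨K, hK, hSK⟩ := hS.cover
  ⟨hS.measurableSet.inter hT, K, hK, Set.inter_subset_left.trans hSK⟩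

theorem CompactlyCovered.exists_monotone_cover {T : Set X} (hT : CompactlyCovered T) :
    ∃ K : ℕ → Set X, Monotone K ∧ (∀ n, IsCompact (K n)) ∧ T ⊆ ⋃ n, K n := by
  obtain ⟨K, hK, hTK⟩ := hT.cover
  exact ⟨Set.accumulate K, Set.monotone_accumulate, fun n => isCompact_accumulate hK n,
    hTK.trans_eq Set.iUnion_accumulate.symm⟩

theorem CompactlyCovered.restrict_congr {T : Set X} (hT : CompactlyCovered T) {μ ν : Measure X}
    (h : ∀ K, IsCompact K → μ.restrict K = ν.restrict K) : μ.restrict T = ν.restrict T := by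
  obtain ⟨K, hK, hTK⟩ := hT.cover
  have hU : μ.restrict (⋃ n, K n) = ν.restrict (⋃ n, K n) :=
    Measure.restrict_iUnion_congr.2 fun n => h (K n) (hK n)
  rw [← Measure.restrict_restrict_of_subset hTK, hU, Measure.restrict_restrict_of_subset hTK]

theorem CompactlyCovered.rect {G H : Type*} [TopologicalSpace G] [MeasurableSpace G] [BorelSpace G]
    [TopologicalSpace H] [MeasurableSpace H] [BorelSpace H] {S : Set G} {T : Set H}
    (hS : CompactlyCovered S) (hT : CompactlyCovered T) : CompactlyCovered (rect S T) := by
  obtain ⟨K, hKm, hK, hSK⟩ := hS.exists_monotone_cover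
  obtain ⟨L, hLm, hL, hTL⟩ := hT.exists_monotone_cover
  refine ⟨measurableSet_rect hS.measurableSet hT.measurableSet, fun n => Beurling.rect (K n) (L n),
    fun n => isCompact_rect (hK n) (hL n), fun p hp => ?_⟩
  obtain ⟨m, hm⟩ := Set.mem_iUnion.1 (hSK hp.1)
  obtain ⟨n, hn⟩ := Set.mem_iUnion.1 (hTL hp.2)
  exact Set.mem_iUnion.2 ⟨max m n, hKm (le_max_left m n) hm, hLm (le_max_right m n) hn⟩

end CompactlyCovered

section SectionKernel

variable {G H : Type*} [TopologicalSpace G] [TopologicalSpace H] [MeasurableSpace H]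
  [BorelSpace H] (ν : Measure H)

theorem map_mk_restrict_apply (T : Set H) (x : G) {B : Set (BProd G H)} (hB : MeasurableSet B) :
    (ν.restrict T).map (BProd.mk x) B = ν (BProd.mk x ⁻¹' B ∩ T) := by
  rw [Measure.map_apply (BProd.measurable_mk_left x) hB,
    Measure.restrict_apply (BProd.measurable_mk_left x hB)]

variable [T2Space H] [ν.InnerRegularCompactLTTop] [IsFiniteMeasureOnCompacts ν]

theorem lowerSemicontinuous_measure_section {L : Set H} (hL : IsCompact L) {U : Set (BProd G H)}
    (hU : IsOpen U) : LowerSemicontinuous fun x : G => ν (BProd.mk x ⁻¹' U ∩ L) := by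
  intro x a ha
  have hm : MeasurableSet (BProd.mk x ⁻¹' U ∩ L) :=
    (BProd.measurable_mk_left x hU.measurableSet).inter hL.measurableSet
  have hfin : ν (BProd.mk x ⁻¹' U ∩ L) ≠ ∞ :=
    ((measure_mono Set.inter_subset_right).trans_lt hL.measure_lt_top).ne
  obtain ⟨C, hC, hCc, haC⟩ := hm.exists_lt_isCompact_of_ne_top hfin ha
  have hsub : ({x} : Set G) ×ˢ C ⊆ U := by
    rintro ⟨_, y⟩ ⟨rfl, hy⟩
    exact (hC hy).1
  obtain ⟨W, V, hW, -, hxW, hCV, hWV⟩ :=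
    generalized_tube_lemma (isCompact_singleton (x := x)) hCc hU hsub
  filter_upwards [hW.mem_nhds (hxW rfl)] with x' hx'
  exact haC.trans_le (measure_mono fun y hy => ⟨hWV (Set.mk_mem_prod hx' (hCV hy)), (hC hy).2⟩)

variable [MeasurableSpace G] [BorelSpace G]

theorem measurable_map_mk_restrict_of_isCompact {L : Set H} (hL : IsCompact L) :
    Measurable fun x : G => (ν.restrict L).map (BProd.mk x) := by
  have : IsFiniteMeasure (ν.restrict L) := ⟨by simpa using hL.measure_lt_top⟩
  refine Measurable.measure_of_isPiSystem (S := {U | IsOpen U}) rfl isPiSystem_isOpen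
    (fun U hU => ?_) ?_
  · have hUm : MeasurableSet U := IsOpen.measurableSet (by exact hU)
    simp only [map_mk_restrict_apply ν L _ hUm]
    exact (lowerSemicontinuous_measure_section ν hL hU).measurable
  · simp only [map_mk_restrict_apply ν L _ MeasurableSet.univ, Set.preimage_univ]
    exact measurable_const

theorem measurable_map_mk_restrict {T : Set H} (hT : CompactlyCovered T) :
    Measurable fun x : G => (ν.restrict T).map (BProd.mk x) := by
  obtain ⟨K, hKm, hK, hTK⟩ := hT.exists_monotone_cover
  refine Measure.measurable_of_measurable_coe _ fun B hB => ?_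
  have hBT : MeasurableSet (B ∩ rect Set.univ T : Set (BProd G H)) :=
    hB.inter (measurableSet_rect MeasurableSet.univ hT.measurableSet)
  have hsup : ∀ x : G, (ν.restrict T).map (BProd.mk x) B =
      ⨆ n, (ν.restrict (K n)).map (BProd.mk x) (B ∩ rect Set.univ T) := fun x => by
    have hunion : BProd.mk x ⁻¹' B ∩ T =
        ⋃ n, BProd.mk x ⁻¹' (B ∩ rect Set.univ T) ∩ K n := by
      rw [← Set.inter_iUnion, Set.preimage_inter, Set.inter_assoc,
        show BProd.mk x ⁻¹' rect Set.univ T = T by ext; simp [mem_rect],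
        Set.inter_eq_left.2 hTK]
    simp only [map_mk_restrict_apply ν _ x hB, map_mk_restrict_apply ν _ x hBT]
    rw [hunion]
    exact Monotone.measure_iUnion fun m n hmn => Set.inter_subset_inter_right _ (hKm hmn)
  simp only [hsup]
  exact Measurable.iSup fun n =>
    (Measure.measurable_coe hBT).comp (measurable_map_mk_restrict_of_isCompact ν (hK n))

variable (G) in
/-- The kernel `x ↦ δ_x ⊗ ν|_T` on the Borel product. -/
noncomputable def sectionKernel {T : Set H} (hT : CompactlyCovered T) :
    ProbabilityTheory.Kernel G (BProd G H) where
  toFun x := (ν.restrict T).map (BProd.mk x)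
  measurable' := measurable_map_mk_restrict ν hT

theorem sectionKernel_apply {T : Set H} (hT : CompactlyCovered T) (x : G) :
    sectionKernel G ν hT x = (ν.restrict T).map (BProd.mk x) := rfl

end SectionKernel

section IteratedMeasure

variable {G H : Type*} [TopologicalSpace G] [MeasurableSpace G] [BorelSpace G]
  [TopologicalSpace H] [MeasurableSpace H] [BorelSpace H]

/-- The measure `B ↦ ∫ x in S, ν {y ∈ T | (x, y) ∈ B} ∂μ` on the Borel product. It is only
meaningful when the integrand is measurable, as it is for compactly covered `T`. -/
noncomputable def iteratedMeasure (μ : Measure G) (ν : Measure H) (S : Set G) (T : Set H) :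
    Measure (BProd G H) :=
  (μ.restrict S).bind fun x => (ν.restrict T).map (BProd.mk x)

variable [T2Space H] {μ : Measure G} {ν : Measure H} [ν.InnerRegularCompactLTTop]
  [IsFiniteMeasureOnCompacts ν] {S : Set G} {T : Set H}

theorem iteratedMeasure_apply (hT : CompactlyCovered T) {B : Set (BProd G H)}
    (hB : MeasurableSet B) :
    iteratedMeasure μ ν S T B = ∫⁻ x in S, ν (BProd.mk x ⁻¹' B ∩ T) ∂μ := by
  rw [iteratedMeasure, Measure.bind_apply hB (measurable_map_mk_restrict ν hT).aemeasurable]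
  simp only [map_mk_restrict_apply ν T _ hB]

theorem iteratedMeasure_mono {S' : Set G} {T' : Set H} (hT : CompactlyCovered T)
    (hT' : CompactlyCovered T') (hSS' : S ⊆ S') (hTT' : T ⊆ T') :
    iteratedMeasure μ ν S T ≤ iteratedMeasure μ ν S' T' := by
  refine Measure.le_iff.2 fun B hB => ?_
  rw [iteratedMeasure_apply hT hB, iteratedMeasure_apply hT' hB]
  exact lintegral_mono' (Measure.restrict_mono hSS' le_rfl) fun x =>
    measure_mono (Set.inter_subset_inter_right _ hTT')

theorem iteratedMeasure_restrict_rect {S' : Set G} {T' : Set H} (hT : CompactlyCovered T)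
    (hS' : MeasurableSet S') (hT' : MeasurableSet T') :
    (iteratedMeasure μ ν S T).restrict (rect S' T') =
      iteratedMeasure μ ν (S' ∩ S) (T ∩ T') := by
  refine Measure.ext fun B hB => ?_
  have hsec : ∀ x : G, ν (BProd.mk x ⁻¹' (B ∩ rect S' T') ∩ T) =
      S'.indicator (fun x => ν (BProd.mk x ⁻¹' B ∩ (T ∩ T'))) x := fun x => by
    by_cases hx : x ∈ S'
    · rw [Set.indicator_of_mem hx]
      congr 1
      ext y
      simp [mem_rect, hx, and_assoc, and_comm]
    · rw [Set.indicator_of_notMem hx, ← measure_empty (μ := ν)]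
      congr 1
      ext y
      simp [mem_rect, hx]
  rw [Measure.restrict_apply hB, iteratedMeasure_apply hT (hB.inter (measurableSet_rect hS' hT')),
    iteratedMeasure_apply (hT.inter hT') hB, ← Measure.restrict_restrict hS',
    ← lintegral_indicator hS']
  simp only [hsec]

theorem iteratedMeasure_preimage_mul [Group G] [IsTopologicalGroup G] [Group H]
    [IsTopologicalGroup H] [μ.IsMulLeftInvariant] [ν.IsMulLeftInvariant] (hT : IsCompact T)
    (g : BProd G H) {B : Set (BProd G H)} (hB : MeasurableSet B) :
    iteratedMeasure μ ν S T ((g * ·) ⁻¹' B) = iteratedMeasure μ ν (g.fst • S) (g.snd • T) B := by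
  have hsec : ∀ x : G, ν (BProd.mk x ⁻¹' ((g * ·) ⁻¹' B) ∩ T) =
      ν (BProd.mk (g.fst * x) ⁻¹' B ∩ g.snd • T) := fun x => by
    rw [← measure_smul ν g.snd]
    congr 1
    ext y
    simp only [Set.mem_smul_set_iff_inv_smul_mem, Set.mem_inter_iff, Set.mem_preimage,
      show g * BProd.mk x (g.snd⁻¹ • y) = BProd.mk (g.fst * x) y from
        congrArg (BProd.mk (g.fst * x)) (mul_inv_cancel_left g.snd y)]
  have hS : S = (g.fst * ·) ⁻¹' (g.fst • S) := 
    (Set.preimage_image_eq S (mul_right_injective g.fst)).symm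
  rw [iteratedMeasure_apply (.of_isCompact hT) (continuous_const_mul g |>.measurable hB),
    iteratedMeasure_apply (.of_isCompact (hT.smul _)) hB]
  simp only [hsec]
  conv_lhs => rw [hS]
  exact (measurePreserving_mul_left μ g.fst).setLIntegral_comp_preimage_emb
    (measurableEmbedding_mulLeft g.fst) (fun x => ν (BProd.mk x ⁻¹' B ∩ g.snd • T)) _

end IteratedMeasure

section ProductMeasure

open TopologicalSpace

variable {G H : Type*} [TopologicalSpace G] [MeasurableSpace G] [BorelSpace G]
  [TopologicalSpace H] [T2Space H] [MeasurableSpace H] [BorelSpace H]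
  (μ : Measure G) (ν : Measure H) [ν.InnerRegularCompactLTTop] [IsFiniteMeasureOnCompacts ν]

theorem monotone_iteratedMeasure_compacts :
    Monotone fun q : Compacts G × Compacts H => iteratedMeasure μ ν (q.1 : Set G) (q.2 : Set H) :=
  fun p q h => iteratedMeasure_mono (.of_isCompact p.2.isCompact) (.of_isCompact q.2.isCompact)
    h.1 h.2

/-- The Borel measure on the product obtained by iterated integration over compact rectangles. -/
noncomputable def productMeasure : Measure (BProd G H) :=
  Measure.ofMeasurable
    (fun B _ => ⨆ q : Compacts G × Compacts H, iteratedMeasure μ ν (q.1 : Set G) (q.2 : Set H) B)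
    (by simp) (by
      intro f hf hd
      simp only [measure_iUnion hd hf]
      simp_rw [ENNReal.tsum_eq_iSup_sum]
      rw [iSup_comm]
      refine iSup_congr fun s => ?_
      rw [ENNReal.finsetSum_iSup]
      exact fun p q => ⟨p ⊔ q, fun i => ⟨monotone_iteratedMeasure_compacts μ ν le_sup_left _,
        monotone_iteratedMeasure_compacts μ ν le_sup_right _⟩⟩)

theorem productMeasure_apply {B : Set (BProd G H)} (hB : MeasurableSet B) :
    productMeasure μ ν B =
      ⨆ q : Compacts G × Compacts H, iteratedMeasure μ ν (q.1 : Set G) (q.2 : Set H) B :=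
  Measure.ofMeasurable_apply B hB

variable [T2Space G]

theorem productMeasure_restrict_rect_of_isCompact {K : Set G} {L : Set H} (hK : IsCompact K)
    (hL : IsCompact L) :
    (productMeasure μ ν).restrict (rect K L) = iteratedMeasure μ ν K L := by
  have hrect := measurableSet_rect hK.measurableSet hL.measurableSet
  refine Measure.ext fun B hB => ?_
  have hinter : ∀ q : Compacts G × Compacts H,
      iteratedMeasure μ ν (q.1 : Set G) (q.2 : Set H) (B ∩ rect K L) =
        iteratedMeasure μ ν (K ∩ q.1) (q.2 ∩ L) B := fun q => by
    rw [← Measure.restrict_apply hB, iteratedMeasure_restrict_rect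
      (.of_isCompact q.2.isCompact) hK.measurableSet hL.measurableSet]
  rw [Measure.restrict_apply hB, productMeasure_apply μ ν (hB.inter hrect)]
  simp only [hinter]
  refine le_antisymm (iSup_le fun q => ?_) (le_iSup_of_le (⟨K, hK⟩, ⟨L, hL⟩) ?_)
  · exact iteratedMeasure_mono ((CompactlyCovered.of_isCompact q.2.isCompact).inter
      hL.measurableSet) (.of_isCompact hL) Set.inter_subset_left Set.inter_subset_right B
  · simp only [Compacts.coe_mk, Set.inter_self, le_refl]

theorem productMeasure_restrict_rect {S : Set G} {T : Set H} (hS : CompactlyCovered S)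
    (hT : CompactlyCovered T) :
    (productMeasure μ ν).restrict (rect S T) = iteratedMeasure μ ν S T := by
  have hrect := measurableSet_rect hS.measurableSet hT.measurableSet
  have hcompact : ∀ Q, IsCompact Q → ((productMeasure μ ν).restrict (rect S T)).restrict Q =
      (iteratedMeasure μ ν S T).restrict Q := fun Q hQ => by
    have hK := hQ.image BProd.continuous_fst
    have hL := hQ.image BProd.continuous_snd
    have hKL := measurableSet_rect hK.measurableSet hL.measurableSet
    rw [← Measure.restrict_restrict_of_subset (subset_rect_image Q),
      ← Measure.restrict_restrict_of_subset (μ := iteratedMeasure μ ν S T) (subset_rect_image Q),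
      Measure.restrict_comm hKL, productMeasure_restrict_rect_of_isCompact μ ν hK hL,
      iteratedMeasure_restrict_rect (.of_isCompact hL) hS.measurableSet hT.measurableSet,
      iteratedMeasure_restrict_rect hT hK.measurableSet hL.measurableSet,
      Set.inter_comm S, Set.inter_comm T]
  have h := (hS.rect hT).restrict_congr hcompact
  rwa [Measure.restrict_restrict hrect, Set.inter_self,
    iteratedMeasure_restrict_rect hT hS.measurableSet hT.measurableSet, Set.inter_self,
    Set.inter_self] at h

theorem productMeasure_rect {K : Set G} {L : Set H} (hK : IsCompact K) (hL : IsCompact L) :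
    productMeasure μ ν (rect K L) = μ K * ν L := by
  rw [← Measure.restrict_apply_univ, productMeasure_restrict_rect_of_isCompact μ ν hK hL,
    iteratedMeasure_apply (.of_isCompact hL) MeasurableSet.univ]
  simp [mul_comm]

instance [IsFiniteMeasureOnCompacts μ] : IsFiniteMeasureOnCompacts (productMeasure μ ν) :=
  ⟨fun {Q} hQ => by
    have hK := hQ.image BProd.continuous_fst
    have hL := hQ.image BProd.continuous_snd
    refine (measure_mono (subset_rect_image Q)).trans_lt ?_
    rw [productMeasure_rect μ ν hK hL]
    exact ENNReal.mul_lt_top hK.measure_lt_top hL.measure_lt_top⟩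

end ProductMeasure

section Haar

open TopologicalSpace

variable {G H : Type*} [Group G] [TopologicalSpace G] [IsTopologicalGroup G]
  [MeasurableSpace G] [BorelSpace G] [Group H] [TopologicalSpace H] [IsTopologicalGroup H]
  [T2Space H] [MeasurableSpace H] [BorelSpace H]

section Invariance

variable (μ : Measure G) (ν : Measure H) [ν.InnerRegularCompactLTTop]

theorem productMeasure_preimage_mul_le [IsFiniteMeasureOnCompacts ν] [μ.IsMulLeftInvariant]
    [ν.IsMulLeftInvariant] (g : BProd G H) {B : Set (BProd G H)} (hB : MeasurableSet B) :
    productMeasure μ ν ((g * ·) ⁻¹' B) ≤ productMeasure μ ν B := by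
  rw [productMeasure_apply μ ν ((continuous_const_mul g).measurable hB),
    productMeasure_apply μ ν hB]
  refine iSup_le fun q => le_iSup_of_le (⟨g.fst • (q.1 : Set G), q.1.isCompact.smul _⟩,
    ⟨g.snd • (q.2 : Set H), q.2.isCompact.smul _⟩) (le_of_eq ?_)
  exact iteratedMeasure_preimage_mul q.2.isCompact g hB

instance [IsFiniteMeasureOnCompacts ν] [μ.IsMulLeftInvariant] [ν.IsMulLeftInvariant] :
    (productMeasure μ ν).IsMulLeftInvariant := ⟨fun g => by
  have hmeas : ∀ g : BProd G H, Measurable (g * ·) := fun g => (continuous_const_mul g).measurable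
  refine Measure.ext fun B hB => ?_
  rw [Measure.map_apply (hmeas g) hB]
  refine le_antisymm (productMeasure_preimage_mul_le μ ν g hB) ?_
  simpa [Set.preimage_preimage] using productMeasure_preimage_mul_le μ ν g⁻¹ (hmeas g hB)⟩

instance [T2Space G] [LocallyCompactSpace G] [LocallyCompactSpace H] [μ.IsHaarMeasure]
    [ν.IsHaarMeasure] : (productMeasure μ ν).IsHaarMeasure := by
  let K : PositiveCompacts G := Classical.arbitrary _
  let L : PositiveCompacts H := Classical.arbitrary _
  refine Measure.isHaarMeasure_of_isCompact_nonempty_interior _ (rect (K : Set G) (L : Set H))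
    (isCompact_rect K.isCompact L.isCompact) ?_ ?_ ?_
  · obtain ⟨x, hx⟩ := K.interior_nonempty
    obtain ⟨y, hy⟩ := L.interior_nonempty
    exact ⟨BProd.mk x y, mem_interior.2 ⟨rect (interior K) (interior L),
      fun p hp => ⟨interior_subset hp.1, interior_subset hp.2⟩,
      isOpen_rect isOpen_interior isOpen_interior, hx, hy⟩⟩
  · rw [productMeasure_rect μ ν K.isCompact L.isCompact]
    exact mul_ne_zero (Measure.measure_pos_of_nonempty_interior _ K.interior_nonempty).ne'
      (Measure.measure_pos_of_nonempty_interior _ L.interior_nonempty).ne'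
  · exact (isCompact_rect K.isCompact L.isCompact).measure_lt_top.ne

end Invariance

variable [T2Space G] [LocallyCompactSpace G] [LocallyCompactSpace H]

variable (G H) in
/-- The ratio of the chosen Haar measure on the product to the product of the chosen Haar measures
on the factors. -/
noncomputable def productConst : NNReal :=
  (Measure.haarScalarFactor
    (productMeasure (Measure.haar : Measure G) (Measure.haar : Measure H)) Measure.haar)⁻¹

variable (G H) in
theorem productConst_pos : 0 < productConst G H :=
  inv_pos.2 (Measure.haarScalarFactor_pos_of_isHaarMeasure _ _)

variable (G H) in
theorem coe_productConst_ne_zero : (productConst G H : ℂ) ≠ 0 :=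
  mod_cast (productConst_pos G H).ne'

theorem haar_restrict_of_isCompact {Q : Set (BProd G H)} (hQ : IsCompact Q) :
    (Measure.haar : Measure (BProd G H)).restrict Q = productConst G H •
      (productMeasure (Measure.haar : Measure G) (Measure.haar : Measure H)).restrict Q := by
  refine Measure.ext fun B hB => ?_
  have hB' : IsCompact (closure (B ∩ Q)) := hQ.closure_of_subset Set.inter_subset_right
  rw [Measure.restrict_apply hB, Measure.smul_apply, Measure.restrict_apply hB,
    Measure.measure_isMulInvariant_eq_smul_of_isCompact_closure
      (productMeasure Measure.haar Measure.haar) Measure.haar hB', smul_smul, productConst,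
    inv_mul_cancel₀ (Measure.haarScalarFactor_pos_of_isHaarMeasure _ _).ne', one_smul]

theorem haar_restrict_rect {S : Set G} {T : Set H} (hS : CompactlyCovered S)
    (hT : CompactlyCovered T) :
    (Measure.haar : Measure (BProd G H)).restrict (rect S T) =
      productConst G H • iteratedMeasure Measure.haar Measure.haar S T := by
  rw [← productMeasure_restrict_rect _ _ hS hT, ← Measure.restrict_smul]
  refine (hS.rect hT).restrict_congr fun Q hQ => ?_
  rw [haar_restrict_of_isCompact hQ, Measure.restrict_smul]

theorem haar_rect {K : Set G} {L : Set H} (hK : IsCompact K) (hL : IsCompact L) :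
    (Measure.haar : Measure (BProd G H)) (rect K L) = productConst G H *
      ((Measure.haar : Measure G) K * (Measure.haar : Measure H) L) := by
  rw [← Measure.restrict_apply_univ, haar_restrict_of_isCompact (isCompact_rect hK hL),
    Measure.smul_apply, Measure.restrict_apply_univ, productMeasure_rect _ _ hK hL,
    ENNReal.smul_def, smul_eq_mul]

end Haar

theorem setLIntegral_eq_lintegral_of_forall_compl_eq_zero {X : Type*} [MeasurableSpace X]
    (μ : Measure X) {s : Set X} (hs : MeasurableSet s) {f : X → ℝ≥0∞}
    (hf : ∀ x, x ∉ s → f x = 0) : ∫⁻ x in s, f x ∂μ = ∫⁻ x, f x ∂μ := by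
  rw [← lintegral_indicator hs, Set.indicator_eq_self.2]
  exact Function.support_subset_iff'.2 hf

section IteratedIntegral

variable {G H : Type*} [TopologicalSpace G] [MeasurableSpace G] [BorelSpace G]
  [TopologicalSpace H] [T2Space H] [MeasurableSpace H] [BorelSpace H]
  (μ : Measure G) (ν : Measure H) [ν.InnerRegularCompactLTTop] [IsFiniteMeasureOnCompacts ν]
  {S : Set G} {T : Set H}

theorem measurable_integral_section (hT : CompactlyCovered T) {F : BProd G H → ℂ}
    (hF : Measurable F) (h0 : ∀ x y, y ∉ T → F (BProd.mk x y) = 0) :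
    Measurable fun x => ∫ y, F (BProd.mk x y) ∂ν := by
  have h := hF.stronglyMeasurable.integral_kernel (κ := sectionKernel G ν hT)
  convert h.measurable using 2 with x
  rw [sectionKernel_apply, integral_map (BProd.measurable_mk_left x).aemeasurable
    hF.aestronglyMeasurable, setIntegral_eq_integral_of_forall_compl_eq_zero (h0 x)]

theorem lintegral_iteratedMeasure (hS : MeasurableSet S) (hT : CompactlyCovered T)
    {F : BProd G H → ℝ≥0∞} (hF : Measurable F) (h0 : ∀ p, p ∉ rect S T → F p = 0) :
    ∫⁻ p, F p ∂(iteratedMeasure μ ν S T) = ∫⁻ x, ∫⁻ y, F (BProd.mk x y) ∂ν ∂μ := by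
  rw [iteratedMeasure, Measure.lintegral_bind (measurable_map_mk_restrict ν hT).aemeasurable
      hF.aemeasurable,
    ← setLIntegral_eq_lintegral_of_forall_compl_eq_zero μ hS
      (fun x hx => by simp [h0 (BProd.mk x _) fun hp => hx hp.1])]
  refine lintegral_congr fun x => ?_
  rw [lintegral_map hF (BProd.measurable_mk_left x),
    setLIntegral_eq_lintegral_of_forall_compl_eq_zero _ hT.measurableSet
      (fun y hy => h0 (BProd.mk x y) fun hp => hy hp.2)]

theorem integral_iteratedMeasure (hT : CompactlyCovered T)
    {F : BProd G H → ℂ} (hF : Measurable F) (hi : Integrable F (iteratedMeasure μ ν S T))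
    (h0 : ∀ p, p ∉ rect S T → F p = 0) :
    ∫ p, F p ∂(iteratedMeasure μ ν S T) = ∫ x, ∫ y, F (BProd.mk x y) ∂ν ∂μ := by
  have hcomp : iteratedMeasure μ ν S T = sectionKernel G ν hT ∘ₘ μ.restrict S := rfl
  rw [hcomp, Measure.comp_eq_comp_const_apply] at hi ⊢
  rw [ProbabilityTheory.Kernel.integral_comp hi, ProbabilityTheory.Kernel.const_apply,
    ← setIntegral_eq_integral_of_forall_compl_eq_zero (s := S)
      (f := fun x => ∫ y, F (BProd.mk x y) ∂ν)
      (fun x hx => by simp [h0 (BProd.mk x _) fun hp => hx hp.1])]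
  refine integral_congr_ae (Eventually.of_forall fun x => ?_)
  dsimp only
  rw [sectionKernel_apply, integral_map (BProd.measurable_mk_left x).aemeasurable
    hF.aestronglyMeasurable, setIntegral_eq_integral_of_forall_compl_eq_zero
      fun y hy => h0 (BProd.mk x y) fun hp => hy hp.2]

end IteratedIntegral

section HaarIntegral

variable {G H : Type*} [Group G] [TopologicalSpace G] [IsTopologicalGroup G]
  [LocallyCompactSpace G] [T2Space G] [MeasurableSpace G] [BorelSpace G]
  [Group H] [TopologicalSpace H] [IsTopologicalGroup H]
  [LocallyCompactSpace H] [T2Space H] [MeasurableSpace H] [BorelSpace H]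
  {S : Set G} {T : Set H}

theorem lintegral_haar_bprod (hS : CompactlyCovered S) (hT : CompactlyCovered T)
    {F : BProd G H → ℝ≥0∞} (hF : Measurable F) (h0 : ∀ p, p ∉ rect S T → F p = 0) :
    ∫⁻ p, F p ∂Measure.haar = productConst G H * ∫⁻ x, ∫⁻ y, F (BProd.mk x y)
      ∂(Measure.haar : Measure H) ∂(Measure.haar : Measure G) := by
  rw [← setLIntegral_eq_lintegral_of_forall_compl_eq_zero _ (hS.rect hT).measurableSet h0,
    haar_restrict_rect hS hT, lintegral_smul_measure,
    lintegral_iteratedMeasure _ _ hS.measurableSet hT hF h0, ENNReal.smul_def, smul_eq_mul]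

theorem integral_haar_bprod (hS : CompactlyCovered S) (hT : CompactlyCovered T)
    {F : BProd G H → ℂ} (hF : Measurable F)
    (hi : Integrable F (Measure.haar : Measure (BProd G H))) (h0 : ∀ p, p ∉ rect S T → F p = 0) :
    ∫ p, F p ∂Measure.haar = productConst G H * ∫ x, ∫ y, F (BProd.mk x y)
      ∂(Measure.haar : Measure H) ∂(Measure.haar : Measure G) := by
  have hi' : Integrable F (iteratedMeasure (Measure.haar : Measure G) Measure.haar S T) := by
    have h := hi.restrict (s := rect S T)
    rw [haar_restrict_rect hS hT] at h
    exact (integrable_smul_measure (c := (productConst G H : ℝ≥0∞))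
      (mod_cast (productConst_pos G H).ne') ENNReal.coe_ne_top).1 h
  rw [← setIntegral_eq_integral_of_forall_compl_eq_zero h0, haar_restrict_rect hS hT,
    integral_smul_nnreal_measure, integral_iteratedMeasure _ _ hT hF hi' h0, NNReal.smul_def,
    Complex.real_smul]

theorem exists_map_swap_haar : ∃ e : NNReal, productConst H G = e * productConst G H ∧
    (Measure.haar : Measure (BProd H G)).map BProd.swap =
      e • (Measure.haar : Measure (BProd G H)) := by
  have hsmul : ∃ e : NNReal, (Measure.haar : Measure (BProd H G)).map BProd.swap =
      e • (Measure.haar : Measure (BProd G H)) := by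
    let E : BProd H G ≃* BProd G H := MulEquiv.prodComm
    have : ((Measure.haar : Measure (BProd H G)).map BProd.swap).IsHaarMeasure :=
      MulEquiv.isHaarMeasure_map _ E BProd.swap.continuous BProd.swap.symm.continuous
    have : ((Measure.haar : Measure (BProd H G)).map BProd.swap).Regular :=
      Measure.Regular.map BProd.swap
    exact ⟨_, Measure.isMulLeftInvariant_eq_smul_of_regular _ Measure.haar⟩
  obtain ⟨e, he⟩ := hsmul
  refine ⟨e, ?_, he⟩
  -- The constants are compared on a rectangle of finite positive measure.
  let K : TopologicalSpace.PositiveCompacts G := Classical.arbitrary _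
  let L : TopologicalSpace.PositiveCompacts H := Classical.arbitrary _
  have hrect := Measure.ext_iff'.1 he (rect (K : Set G) (L : Set H))
  have hpre : BProd.swap ⁻¹' (rect (K : Set G) (L : Set H)) = rect (L : Set H) (K : Set G) :=
    Set.ext fun _ => And.comm
  rw [Measure.map_apply BProd.swap.continuous.measurable
      (isCompact_rect K.isCompact L.isCompact).measurableSet, hpre,
    haar_rect L.isCompact K.isCompact, Measure.smul_apply, haar_rect K.isCompact L.isCompact,
    ENNReal.smul_def, smul_eq_mul, ← mul_assoc (e : ℝ≥0∞),
    mul_comm (Measure.haar (L : Set H)), ENNReal.mul_left_inj] at hrect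
  · exact_mod_cast hrect
  · exact mul_ne_zero (Measure.measure_pos_of_nonempty_interior _ K.interior_nonempty).ne'
      (Measure.measure_pos_of_nonempty_interior _ L.interior_nonempty).ne'
  · exact ENNReal.mul_ne_top K.isCompact.measure_lt_top.ne L.isCompact.measure_lt_top.ne

theorem integral_haar_bprod_swap (hS : CompactlyCovered S) (hT : CompactlyCovered T)
    {F : BProd G H → ℂ} (hF : Measurable F)
    (hi : Integrable F (Measure.haar : Measure (BProd G H))) (h0 : ∀ p, p ∉ rect S T → F p = 0) :
    ∫ p, F p ∂Measure.haar = productConst G H * ∫ y, ∫ x, F (BProd.mk x y)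
      ∂(Measure.haar : Measure G) ∂(Measure.haar : Measure H) := by
  obtain ⟨e, he, hmap⟩ := exists_map_swap_haar (G := G) (H := H)
  have hm : Measurable (BProd.swap : BProd H G → BProd G H) := BProd.swap.continuous.measurable
  have hiswap : Integrable (F ∘ BProd.swap) (Measure.haar : Measure (BProd H G)) := by
    rw [← integrable_map_measure hF.aestronglyMeasurable hm.aemeasurable, hmap]
    exact hi.smul_measure ENNReal.coe_ne_top
  have hiter := integral_haar_bprod hT hS (hF.comp hm) hiswap
    fun p hp => h0 _ fun hp' => hp hp'.symm
  have hpush := integral_map hm.aemeasurable (f := F) hF.aestronglyMeasurable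
    (μ := (Measure.haar : Measure (BProd H G)))
  rw [hmap, integral_smul_nnreal_measure, NNReal.smul_def, Complex.real_smul] at hpush
  have he0 : (e : ℂ) ≠ 0 := fun h => coe_productConst_ne_zero H G <| by
    rw [he, NNReal.coe_mul, Complex.ofReal_mul]
    exact mul_eq_zero_of_left h _
  refine mul_left_cancel₀ he0 ((hpush.trans hiter).trans ?_)
  rw [he, NNReal.coe_mul, Complex.ofReal_mul, mul_assoc]
  rfl

end HaarIntegral

section WBounded

theorem borelFun_iff {X : Type*} [TopologicalSpace X] [MeasurableSpace X] [BorelSpace X]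
    {h : X → ℂ} : BorelFun h ↔ Measurable h := by
  obtain rfl : ‹MeasurableSpace X› = borel X := BorelSpace.measurable_eq
  obtain hℂ : (inferInstance : MeasurableSpace ℂ) = borel ℂ := BorelSpace.measurable_eq
  unfold BorelFun
  rw [← hℂ]

variable {G H : Type*} [Group G] [TopologicalSpace G] [Group H] [TopologicalSpace H]
  {ω : Weight G} {ω' : Weight H} {h k : G → ℂ}

theorem Weight.ofReal_ne_zero (ω : Weight G) (x : G) : (ω x : ℂ) ≠ 0 :=
  mod_cast (ω.pos x).ne'

variable [MeasurableSpace G] [MeasurableSpace H]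

/-- Borel functions that are bounded everywhere, not just almost everywhere, by a multiple of the
weight: the representatives of elements of `L^∞(G, 1/ω)` used throughout. -/
structure WBounded (ω : Weight G) (h : G → ℂ) : Prop where
  measurable : Measurable h
  bound : ∃ C, ∀ x, ‖h x‖ ≤ C * ω x

namespace WBounded

theorem exists_nonneg (hh : WBounded ω h) : ∃ C, 0 ≤ C ∧ ∀ x, ‖h x‖ ≤ C * ω x := by
  obtain ⟨C, hC⟩ := hh.bound
  have h1 := (norm_nonneg _).trans (hC 1)
  rw [ω.map_one', mul_one] at h1
  exact ⟨C, h1, hC⟩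

theorem add (hh : WBounded ω h) (hk : WBounded ω k) : WBounded ω fun x => h x + k x := by
  obtain ⟨C, hC⟩ := hh.bound
  obtain ⟨D, hD⟩ := hk.bound
  refine ⟨hh.measurable.add hk.measurable, C + D, fun x => ?_⟩
  rw [add_mul]
  exact norm_add_le_of_le (hC x) (hD x)

theorem const_mul (hh : WBounded ω h) (c : ℂ) : WBounded ω fun x => c * h x := by
  obtain ⟨C, hC⟩ := hh.bound
  refine ⟨hh.measurable.const_mul c, ‖c‖ * C, fun x => ?_⟩
  rw [norm_mul, mul_assoc]
  exact mul_le_mul_of_nonneg_left (hC x) (norm_nonneg _)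

theorem sub (hh : WBounded ω h) (hk : WBounded ω k) : WBounded ω fun x => h x - k x := by
  simpa [sub_eq_add_neg] using hh.add (hk.const_mul (-1))

theorem comp (hh : WBounded ω h) {φ : H → G} (hφ : Measurable φ) {D : ℝ}
    (hD : ∀ y, ω (φ y) ≤ D * ω' y) : WBounded ω' fun y => h (φ y) := by
  obtain ⟨C, hC0, hC⟩ := hh.exists_nonneg
  refine ⟨hh.measurable.comp hφ, C * D, fun y => (hC _).trans ?_⟩
  rw [mul_assoc]
  exact mul_le_mul_of_nonneg_left (hD y) hC0

variable [IsTopologicalGroup G] [BorelSpace G]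

theorem comp_mul_left (hh : WBounded ω h) (y : G) : WBounded ω fun x => h (y * x) :=
  hh.comp (continuous_const_mul y).measurable fun x => ω.mul_le' y x

theorem comp_mul_right (hh : WBounded ω h) (y : G) : WBounded ω fun x => h (x * y) :=
  hh.comp (continuous_mul_const y).measurable fun x => (ω.mul_le' x y).trans_eq (mul_comm _ _)

end WBounded

variable [IsTopologicalGroup G] [LocallyCompactSpace G] [BorelSpace G]

theorem WBounded.memLinf (hh : WBounded ω h) : MemLinf ω h :=
  ⟨borelFun_iff.2 hh.measurable, hh.bound.imp fun _ hC => Eventually.of_forall hC⟩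

theorem exists_norm_le_locallyAE_eq (hm : Measurable h) {C : ℝ} (hC0 : 0 ≤ C)
    (hC : ∀ᶠ x in locallyAE G, ‖h x‖ ≤ C * ω x) :
    ∃ k, Measurable k ∧ (∀ x, ‖k x‖ ≤ C * ω x) ∧ h =ᶠ[locallyAE G] k := by
  have hs : MeasurableSet {x | ‖h x‖ ≤ C * ω x} :=
    measurableSet_le hm.norm (ω.continuous'.measurable.const_mul C)
  refine ⟨{x | ‖h x‖ ≤ C * ω x}.indicator h, hm.indicator hs, fun x => ?_, ?_⟩
  · by_cases hx : x ∈ {x | ‖h x‖ ≤ C * ω x}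
    · rwa [Set.indicator_of_mem hx]
    · rw [Set.indicator_of_notMem hx, norm_zero]
      exact mul_nonneg hC0 (ω.pos x).le
  · filter_upwards [hC] with x hx
    exact (Set.indicator_of_mem (s := {x | ‖h x‖ ≤ C * ω x}) hx h).symm

theorem MemLinf.exists_wBounded (hh : MemLinf ω h) : ∃ k, WBounded ω k ∧ h =ᶠ[locallyAE G] k := by
  obtain ⟨hm, C, hC⟩ := hh
  obtain ⟨k, hk, hkb, he⟩ := exists_norm_le_locallyAE_eq (borelFun_iff.1 hm) (le_max_right C 0)
    (hC.mono fun x hx => hx.trans (mul_le_mul_of_nonneg_right (le_max_left _ _) (ω.pos x).le))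
  exact ⟨k, ⟨hk, _, hkb⟩, he⟩

end WBounded

section Pair

variable {G : Type*} [Group G] [TopologicalSpace G] [IsTopologicalGroup G]
  [LocallyCompactSpace G] [MeasurableSpace G] [BorelSpace G] {ω : Weight G} {h k : G → ℂ}

theorem L1.coe_mk_haar {f : G → ℂ} (hf : MemLp f 1 (wMeasure ω)) :
    (L1.mk ω f hf).rep =ᵐ[Measure.haar] f := ae_wMeasure ω ▸ L1.coe_mk ω hf

theorem coe_translate_haar (y : G) (g : L1 ω) :
    (translate ω y g).rep =ᵐ[Measure.haar] fun x => g (y⁻¹ * x) :=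
  ae_wMeasure ω ▸ coe_translate ω y g

theorem L1.aestronglyMeasurable (f : L1 ω) :
    AEStronglyMeasurable f.rep (Measure.haar : Measure G) := by
  have hi : Continuous fun x => (ω x : ℂ)⁻¹ :=
    (Complex.continuous_ofReal.comp ω.continuous').inv₀ ω.ofReal_ne_zero
  refine (hi.measurable.aestronglyMeasurable.mul ((memLp_iff ω f).1 f.memLp).1).congr
    (Eventually.of_forall fun x => ?_)
  simp [inv_mul_cancel_left₀ (ω.ofReal_ne_zero x)]

theorem L1.integrable_weight_mul_norm (f : L1 ω) :
    Integrable (fun y => ω y * ‖f y‖) (Measure.haar : Measure G) := by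
  refine ((memLp_iff ω f).1 f.memLp).norm.congr (Eventually.of_forall fun y => ?_)
  simp [abs_of_pos (ω.pos y)]

/-- The bilinear form `⟨h, f⟩ = ∫ f(x) h(x) dx`, for arbitrary functions `h`. -/
noncomputable def pair (h : G → ℂ) (f : L1 ω) : ℂ :=
  ∫ x, f x * h x ∂(Measure.haar : Measure G)

theorem toDual_mk (hh : MemLinf ω h) (f : L1 ω) :
    toDual ω (Linf.mk ω h hh) f = pair h f := pairing_eq (Linf.coe_mk ω hh) f

theorem toDual_eq_pair {h : Linf ω} (e : h.rep =ᶠ[locallyAE G] k) (f : L1 ω) :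
    toDual ω h f = pair k f := pairing_eq e f

theorem pair_eq_integral_of_ae_eq {f : L1 ω} {f₀ : G → ℂ} (e : f.rep =ᵐ[Measure.haar] f₀)
    (h : G → ℂ) : pair h f = ∫ x, f₀ x * h x ∂Measure.haar :=
  integral_congr_ae (e.mono fun x hx => congrArg (· * h x) hx)

theorem pair_congr (e : h =ᶠ[locallyAE G] k) (f : L1 ω) : pair h f = pair k f := by
  refine integral_congr_ae ?_
  filter_upwards [f.ae_of_locallyAE e] with x hx
  rcases eq_or_ne (f x) 0 with h0 | h0
  · simp [h0]
  · rw [hx h0]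

theorem norm_mul_le_of_norm_le {C : ℝ} (hC : ∀ x, ‖h x‖ ≤ C * ω x) (f : L1 ω) (x : G) :
    ‖f x * h x‖ ≤ C * (ω x * ‖f x‖) := by
  rw [norm_mul]
  exact (mul_le_mul_of_nonneg_left (hC x) (norm_nonneg _)).trans_eq (by ring)

theorem WBounded.integrable_mul (hh : WBounded ω h) (f : L1 ω) :
    Integrable (fun x => f x * h x) (Measure.haar : Measure G) := by
  obtain ⟨C, hC⟩ := hh.bound
  exact (f.integrable_weight_mul_norm.const_mul C).mono'
    (f.aestronglyMeasurable.mul hh.measurable.aestronglyMeasurable)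
    (Eventually.of_forall (norm_mul_le_of_norm_le hC f))

theorem norm_pair_le {C : ℝ} (hC : ∀ x, ‖h x‖ ≤ C * ω x) (f : L1 ω) :
    ‖pair h f‖ ≤ C * ‖f‖ := by
  rw [L1.norm_eq_integral, ← integral_const_mul]
  exact norm_integral_le_of_norm_le (f.integrable_weight_mul_norm.const_mul C)
    (Eventually.of_forall (norm_mul_le_of_norm_le hC f))

theorem pair_add (hh : WBounded ω h) (f g : L1 ω) : pair h (f + g) = pair h f + pair h g := by
  rw [← toDual_mk hh.memLinf, ← toDual_mk hh.memLinf, ← toDual_mk hh.memLinf, map_add]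

theorem pair_smul (hh : WBounded ω h) (c : ℂ) (f : L1 ω) : pair h (c • f) = c * pair h f := by
  rw [← toDual_mk hh.memLinf, ← toDual_mk hh.memLinf, map_smul, smul_eq_mul]

theorem zero_pair (f : L1 ω) : pair (fun _ => 0) f = 0 := by
  simp only [pair, mul_zero, integral_zero]

theorem sub_pair (hh : WBounded ω h) (hk : WBounded ω k) (f : L1 ω) :
    pair (fun x => h x - k x) f = pair h f - pair k f := by
  unfold pair
  rw [← integral_sub (hh.integrable_mul f) (hk.integrable_mul f)]
  simp only [mul_sub]

theorem const_mul_pair (c : ℂ) (h : G → ℂ) (f : L1 ω) :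
    pair (fun x => c * h x) f = c * pair h f := by
  unfold pair
  rw [← integral_const_mul]
  simp only [mul_left_comm]

theorem pair_translate (h : G → ℂ) (y : G) (g : L1 ω) :
    pair h (translate ω y g) = pair (fun x => h (y * x)) g := by
  rw [pair_eq_integral_of_ae_eq (coe_translate_haar y g),
    ← integral_mul_left_eq_self (fun x => g (y⁻¹ * x) * h x) y]
  simp only [inv_mul_cancel_left, pair]

theorem apply_mul_eq (z : StrongDual ℂ (L1 ω)) (f g : L1 ω) :
    z (f * g) = pair (fun y => z (translate ω y g)) f := by
  have hfg : f * g = ∫ y, f y • translate ω y g ∂(Measure.haar : Measure G) := rfl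
  rw [hfg, ← ContinuousLinearMap.integral_comp_comm _ (integrable_smul_translate ω f g)]
  simp only [map_smul, smul_eq_mul, pair]

theorem pair_mul (hh : WBounded ω h) (f g : L1 ω) :
    pair h (f * g) = pair (fun y => pair (fun x => h (y * x)) g) f := by
  rw [← toDual_mk hh.memLinf, apply_mul_eq]
  simp only [toDual_mk, pair_translate]

end Pair

section BorelRepresentative

variable {G : Type*} [Group G] [TopologicalSpace G] [IsTopologicalGroup G]
  [LocallyCompactSpace G] [MeasurableSpace G] [BorelSpace G] {ω : Weight G}

theorem L1.exists_measurable_rep (f : L1 ω) : ∃ f₀ : G → ℂ, Measurable f₀ ∧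
    f.rep =ᵐ[Measure.haar] f₀ ∧ ∃ S, CompactlyCovered S ∧ ∀ x, x ∉ S → f₀ x = 0 := by
  obtain ⟨k, -, hks, hk⟩ := exists_seq_compactSupport ((memLp_iff ω f).1 f.memLp)
  have hS : MeasurableSet (⋃ n, tsupport (k n)) :=
    MeasurableSet.iUnion fun n => (isClosed_tsupport _).measurableSet
  have hf : Measurable f.rep := (Lp.stronglyMeasurable (show Lp ℂ 1 (wMeasure ω) from f)).measurable
  refine ⟨(⋃ n, tsupport (k n)).indicator f.rep, hf.indicator hS, ?_, ⋃ n, tsupport (k n),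
    ⟨hS, fun n => tsupport (k n), hks, le_rfl⟩, fun x hx => Set.indicator_of_notMem hx _⟩
  filter_upwards [hk] with x hx
  by_cases h : x ∈ ⋃ n, tsupport (k n)
  · rw [Set.indicator_of_mem h]
  · rw [Set.indicator_of_notMem h]
    have h0 : ∀ n, k n x = 0 := fun n => by
      by_contra hn
      exact h (Set.mem_iUnion.2 ⟨n, subset_tsupport _ hn⟩)
    simp only [h0] at hx
    exact (mul_eq_zero.1 (tendsto_nhds_unique hx tendsto_const_nhds)).resolve_left
      (ω.ofReal_ne_zero x)

/-- A Borel representative of `f` living on a countable union of compact sets; such representatives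
make Fubini's theorem available although `G` need not be σ-compact. -/
noncomputable def L1.brep (f : L1 ω) : G → ℂ := f.exists_measurable_rep.choose

theorem L1.measurable_brep (f : L1 ω) : Measurable f.brep :=
  f.exists_measurable_rep.choose_spec.1

theorem L1.ae_eq_brep (f : L1 ω) : f.rep =ᵐ[Measure.haar] f.brep :=
  f.exists_measurable_rep.choose_spec.2.1

theorem L1.exists_brep_support (f : L1 ω) :
    ∃ S, CompactlyCovered S ∧ ∀ x, x ∉ S → f.brep x = 0 :=
  f.exists_measurable_rep.choose_spec.2.2

theorem L1.pair_eq_brep (f : L1 ω) (h : G → ℂ) :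
    pair h f = ∫ x, f.brep x * h x ∂Measure.haar := pair_eq_integral_of_ae_eq f.ae_eq_brep h

theorem L1.integrable_brep (f : L1 ω) :
    Integrable (fun x => (ω x : ℂ) * f.brep x) (Measure.haar : Measure G) :=
  ((memLp_iff ω f).1 f.memLp).congr
    (f.ae_eq_brep.mono fun x hx => congrArg (fun t => (ω x : ℂ) * t) hx)

end BorelRepresentative

section Tensor

/-- The product weight `(x, y) ↦ ω(x) ω'(y)`. -/
def Weight.prod {G H : Type*} [Group G] [TopologicalSpace G] [Group H] [TopologicalSpace H]
    (ω : Weight G) (ω' : Weight H) : Weight (BProd G H) where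
  toFun p := ω p.fst * ω' p.snd
  continuous' := (ω.continuous'.comp BProd.continuous_fst).mul
    (ω'.continuous'.comp BProd.continuous_snd)
  one_le' p := one_le_mul_of_one_le_of_one_le (ω.one_le' _) (ω'.one_le' _)
  mul_le' p q :=
    (mul_le_mul (ω.mul_le' p.fst q.fst) (ω'.mul_le' p.snd q.snd) (ω'.pos _).le
      (mul_pos (ω.pos _) (ω.pos _)).le).trans_eq (mul_mul_mul_comm _ _ _ _)
  map_one' := by
    change ω 1 * ω' 1 = 1
    rw [ω.map_one', ω'.map_one', one_mul]

variable {G H : Type*} [Group G] [TopologicalSpace G] [Group H] [TopologicalSpace H]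
  {ω : Weight G} {ω' : Weight H} {P : BProd G H → ℂ}

theorem Weight.prod_mk (x : G) (y : H) : ω.prod ω' (BProd.mk x y) = ω x * ω' y := rfl

theorem WBounded.comp_swap (hP : WBounded (ω.prod ω') P) :
    WBounded (ω'.prod ω) fun q => P (BProd.swap q) :=
  hP.comp BProd.swap.continuous.measurable fun _ => ((mul_comm _ _).trans (one_mul _).symm).le

variable [MeasurableSpace H] [BorelSpace H]

theorem WBounded.section (hP : WBounded (ω.prod ω') P) (x : G) :
    WBounded ω' fun y => P (BProd.mk x y) :=
  hP.comp (BProd.measurable_mk_left x) (D := ω x) fun _ => le_rfl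

variable [MeasurableSpace G] [BorelSpace G]

theorem WBounded.pair_section [IsTopologicalGroup H] [LocallyCompactSpace H] [T2Space H]
    (hP : WBounded (ω.prod ω') P) (g : L1 ω') :
    WBounded ω fun x => pair (fun y => P (BProd.mk x y)) g := by
  obtain ⟨C, hC⟩ := hP.bound
  refine ⟨?_, C * ‖g‖, fun x => ?_⟩
  · obtain ⟨T, hT, hgT⟩ := g.exists_brep_support
    simp only [L1.pair_eq_brep]
    exact measurable_integral_section _ hT (F := fun p : BProd G H => g.brep p.snd * P p)
      ((g.measurable_brep.comp BProd.measurable_snd).mul hP.measurable)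
      (fun x y hy => by rw [BProd.snd_mk, hgT y hy, zero_mul])
  · refine (norm_pair_le (C := C * ω x) (fun y => ?_) g).trans_eq (by ring)
    exact (hC _).trans_eq (by rw [Weight.prod_mk, mul_assoc])

theorem WBounded.pair_section_left [IsTopologicalGroup G] [LocallyCompactSpace G] [T2Space G]
    (hP : WBounded (ω.prod ω') P) (f : L1 ω) :
    WBounded ω' fun y => pair (fun x => P (BProd.mk x y)) f := hP.comp_swap.pair_section f

variable [IsTopologicalGroup G] [LocallyCompactSpace G] [IsTopologicalGroup H]
  [LocallyCompactSpace H]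

theorem exists_rect_support (f : L1 ω) (g : L1 ω') : ∃ S T, CompactlyCovered S ∧
    CompactlyCovered T ∧ ∀ p, p ∉ rect S T → f.brep p.fst * g.brep p.snd = 0 := by
  obtain ⟨S, hS, hfS⟩ := f.exists_brep_support
  obtain ⟨T, hT, hgT⟩ := g.exists_brep_support
  refine ⟨S, T, hS, hT, fun p hp => ?_⟩
  rw [mem_rect, not_and_or] at hp
  exact hp.elim (fun h => by rw [hfS _ h, zero_mul]) fun h => by rw [hgT _ h, mul_zero]

theorem measurable_tensor_mul (hP : Measurable P) (f : L1 ω) (g : L1 ω') :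
    Measurable fun p : BProd G H => f.brep p.fst * g.brep p.snd * P p :=
  ((f.measurable_brep.comp BProd.measurable_fst).mul
    (g.measurable_brep.comp BProd.measurable_snd)).mul hP

variable [T2Space G] [T2Space H]

theorem memLp_tensor (f : L1 ω) (g : L1 ω') :
    MemLp (fun p : BProd G H => f.brep p.fst * g.brep p.snd) 1 (wMeasure (ω.prod ω')) := by
  obtain ⟨S, T, hS, hT, h0⟩ := exists_rect_support f g
  have hm : Measurable fun p : BProd G H =>
      ((ω.prod ω' p : ℝ) : ℂ) * (f.brep p.fst * g.brep p.snd) := by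
    simpa only [mul_comm, Function.comp_apply] using measurable_tensor_mul
      (Complex.measurable_ofReal.comp (ω.prod ω').continuous'.measurable) f g
  have hsplit (x : G) (y : H) : ‖((ω.prod ω' (BProd.mk x y) : ℝ) : ℂ) *
      (f.brep (BProd.mk x y).fst * g.brep (BProd.mk x y).snd)‖ₑ =
      ‖(ω x : ℂ) * f.brep x‖ₑ * ‖(ω' y : ℂ) * g.brep y‖ₑ := by
    rw [← enorm_mul, Weight.prod_mk, BProd.fst_mk, BProd.snd_mk, Complex.ofReal_mul,
      mul_mul_mul_comm]
  have hf := f.integrable_brep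
  have hg := g.integrable_brep
  rw [memLp_iff]
  refine ⟨hm.aestronglyMeasurable, ?_⟩
  rw [hasFiniteIntegral_iff_enorm,
    lintegral_haar_bprod hS hT hm.enorm fun p hp => by rw [h0 p hp, mul_zero, enorm_zero]]
  simp_rw [hsplit, lintegral_const_mul'' _ hg.1.enorm]
  rw [lintegral_mul_const'' _ hf.1.enorm]
  exact ENNReal.mul_lt_top ENNReal.coe_lt_top (ENNReal.mul_lt_top hf.2 hg.2)

/-- The tensor product `(f ⊗ g)(x, y) = f(x) g(y)`. -/
noncomputable def tensor (f : L1 ω) (g : L1 ω') : L1 (ω.prod ω') :=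
  L1.mk (ω.prod ω') _ (memLp_tensor f g)

theorem coe_tensor (f : L1 ω) (g : L1 ω') : (tensor f g).rep =ᵐ[Measure.haar]
    fun p : BProd G H => f.brep p.fst * g.brep p.snd := L1.coe_mk_haar (memLp_tensor f g)

theorem pair_tensor_eq_integral (P : BProd G H → ℂ) (f : L1 ω) (g : L1 ω') :
    pair P (tensor f g) = ∫ p, f.brep p.fst * g.brep p.snd * P p ∂Measure.haar :=
  pair_eq_integral_of_ae_eq (coe_tensor f g) P

theorem integrable_tensor_mul (hP : WBounded (ω.prod ω') P) (f : L1 ω) (g : L1 ω') :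
    Integrable (fun p => f.brep p.fst * g.brep p.snd * P p)
      (Measure.haar : Measure (BProd G H)) :=
  (hP.integrable_mul (tensor f g)).congr
    ((coe_tensor f g).mono fun p hp => congrArg (· * P p) hp)

theorem pair_tensor (hP : WBounded (ω.prod ω') P) (f : L1 ω) (g : L1 ω') :
    pair P (tensor f g) =
      productConst G H * pair (fun x => pair (fun y => P (BProd.mk x y)) g) f := by
  obtain ⟨S, T, hS, hT, h0⟩ := exists_rect_support f g
  rw [pair_tensor_eq_integral, integral_haar_bprod hS hT (measurable_tensor_mul hP.measurable f g)
    (integrable_tensor_mul hP f g) fun p hp => by rw [h0 p hp, zero_mul]]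
  simp only [L1.pair_eq_brep, ← integral_const_mul, BProd.fst_mk, BProd.snd_mk, mul_assoc]

theorem pair_tensor_swap (hP : WBounded (ω.prod ω') P) (f : L1 ω) (g : L1 ω') :
    pair P (tensor f g) =
      productConst G H * pair (fun y => pair (fun x => P (BProd.mk x y)) f) g := by
  obtain ⟨S, T, hS, hT, h0⟩ := exists_rect_support f g
  rw [pair_tensor_eq_integral, integral_haar_bprod_swap hS hT
    (measurable_tensor_mul hP.measurable f g) (integrable_tensor_mul hP f g)
    fun p hp => by rw [h0 p hp, zero_mul]]
  simp only [L1.pair_eq_brep, ← integral_const_mul, BProd.fst_mk, BProd.snd_mk, mul_assoc,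
    mul_left_comm (g.brep _)]

theorem pair_pair_comm (hP : WBounded (ω.prod ω') P) (f : L1 ω) (g : L1 ω') :
    pair (fun x => pair (fun y => P (BProd.mk x y)) g) f =
      pair (fun y => pair (fun x => P (BProd.mk x y)) f) g :=
  mul_left_cancel₀ (coe_productConst_ne_zero G H)
    ((pair_tensor hP f g).symm.trans (pair_tensor_swap hP f g))

end Tensor

section Mul

variable {G : Type*} [Group G] [TopologicalSpace G] [IsTopologicalGroup G] [MeasurableSpace G]
  [BorelSpace G] {ω : Weight G} {h : G → ℂ}

theorem WBounded.comp_mul (hh : WBounded ω h) :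
    WBounded (ω.prod ω) fun p : BProd G G => h (p.fst * p.snd) :=
  hh.comp (BProd.continuous_fst.mul BProd.continuous_snd).measurable (D := 1)
    fun _ => (ω.mul_le' _ _).trans_eq (one_mul _).symm

theorem WBounded.comp_mul_swap (hh : WBounded ω h) :
    WBounded (ω.prod ω) fun p : BProd G G => h (p.snd * p.fst) := hh.comp_mul.comp_swap

variable [LocallyCompactSpace G] [T2Space G]

theorem WBounded.pair_mul_left (hh : WBounded ω h) (f : L1 ω) :
    WBounded ω fun x => pair (fun y => h (y * x)) f := hh.comp_mul.pair_section_left f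

theorem WBounded.pair_mul_right (hh : WBounded ω h) (f : L1 ω) :
    WBounded ω fun x => pair (fun y => h (x * y)) f := hh.comp_mul.pair_section f

theorem pair_mul_swap (hh : WBounded ω h) (f g : L1 ω) :
    pair h (f * g) = pair (fun x => pair (fun y => h (y * x)) f) g :=
  (pair_mul hh f g).trans (pair_pair_comm hh.comp_mul f g)

theorem integral_integral_kernel (hh : WBounded ω h) (f g : L1 ω) :
    ∫ y, ∫ x, f x * g y * (h (x * y) - h (y * x)) ∂(Measure.haar : Measure G)
      ∂(Measure.haar : Measure G) = pair h (f * g) - pair h (g * f) := by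
  rw [pair_mul_swap hh f g, pair_mul hh g f,
    ← sub_pair (hh.pair_mul_left f) (hh.pair_mul_right f)]
  refine integral_congr_ae (Eventually.of_forall fun y => ?_)
  simp only
  rw [← sub_pair (hh.comp_mul_right y) (hh.comp_mul_left y), pair, ← integral_const_mul]
  refine integral_congr_ae (Eventually.of_forall fun x => ?_)
  simp only
  ring

end Mul

section FiniteMeasure

variable {X : Type*} [MeasurableSpace X] {m : Measure X}

theorem ae_norm_le_of_norm_integral_mul_le {v : X → ℂ} {W : X → ℝ} (hv : Measurable v)
    (hvi : Integrable v m) (hWi : Integrable W m) (hW0 : ∀ x, 0 ≤ W x)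
    (h : ∀ u : X → ℂ, Measurable u → (∀ x, ‖u x‖ ≤ 1) →
      ‖∫ x, u x * v x ∂m‖ ≤ ∫ x, ‖u x‖ * W x ∂m) :
    ∀ᵐ x ∂m, ‖v x‖ ≤ W x := by
  refine ae_le_of_forall_setIntegral_le hvi.norm hWi fun s hs _ => ?_
  -- the phase `conj v / |v|`, which vanishes where `v` does since `0 / 0 = 0`
  let σ : X → ℂ := fun x => (starRingEnd ℂ) (v x) / (‖v x‖ : ℂ)
  have hσ : Measurable σ := (Complex.continuous_conj.measurable.comp hv).div
    (Complex.measurable_ofReal.comp hv.norm)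
  have hσ_le (x : X) : ‖σ x‖ ≤ 1 := by
    rw [norm_div, RCLike.norm_conj, Complex.norm_real, norm_norm]
    exact div_self_le_one _
  have hσ_mul (x : X) : σ x * v x = (‖v x‖ : ℂ) := by
    rw [div_mul_eq_mul_div, Complex.conj_mul', sq, mul_self_div_self]
  calc ∫ x in s, ‖v x‖ ∂m = ‖∫ x, s.indicator σ x * v x ∂m‖ := by
        simp_rw [← Set.indicator_mul_left s σ v, hσ_mul]
        rw [integral_indicator hs, integral_complex_ofReal, Complex.norm_real,
          Real.norm_of_nonneg (integral_nonneg fun x => norm_nonneg _)]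
    _ ≤ ∫ x, ‖s.indicator σ x‖ * W x ∂m :=
        h _ (hσ.indicator hs) fun x => (norm_indicator_le_norm_self σ x).trans (hσ_le x)
    _ ≤ ∫ x, s.indicator W x ∂m := by
        refine integral_mono_of_nonneg
          (Eventually.of_forall fun x => mul_nonneg (norm_nonneg _) (hW0 x))
          (hWi.indicator hs) (Eventually.of_forall fun x => ?_)
        by_cases hx : x ∈ s
        · simpa [hx] using mul_le_of_le_one_left (hW0 x) (hσ_le x)
        · simp [hx]
    _ = ∫ x in s, W x ∂m := integral_indicator hs

/-- Riesz representation in `L²` applied to the restriction of `z` to `L² ⊆ L¹`. -/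
theorem exists_integrable_density [IsFiniteMeasure m] (z : StrongDual ℂ (Lp ℂ 1 m)) :
    ∃ v : X → ℂ, Measurable v ∧ Integrable v m ∧
      ∀ {u : X → ℂ} (hu : MemLp u 1 m), MemLp u 2 m → z (hu.toLp u) = ∫ x, u x * v x ∂m := by
  have h_one : MemLp (fun _ : X => (1 : ℂ)) 2 m := memLp_const 1
  let ι : Lp ℂ 2 m →L[ℂ] Lp ℂ 1 m :=
    (ContinuousLinearMap.mul ℂ ℂ).holderL m 2 2 1 (h_one.toLp _)
  let w : Lp ℂ 2 m := (InnerProductSpace.toDual ℂ (Lp ℂ 2 m)).symm (z.comp ι)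
  have hw : Integrable w m := (Lp.memLp w).integrable (by norm_num)
  have hvm : Measurable fun x => (starRingEnd ℂ) (w x) :=
    Complex.continuous_conj.measurable.comp (Lp.stronglyMeasurable w).measurable
  refine ⟨fun x => (starRingEnd ℂ) (w x), hvm,
    hw.norm.mono' hvm.aestronglyMeasurable (Eventually.of_forall fun x => by simp),
    fun {u} hu hu2 => ?_⟩
  have hι : ι (hu2.toLp u) = hu.toLp u := by
    refine Lp.ext ?_
    filter_upwards [(ContinuousLinearMap.mul ℂ ℂ).coeFn_holder (r := 1) (h_one.toLp _)
      (hu2.toLp u), h_one.coeFn_toLp, hu2.coeFn_toLp, hu.coeFn_toLp] with x h1 h2 h3 h4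
    refine h1.trans ?_
    rw [h2, h3, h4, ContinuousLinearMap.mul_apply', one_mul]
  have hz : inner ℂ w (hu2.toLp u) = z (ι (hu2.toLp u)) :=
    InnerProductSpace.toDual_symm_apply (𝕜 := ℂ) (x := hu2.toLp u) (y := z.comp ι)
  rw [← hι, ← hz, L2.inner_def]
  exact integral_congr_ae (hu2.coeFn_toLp.mono fun x hx =>
    congrArg (· * (starRingEnd ℂ) (w x)) hx)

theorem exists_density_of_isFiniteMeasure [IsFiniteMeasure m] (z : StrongDual ℂ (Lp ℂ 1 m)) :
    ∃ v : X → ℂ, Measurable v ∧ (∀ x, ‖v x‖ ≤ ‖z‖) ∧ ∀ u : Lp ℂ 1 m, z u = ∫ x, u x * v x ∂m := by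
  obtain ⟨v₀, hv₀, hv₀i, hz⟩ := exists_integrable_density z
  have hb : ∀ᵐ x ∂m, ‖v₀ x‖ ≤ ‖z‖ := by
    refine ae_norm_le_of_norm_integral_mul_le hv₀ hv₀i (integrable_const _)
      (fun _ => norm_nonneg z) fun u hu hu1 => ?_
    have hu1' := MemLp.of_bound (p := 1) (μ := m) hu.aestronglyMeasurable 1 (.of_forall hu1)
    rw [← hz hu1' (MemLp.of_bound hu.aestronglyMeasurable 1 (.of_forall hu1)),
      integral_mul_const, mul_comm]
    refine (z.le_opNorm _).trans_eq ?_
    rw [Lp.norm_toLp, eLpNorm_one_eq_lintegral_enorm, integral_norm_eq_lintegral_enorm hu1'.1]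
  have hE : MeasurableSet {x | ‖v₀ x‖ ≤ ‖z‖} := measurableSet_le hv₀.norm measurable_const
  let v : X → ℂ := {x | ‖v₀ x‖ ≤ ‖z‖}.indicator v₀
  have hv : Measurable v := hv₀.indicator hE
  have hv_le (x : X) : ‖v x‖ ≤ ‖z‖ := by
    rw [norm_indicator_eq_indicator_norm]
    exact Set.indicator_le' (fun _ hx => hx) (fun _ _ => norm_nonneg z) x
  have hvv : v₀ =ᵐ[m] v := hb.mono fun x hx =>
    (Set.indicator_of_mem (s := {x | ‖v₀ x‖ ≤ ‖z‖}) hx v₀).symm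
  have hv_top : MemLp v ∞ m := MemLp.of_bound hv.aestronglyMeasurable _ (.of_forall hv_le)
  let Λ : Lp ℂ 1 m →L[ℂ] ℂ :=
    ((ContinuousLinearMap.mul ℂ ℂ).lpPairing m 1 ∞).flip (hv_top.toLp v)
  have hΛ (u : Lp ℂ 1 m) : Λ u = ∫ x, u x * v x ∂m :=
    ((ContinuousLinearMap.mul ℂ ℂ).lpPairing_eq_integral u (hv_top.toLp v)).trans
      (integral_congr_ae (hv_top.coeFn_toLp.mono fun x hx => congrArg (u x * ·) hx))
  refine ⟨v, hv, hv_le, fun u => (Lp.induction ENNReal.one_ne_top (fun u => z u = Λ u)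
    (fun c s hs hμs => ?_) (fun f g hf hg _ h1 h2 => ?_)
    (isClosed_eq z.continuous Λ.continuous) u).trans (hΛ u)⟩
  · rw [hΛ, Lp.simpleFunc.coe_indicatorConst]
    refine (hz (memLp_indicator_const 1 hs c (.inr hμs.ne))
      (memLp_indicator_const 2 hs c (.inr hμs.ne))).trans (integral_congr_ae ?_)
    filter_upwards [hvv, indicatorConstLp_coeFn (p := 1) (hs := hs) (hμs := hμs.ne) (c := c)]
      with x h1 h2
    rw [h1, h2]
  · rw [map_add, map_add, h1, h2]

end FiniteMeasure

section SigmaFinite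

variable {X : Type*} [MeasurableSpace X] (μ : Measure X)

/-- Multiplication by the density, as a `ℂ`-linear isometry; the library has it over `ℝ` only. -/
noncomputable def withDensitySMul {θ : X → NNReal} (hθ : Measurable θ) :
    Lp ℂ 1 (μ.withDensity fun x => θ x) →ₗᵢ[ℂ] Lp ℂ 1 μ where
  toFun := withDensitySMulLI μ hθ
  map_add' := map_add _
  map_smul' c u := by
    refine Lp.ext ?_
    filter_upwards [(memL1_smul_of_L1_withDensity hθ u).coeFn_toLp,
      (memL1_smul_of_L1_withDensity hθ (c • u)).coeFn_toLp,
      Lp.coeFn_smul c (withDensitySMulLI μ hθ u),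
      (ae_withDensity_iff hθ.coe_nnreal_ennreal).1 (Lp.coeFn_smul c u)] with x h1 h2 h3 h4
    rw [RingHom.id_apply, h3, withDensitySMulLI_apply, withDensitySMulLI_apply, h2, Pi.smul_apply,
      h1]
    rcases eq_or_ne (θ x) 0 with h | h
    · simp only [h, zero_smul, smul_zero]
    · rw [h4 (by simpa using h), Pi.smul_apply, smul_comm]
  norm_map' := (withDensitySMulLI μ hθ).norm_map

theorem coe_withDensitySMul {θ : X → NNReal} (hθ : Measurable θ)
    (u : Lp ℂ 1 (μ.withDensity fun x => θ x)) : withDensitySMul μ hθ u =ᵐ[μ] fun x => θ x • u x :=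
  (memL1_smul_of_L1_withDensity hθ u).coeFn_toLp

variable {μ}

theorem exists_density_of_sigmaFinite_restrict {T : Set X} (hT : MeasurableSet T)
    [SigmaFinite (μ.restrict T)] (z : StrongDual ℂ (Lp ℂ 1 μ)) :
    ∃ v : X → ℂ, Measurable v ∧ (∀ x, ‖v x‖ ≤ ‖z‖) ∧
      ∀ f : Lp ℂ 1 μ, (∀ᵐ x ∂μ, x ∉ T → f x = 0) → z f = ∫ x, f x * v x ∂μ := by
  obtain ⟨θ₀, hθ₀_pos, hθ₀, hθ₀_int⟩ :=
    exists_pos_lintegral_lt_of_sigmaFinite (μ.restrict T) one_ne_zero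
  let θ : X → NNReal := T.indicator θ₀
  have hθ : Measurable θ := hθ₀.indicator hT
  have hθ_ne {x : X} (hx : x ∈ T) : θ x ≠ 0 := by
    rw [show θ x = θ₀ x from Set.indicator_of_mem hx θ₀]
    exact (hθ₀_pos x).ne'
  have : IsFiniteMeasure (μ.withDensity fun x => θ x) := by
    refine isFiniteMeasure_withDensity (ne_of_lt ?_)
    simp only [θ, ENNReal.coe_indicator]
    rw [lintegral_indicator hT]
    exact hθ₀_int.trans ENNReal.one_lt_top
  let J : Lp ℂ 1 (μ.withDensity fun x => θ x) →L[ℂ] Lp ℂ 1 μ :=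
    (withDensitySMul μ hθ).toContinuousLinearMap
  obtain ⟨v, hv, hv_le, hz⟩ := exists_density_of_isFiniteMeasure (z.comp J)
  have hJ : ‖z.comp J‖ ≤ ‖z‖ := (z.opNorm_comp_le J).trans
    (mul_le_of_le_one_right (norm_nonneg z) (LinearIsometry.norm_toContinuousLinearMap_le _))
  refine ⟨v, hv, fun x => (hv_le x).trans hJ, fun f hf => ?_⟩
  have hcancel : (fun x => θ x • (θ x)⁻¹ • f x) =ᵐ[μ] f := by
    filter_upwards [hf] with x hx
    by_cases hxT : x ∈ T
    · rw [smul_inv_smul₀ (hθ_ne hxT)]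
    · rw [hx hxT, smul_zero, smul_zero]
  have hu : MemLp (fun x => (θ x)⁻¹ • f x) 1 (μ.withDensity fun x => θ x) :=
    memLp_one_iff_integrable.2 ((integrable_withDensity_iff_integrable_smul hθ).2
      ((L1.integrable_coeFn f).congr hcancel.symm))
  have hJf : J (hu.toLp _) = f := by
    refine Lp.ext ((coe_withDensitySMul μ hθ _).trans ?_)
    filter_upwards [hcancel, (ae_withDensity_iff hθ.coe_nnreal_ennreal).1 hu.coeFn_toLp]
      with x h1 h2
    rcases eq_or_ne (θ x) 0 with h | h
    · rw [← h1, h, zero_smul, zero_smul]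
    · rw [h2 (by simpa using h), h1]
  calc z f = z (J (hu.toLp _)) := by rw [hJf]
    _ = ∫ x, hu.toLp _ x * v x ∂μ.withDensity fun x => θ x := hz _
    _ = ∫ x, (θ x)⁻¹ • f x * v x ∂μ.withDensity fun x => θ x :=
      integral_congr_ae (hu.coeFn_toLp.mono fun x hx => congrArg (· * v x) hx)
    _ = ∫ x, θ x • ((θ x)⁻¹ • f x * v x) ∂μ := integral_withDensity_eq_integral_smul hθ _
    _ = ∫ x, f x * v x ∂μ := by
      simp only [← smul_mul_assoc]
      exact integral_congr_ae (hcancel.mono fun x hx => congrArg (· * v x) hx)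

end SigmaFinite

section LocalDuality

theorem CompactlyCovered.sigmaFinite {X : Type*} [TopologicalSpace X] [T2Space X]
    [MeasurableSpace X] [BorelSpace X] {T : Set X} (hT : CompactlyCovered T) (μ : Measure X)
    [IsFiniteMeasureOnCompacts μ] : SigmaFinite (μ.restrict T) := by
  obtain ⟨K, hK, hTK⟩ := hT.cover
  refine ⟨⟨⟨fun n => K n ∪ Tᶜ, fun _ => trivial, fun n => ?_, ?_⟩⟩⟩
  · rw [Measure.restrict_apply ((hK n).measurableSet.union hT.measurableSet.compl),
      Set.union_inter_distrib_right, Set.compl_inter_self, Set.union_empty]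
    exact (measure_mono Set.inter_subset_left).trans_lt (hK n).measure_lt_top
  · rw [← Set.iUnion_union, Set.eq_univ_iff_forall]
    exact fun x => (em (x ∈ T)).imp_left (@hTK x)

variable {G : Type*} [Group G] [TopologicalSpace G] [IsTopologicalGroup G]
  [LocallyCompactSpace G] [MeasurableSpace G] [BorelSpace G] {ω : Weight G}

instance wMeasure.isLocallyFiniteMeasure : IsLocallyFiniteMeasure (wMeasure ω) :=
  IsLocallyFiniteMeasure.withDensity_ofReal ω.continuous'

theorem integral_wMeasure (F : G → ℂ) :
    ∫ x, F x ∂wMeasure ω = ∫ x, (ω x : ℂ) * F x ∂Measure.haar := by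
  rw [wMeasure, integral_withDensity_eq_integral_toReal_smul ω.measurable_ofReal
    (Eventually.of_forall fun _ => ENNReal.ofReal_lt_top)]
  simp only [ENNReal.toReal_ofReal (ω.pos _).le, Complex.real_smul]

theorem L1.norm_mk_eq_integral {f : G → ℂ} (hf : MemLp f 1 (wMeasure ω)) :
    ‖L1.mk ω f hf‖ = ∫ x, ω x * ‖f x‖ ∂Measure.haar :=
  (L1.norm_eq_integral _).trans
    (integral_congr_ae ((L1.coe_mk_haar hf).mono fun x hx => congrArg (ω x * ‖·‖) hx))

theorem pair_mk_indicator {K : Set G} (hK : MeasurableSet K) {u : G → ℂ}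
    (hu : MemLp (K.indicator u) 1 (wMeasure ω)) (h : G → ℂ) :
    pair h (L1.mk ω _ hu) = ∫ x in K, u x * h x ∂Measure.haar := by
  rw [pair_eq_integral_of_ae_eq (L1.coe_mk_haar hu), ← integral_indicator hK]
  simp only [Set.indicator_mul_left]

theorem L1.norm_mk_indicator {K : Set G} (hK : MeasurableSet K) {u : G → ℂ}
    (hu : MemLp (K.indicator u) 1 (wMeasure ω)) :
    ‖L1.mk ω _ hu‖ = ∫ x in K, ω x * ‖u x‖ ∂Measure.haar := by
  rw [L1.norm_mk_eq_integral, ← integral_indicator hK]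
  simp only [norm_indicator_eq_indicator_norm, Set.indicator_mul_right]

variable [T2Space G]

theorem WBounded.integrableOn_of_isCompact {h : G → ℂ} (hh : WBounded ω h) {K : Set G}
    (hK : IsCompact K) : IntegrableOn h K (Measure.haar : Measure G) := by
  obtain ⟨C, hC⟩ := hh.bound
  exact ((ω.continuous'.continuousOn.integrableOn_compact hK).const_mul C).mono'
    hh.measurable.aestronglyMeasurable (Eventually.of_forall hC)

theorem memLp_indicator_of_isCompact {K : Set G} (hK : IsCompact K) {u : G → ℂ}
    (hu : Measurable u) {C : ℝ} (hC : ∀ x, ‖u x‖ ≤ C) :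
    MemLp (K.indicator u) 1 (wMeasure ω) := by
  have : IsFiniteMeasure ((wMeasure ω).restrict K) := isFiniteMeasure_restrict.2 hK.measure_ne_top
  exact (memLp_indicator_iff_restrict hK.measurableSet).2
    (MemLp.of_bound hu.aestronglyMeasurable C (Eventually.of_forall hC))

theorem WBounded.eventually_norm_le {h : G → ℂ} (hh : WBounded ω h) {M : ℝ} (hM : 0 ≤ M)
    (hp : ∀ f : L1 ω, ‖pair h f‖ ≤ M * ‖f‖) : ∀ᶠ x in locallyAE G, ‖h x‖ ≤ M * ω x := by
  rw [eventually_locallyAE]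
  intro K hK
  have hω : IntegrableOn ω K (Measure.haar : Measure G) :=
    ω.continuous'.continuousOn.integrableOn_compact hK
  refine ae_norm_le_of_norm_integral_mul_le hh.measurable
    (hh.integrableOn_of_isCompact hK) (hω.const_mul M) (fun x => mul_nonneg hM (ω.pos x).le)
    fun u hu hu1 => ?_
  have hK_mem : MemLp (K.indicator u) 1 (wMeasure ω) := memLp_indicator_of_isCompact hK hu hu1
  calc ‖∫ x in K, u x * h x ∂Measure.haar‖ ≤ M * ∫ x in K, ω x * ‖u x‖ ∂Measure.haar := by
        rw [← pair_mk_indicator hK.measurableSet hK_mem, ← L1.norm_mk_indicator hK.measurableSet]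
        exact hp _
    _ = ∫ x in K, ‖u x‖ * (M * ω x) ∂Measure.haar := by
        rw [← integral_const_mul]
        simp only [mul_left_comm, mul_comm]

theorem WBounded.eventually_eq_zero {h : G → ℂ} (hh : WBounded ω h)
    (hp : ∀ f : L1 ω, pair h f = 0) : ∀ᶠ x in locallyAE G, h x = 0 := by
  filter_upwards [hh.eventually_norm_le le_rfl fun f => by rw [hp f, norm_zero, zero_mul]]
    with x hx
  rw [zero_mul] at hx
  exact norm_le_zero_iff.1 hx

theorem exists_density_on {T : Set G} (hT : CompactlyCovered T) (z : StrongDual ℂ (L1 ω)) :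
    ∃ v : G → ℂ, Measurable v ∧ (∀ x, ‖v x‖ ≤ ‖z‖) ∧
      ∀ f : L1 ω, (∀ᵐ x ∂(Measure.haar : Measure G), x ∉ T → f x = 0) →
        z f = pair (fun x => ω x * v x) f := by
  have := hT.sigmaFinite (wMeasure ω)
  obtain ⟨v, hv, hv_le, hz⟩ := exists_density_of_sigmaFinite_restrict hT.measurableSet
    (show StrongDual ℂ (Lp ℂ 1 (wMeasure ω)) from z)
  refine ⟨v, hv, hv_le, fun f hf => ?_⟩
  rw [← ae_wMeasure ω] at hf
  refine (hz f hf).trans ((integral_wMeasure _).trans ?_)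
  simp only [pair, mul_left_comm]
  rfl

end LocalDuality

section Gluing

variable {G : Type*} [Group G] [TopologicalSpace G] [IsTopologicalGroup G]
  [LocallyCompactSpace G]

variable (G) in
theorem exists_open_sigmaCompact_subgroup :
    ∃ N : Subgroup G, IsOpen (N : Set G) ∧ IsSigmaCompact (N : Set G) := by
  obtain ⟨V, hV, hV1⟩ := exists_compact_mem_nhds (1 : G)
  have hopen : IsOpen (Subgroup.closure V : Set G) := Subgroup.isOpen_of_mem_nhds _
    (mem_of_superset hV1 Subgroup.subset_closure)
  have hinv : (V ∪ V⁻¹)⁻¹ = V ∪ V⁻¹ := by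
    rw [Set.union_inv, inv_inv, Set.union_comm]
  have hpow (n : ℕ) : IsCompact ((V ∪ V⁻¹) ^ n) := by
    induction n with
    | zero => simp
    | succ n ih => exact pow_succ (V ∪ V⁻¹) n ▸ ih.mul (hV.union hV.inv)
  refine ⟨Subgroup.closure V, hopen, (isSigmaCompact_iUnion_of_isCompact _ hpow).of_isClosed_subset
    (Subgroup.isClosed_of_isOpen _ hopen) fun x hx => Set.mem_iUnion.2 ?_⟩
  induction hx using Subgroup.closure_induction with
  | mem x hx => exact ⟨1, by rw [pow_one]; exact Or.inl hx⟩
  | one => exact ⟨0, by simp⟩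
  | mul x y _ _ hx hy =>
    obtain ⟨n, hn⟩ := hx
    obtain ⟨k, hk⟩ := hy
    exact ⟨n + k, by rw [pow_add]; exact Set.mul_mem_mul hn hk⟩
  | inv x _ hx =>
    obtain ⟨n, hn⟩ := hx
    exact ⟨n, by rw [← hinv, inv_pow]; exact Set.inv_mem_inv.2 hn⟩

theorem finite_image_of_eventually_eq {X ι : Type*} [TopologicalSpace X] {π : X → ι}
    (hπ : ∀ x, ∀ᶠ y in 𝓝 x, π y = π x) {K : Set X} (hK : IsCompact K) : (π '' K).Finite := by
  let _ : TopologicalSpace ι := ⊥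
  have : DiscreteTopology ι := ⟨rfl⟩
  have hc : Continuous π := continuous_iff_continuousAt.2 fun x =>
    tendsto_const_nhds.congr' ((hπ x).mono fun _ h => h.symm)
  exact (hK.image hc).finite_of_discrete

variable [MeasurableSpace G] [BorelSpace G]

variable (G) in
theorem exists_open_partition : ∃ N : Subgroup G,
    (∀ x : G, ∀ᶠ y : G in 𝓝 x, (y : G ⧸ N) = x) ∧
      ∀ q : G ⧸ N, CompactlyCovered {x : G | (x : G ⧸ N) = q} := by
  obtain ⟨N, hN, hNσ⟩ := exists_open_sigmaCompact_subgroup G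
  have := QuotientGroup.discreteTopology hN
  have hopen (q : G ⧸ N) : IsOpen {x : G | (x : G ⧸ N) = q} :=
    (isOpen_discrete ({q} : Set (G ⧸ N))).preimage continuous_quotient_mk'
  refine ⟨N, fun x => (hopen _).mem_nhds rfl, fun q => ⟨(hopen q).measurableSet, ?_⟩⟩
  obtain ⟨a, rfl⟩ := QuotientGroup.mk_surjective q
  obtain ⟨K, hK, hKU⟩ := hNσ.image (continuous_const_mul a)
  refine ⟨K, hK, fun x hx => hKU ▸ ⟨a⁻¹ * x, QuotientGroup.eq.1 (Eq.symm hx), ?_⟩⟩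
  exact mul_inv_cancel_left a x

variable {ι : Type*} {π : G → ι}

theorem exists_measurable_glue_of_integrable (hπ : ∀ x, ∀ᶠ y in 𝓝 x, π y = π x)
    {a : ι → G → ℂ} (ha : ∀ q, Integrable (a q) (Measure.haar : Measure G)) :
    ∃ A : G → ℂ, Measurable A ∧
      ∀ q, ∀ᵐ x ∂(Measure.haar : Measure G), π x = q → A x = a q x := by
  choose k hkc _ hk using fun q => exists_seq_compactSupport (ha q)
  -- Borel functions cannot be glued along an uncountable partition, but continuous ones can.
  have hcont (n : ℕ) : Continuous fun x => k (π x) n x := continuous_iff_continuousAt.2 fun x =>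
    (hkc (π x) n).continuousAt.congr ((hπ x).mono fun y hy => by simp only [hy])
  refine ⟨fun x => limUnder atTop fun n => k (π x) n x,
    (StronglyMeasurable.limUnder fun n =>
      (hcont n).measurable.stronglyMeasurable).measurable, fun q => ?_⟩
  filter_upwards [hk q] with x hx hxq
  subst hxq
  exact hx.limUnder_eq

variable [T2Space G]

theorem CompactlyCovered.exists_integrable_div_eq {T : Set G} (hT : CompactlyCovered T)
    {v : G → ℂ} (hv : Measurable v) : ∃ a b : G → ℂ, Integrable a (Measure.haar : Measure G) ∧
      Integrable b (Measure.haar : Measure G) ∧ ∀ x ∈ T, a x / b x = v x := by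
  have := hT.sigmaFinite (Measure.haar : Measure G)
  obtain ⟨θ, hθ_pos, hθ, hθ_int⟩ := exists_pos_lintegral_lt_of_sigmaFinite
    ((Measure.haar : Measure G).restrict T) one_ne_zero
  have hθi : Integrable (fun x => (θ x : ℝ)) (Measure.haar.restrict T) := by
    refine ⟨hθ.coe_nnreal_real.aestronglyMeasurable, ?_⟩
    simpa [hasFiniteIntegral_iff_enorm] using hθ_int.trans ENNReal.one_lt_top
  have hpos (x : G) : 0 < 1 + ‖v x‖ := by positivity
  let b (x : G) : ℂ := (θ x / (1 + ‖v x‖) : ℝ)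
  have hbm : Measurable b := by fun_prop
  have hb (x : G) : ‖b x‖ = θ x / (1 + ‖v x‖) :=
    Complex.norm_of_nonneg (div_nonneg (θ x).coe_nonneg (hpos x).le)
  have hb_ne (x : G) : b x ≠ 0 := norm_ne_zero_iff.1 <| (hb x).symm ▸
    (div_pos (NNReal.coe_pos.2 (hθ_pos x)) (hpos x)).ne'
  have hbv (x : G) : ‖b x * v x‖ ≤ θ x := by
    rw [norm_mul, hb, div_mul_eq_mul_div, div_le_iff₀ (hpos x)]
    exact mul_le_mul_of_nonneg_left (le_add_of_nonneg_left zero_le_one) (θ x).coe_nonneg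
  have hbθ (x : G) : ‖b x‖ ≤ θ x :=
    (hb x).trans_le (div_le_self (θ x).coe_nonneg (le_add_of_nonneg_right (norm_nonneg _)))
  refine ⟨T.indicator fun x => b x * v x, T.indicator b,
    (integrable_indicator_iff hT.measurableSet).2
      (hθi.mono' (hbm.mul hv).aestronglyMeasurable (Eventually.of_forall hbv)),
    (integrable_indicator_iff hT.measurableSet).2
      (hθi.mono' hbm.aestronglyMeasurable (Eventually.of_forall hbθ)), fun x hx => ?_⟩
  rw [Set.indicator_of_mem hx, Set.indicator_of_mem hx, mul_div_cancel_left₀ _ (hb_ne x)]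

theorem eventually_locallyAE_of_partition (hπ : ∀ x, ∀ᶠ y in 𝓝 x, π y = π x) {P : G → Prop}
    (h : ∀ q, ∀ᵐ x ∂(Measure.haar : Measure G), π x = q → P x) : ∀ᶠ x in locallyAE G, P x := by
  rw [eventually_locallyAE]
  intro K hK
  rw [ae_restrict_iff' hK.measurableSet]
  filter_upwards [(ae_ball_iff (finite_image_of_eventually_eq hπ hK).countable).2
    fun q _ => h q] with x hx hxK
  exact hx (π x) ⟨x, hxK, rfl⟩ rfl

theorem exists_measurable_glue (hπ : ∀ x, ∀ᶠ y in 𝓝 x, π y = π x)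
    (hcov : ∀ q, CompactlyCovered {x | π x = q}) {v : ι → G → ℂ} (hv : ∀ q, Measurable (v q)) :
    ∃ V : G → ℂ, Measurable V ∧
      ∀ q, ∀ᵐ x ∂(Measure.haar : Measure G), π x = q → V x = v q x := by
  choose a b ha hb hab using fun q => (hcov q).exists_integrable_div_eq (hv q)
  obtain ⟨A, hA, hAa⟩ := exists_measurable_glue_of_integrable hπ ha
  obtain ⟨B, hB, hBb⟩ := exists_measurable_glue_of_integrable hπ hb
  refine ⟨fun x => A x / B x, hA.div hB, fun q => ?_⟩
  filter_upwards [hAa q, hBb q] with x h1 h2 hx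
  rw [h1 hx, h2 hx, hab q x hx]

end Gluing

section Duality

variable {G : Type*} [Group G] [TopologicalSpace G] [IsTopologicalGroup G]
  [LocallyCompactSpace G] [MeasurableSpace G] [BorelSpace G] {ω : Weight G}

theorem eq_zero_of_compactSupport (w : StrongDual ℂ (L1 ω))
    (hw : ∀ (k : G → ℂ) (hk : MemLp k 1 (wMeasure ω)), Continuous k → HasCompactSupport k →
      w (L1.mk ω k hk) = 0) (f : L1 ω) : w f = 0 := by
  have hclosed : IsClosed {g | w g = 0} := isClosed_eq w.continuous continuous_const
  have hf : f ∈ closure {g | w g = 0} := Metric.mem_closure_iff.2 fun ε hε => by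
    obtain ⟨k, hk, hkc, hks, hle⟩ := exists_compactSupport ω f (half_pos hε)
    exact ⟨_, hw k hk hkc hks, (dist_eq_norm f _).trans_lt (hle.trans_lt (half_lt_self hε))⟩
  exact hclosed.closure_subset hf

variable {ι : Type*} {π : G → ι}

theorem eq_zero_of_finite_pieces (hm : ∀ q, MeasurableSet {x | π x = q})
    (w : StrongDual ℂ (L1 ω))
    (hw : ∀ q (f : L1 ω), (∀ᵐ x ∂(Measure.haar : Measure G), π x ≠ q → f x = 0) → w f = 0)
    {s : Set ι} (hs : s.Finite) (f : L1 ω)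
    (hf : ∀ᵐ x ∂(Measure.haar : Measure G), π x ∉ s → f x = 0) : w f = 0 := by
  induction s, hs using Set.Finite.induction_on generalizing f with
  | empty =>
    have hsub := L1.coe_sub f f
    rw [EventuallyEq, ae_wMeasure] at hsub
    have h0 : f = f - f := L1.ext <| by
      rw [EventuallyEq, ae_wMeasure]
      filter_upwards [hf, hsub] with x hx h1
      rw [h1, Pi.sub_apply, sub_self, hx (Set.notMem_empty _)]
    rw [h0, sub_self, map_zero]
  | @insert q s _ _ ih =>
    have hq : MemLp ({x | π x = q}.indicator f) 1 (wMeasure ω) := f.memLp.indicator (hm q)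
    have hsub := L1.coe_sub f (L1.mk ω _ hq)
    rw [EventuallyEq, ae_wMeasure] at hsub
    rw [← sub_add_cancel f (L1.mk ω _ hq), map_add, ih (f - L1.mk ω _ hq), hw q, add_zero]
    · filter_upwards [L1.coe_mk_haar hq] with x hx hxq
      rw [hx]
      exact Set.indicator_of_notMem (s := {x | π x = q}) hxq _
    · filter_upwards [hf, hsub, L1.coe_mk_haar hq] with x hx h1 h2 hxs
      rw [h1, Pi.sub_apply, h2]
      by_cases hxq : π x = q
      · rw [Set.indicator_of_mem (s := {x | π x = q}) hxq, sub_self]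
      · rw [Set.indicator_of_notMem (s := {x | π x = q}) hxq, sub_zero, hx (by simp [hxq, hxs])]

variable [T2Space G]

theorem exists_wBounded_density (z : StrongDual ℂ (L1 ω)) :
    ∃ h : G → ℂ, Measurable h ∧ (∀ x, ‖h x‖ ≤ ‖z‖ * ω x) ∧ ∀ f, z f = pair h f := by
  obtain ⟨N, hπ, hcov⟩ := exists_open_partition G
  choose v hv hv_le hz using fun q => exists_density_on (hcov q) z
  obtain ⟨V, hV, hVv⟩ := exists_measurable_glue hπ hcov hv
  have hV_le : ∀ᶠ x in locallyAE G, ‖(ω x : ℂ) * V x‖ ≤ ‖z‖ * ω x := by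
    refine eventually_locallyAE_of_partition hπ fun q => (hVv q).mono fun x hx hxq => ?_
    rw [hx hxq, norm_mul, Complex.norm_of_nonneg (ω.pos x).le, mul_comm]
    exact mul_le_mul_of_nonneg_right (hv_le q x) (ω.pos x).le
  obtain ⟨h, hh, hh_le, heq⟩ := exists_norm_le_locallyAE_eq
    ((Complex.measurable_ofReal.comp ω.continuous'.measurable).mul hV) (norm_nonneg z) hV_le
  have hhω : WBounded ω h := ⟨hh, _, hh_le⟩
  refine ⟨h, hh, hh_le, fun f => sub_eq_zero.1 ?_⟩
  let w : StrongDual ℂ (L1 ω) := z - toDual ω (Linf.mk ω h hhω.memLinf)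
  have hw (f : L1 ω) : w f = z f - pair h f := by
    rw [← toDual_mk hhω.memLinf, _root_.sub_apply]
  have hpiece (q : G ⧸ N) (f : L1 ω)
      (hf : ∀ᵐ x : G ∂(Measure.haar : Measure G), (x : G ⧸ N) ≠ q → f x = 0) : w f = 0 := by
    rw [hw, ← pair_congr heq, hz q f hf, sub_eq_zero]
    refine integral_congr_ae ?_
    filter_upwards [hVv q, hf] with x h1 h2
    by_cases hx : (x : G ⧸ N) = q
    · simp only [Pi.mul_apply, Function.comp_apply, h1 hx]
    · rw [h2 hx, zero_mul, zero_mul]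
  rw [← hw]
  refine eq_zero_of_compactSupport w (fun k hk _ hks =>
    eq_zero_of_finite_pieces (fun q => (hcov q).measurableSet) w hpiece
      (finite_image_of_eventually_eq hπ hks) _ ?_) f
  filter_upwards [L1.coe_mk_haar hk] with x hx hxk
  rw [hx]
  exact image_eq_zero_of_notMem_tsupport fun hxs => hxk ⟨x, hxs, rfl⟩

end Duality

section RightTranslation

variable {G : Type*} [Group G] [TopologicalSpace G] [IsTopologicalGroup G]
  [LocallyCompactSpace G] [MeasurableSpace G] [BorelSpace G] {ω : Weight G}

theorem map_mul_right_haar (x : G) : (Measure.haar : Measure G).map (· * x) =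
    Measure.modularCharacterFun x • (Measure.haar : Measure G) := by
  have : ((Measure.haar : Measure G).map (· * x)).Regular :=
    Measure.Regular.map (Homeomorph.mulRight x)
  rw [Measure.modularCharacterFun_eq_haarScalarFactor (Measure.haar : Measure G)]
  exact Measure.isMulLeftInvariant_eq_smul_of_regular _ _

theorem integral_comp_mul_right {F : G → ℂ} (hF : Measurable F) (x : G) :
    ∫ y, F (y * x) ∂(Measure.haar : Measure G) =
      (Measure.modularCharacterFun x : ℂ) * ∫ y, F y ∂(Measure.haar : Measure G) := by
  rw [← integral_map (φ := (· * x)) (f := F) (continuous_mul_const x).measurable.aemeasurable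
    hF.aestronglyMeasurable, map_mul_right_haar, integral_smul_nnreal_measure]
  rfl

theorem continuous_integral_comp_mul_right {f : G → ℂ} (hf : Continuous f)
    (hs : HasCompactSupport f) :
    Continuous fun x => ∫ y, f (y * x) ∂(Measure.haar : Measure G) := by
  refine continuous_iff_continuousAt.2 fun x₀ => ?_
  obtain ⟨S, hS, hxS⟩ := exists_compact_mem_nhds x₀
  have hT : IsCompact (tsupport f * S⁻¹) := hs.isCompact.mul hS.inv
  refine (continuousOn_integral_of_compact_support (f := fun x y => f (y * x)) hT
    (hf.comp (continuous_snd.mul continuous_fst)).continuousOn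
    fun x y hx hy => ?_).continuousAt hxS
  by_contra h
  exact hy ⟨y * x, subset_tsupport f h, x⁻¹, Set.inv_mem_inv.2 hx, mul_inv_cancel_right y x⟩

theorem continuous_modularCharacterFun :
    Continuous fun x : G => (Measure.modularCharacterFun x : ℂ) := by
  obtain ⟨f, hfs, hf0, hf1⟩ := exists_continuous_nonneg_pos (1 : G)
  have hpos : 0 < ∫ y, f y ∂(Measure.haar : Measure G) :=
    f.continuous.integral_pos_of_hasCompactSupport_nonneg_nonzero hfs hf0 hf1
  have hc : Continuous fun y => (f y : ℂ) := Complex.continuous_ofReal.comp f.continuous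
  have hs : HasCompactSupport fun y => (f y : ℂ) := hfs.comp_left Complex.ofReal_zero
  have hne : ∫ y, (f y : ℂ) ∂(Measure.haar : Measure G) ≠ 0 := by
    rw [integral_complex_ofReal]
    exact_mod_cast hpos.ne'
  refine ((continuous_integral_comp_mul_right hc hs).div_const
    (∫ y, (f y : ℂ) ∂(Measure.haar : Measure G))).congr fun x => ?_
  rw [integral_comp_mul_right hc.measurable, mul_div_cancel_right₀ _ hne]

/-- The right translate of `k` by `x⁻¹`, normalised so that it has the same Haar integral as
`k`. -/
noncomputable def rightTranslate (x : G) (k : G → ℂ) (y : G) : ℂ :=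
  Measure.modularCharacterFun x * k (y * x⁻¹)

theorem continuous_rightTranslate {k : G → ℂ} (hk : Continuous k) :
    Continuous fun p : G × G => rightTranslate p.1 k p.2 := by
  have hΔ := (continuous_modularCharacterFun (G := G)).comp (continuous_fst (Y := G))
  exact hΔ.mul (hk.comp (continuous_snd.mul continuous_fst.inv))

/-- The distance in `L^1(G, ω)` from `k` to its normalised right translate by `x⁻¹`. -/
noncomputable def rightModulus (ω : Weight G) (k : G → ℂ) (x : G) : ℝ :=
  ∫ y, ‖rightTranslate x k y - k y‖ * ω y ∂(Measure.haar : Measure G)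

theorem tendsto_rightModulus (ω : Weight G) {k : G → ℂ} (hk : Continuous k)
    (hs : HasCompactSupport k) : Tendsto (rightModulus ω k) (𝓝 1) (𝓝 0) := by
  obtain ⟨S, hS, h1S⟩ := exists_compact_mem_nhds (1 : G)
  have hT : IsCompact (tsupport k * S ∪ tsupport k) := (hs.isCompact.mul hS).union hs.isCompact
  have hc : Continuous fun p : G × G => ‖rightTranslate p.1 k p.2 - k p.2‖ * ω p.2 :=
    ((continuous_rightTranslate hk).sub (hk.comp continuous_snd)).norm.mul
      (ω.continuous'.comp continuous_snd)
  have h0 : rightModulus ω k 1 = 0 := by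
    simp [rightModulus, rightTranslate, Measure.modularCharacterFun_map_one]
  rw [← h0]
  refine (continuousOn_integral_of_compact_support
    (f := fun x y => ‖rightTranslate x k y - k y‖ * ω y) hT hc.continuousOn
    fun x y hx hy => ?_).continuousAt h1S
  have h1 : k y = 0 := by
    by_contra h
    exact hy (Or.inr (subset_tsupport k h))
  have h2 : k (y * x⁻¹) = 0 := by
    by_contra h
    exact hy (Or.inl ⟨y * x⁻¹, subset_tsupport k h, x, hx, inv_mul_cancel_right y x⟩)
  simp [rightTranslate, h1, h2]

theorem WBounded.integrable_mul_of_hasCompactSupport {h u : G → ℂ} (hh : WBounded ω h)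
    (hu : Continuous u) (hus : HasCompactSupport u) :
    Integrable (fun y => u y * h y) (Measure.haar : Measure G) := by
  obtain ⟨C, hC⟩ := hh.bound
  have hi : Integrable (fun y => ‖u y‖ * ω y) (Measure.haar : Measure G) :=
    (hu.norm.mul ω.continuous').integrable_of_hasCompactSupport hus.norm.mul_right
  refine (hi.const_mul C).mono' (hu.measurable.mul hh.measurable).aestronglyMeasurable
    (Eventually.of_forall fun y => ?_)
  rw [norm_mul, mul_left_comm]
  exact mul_le_mul_of_nonneg_left (hC y) (norm_nonneg _)

theorem norm_pair_mul_right_sub_le {h : G → ℂ} (hm : Measurable h) {C : ℝ}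
    (hC : ∀ x, ‖h x‖ ≤ C * ω x) {k : G → ℂ} (hk : MemLp k 1 (wMeasure ω)) (hkc : Continuous k)
    (hks : HasCompactSupport k) (x : G) :
    ‖pair (fun y => h (y * x)) (L1.mk ω k hk) - pair h (L1.mk ω k hk)‖ ≤
      C * rightModulus ω k x := by
  have hh : WBounded ω h := ⟨hm, C, hC⟩
  have hkx : Continuous (rightTranslate x k) :=
    (continuous_rightTranslate hkc).comp (continuous_const.prodMk continuous_id)
  have hkxs : HasCompactSupport (rightTranslate x k) :=
    (hks.comp_homeomorph (Homeomorph.mulRight x⁻¹)).mul_left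
  have htranslate : ∫ y, k y * h (y * x) ∂(Measure.haar : Measure G) =
      ∫ y, rightTranslate x k y * h y ∂(Measure.haar : Measure G) := by
    have := integral_comp_mul_right (F := fun y => k (y * x⁻¹) * h y)
      ((hkc.comp (continuous_mul_const _)).measurable.mul hm) x
    simpa only [rightTranslate, mul_inv_cancel_right, ← integral_const_mul, ← mul_assoc] using this
  rw [pair_eq_integral_of_ae_eq (L1.coe_mk_haar hk), pair_eq_integral_of_ae_eq (L1.coe_mk_haar hk),
    htranslate, ← integral_sub (hh.integrable_mul_of_hasCompactSupport hkx hkxs)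
      (hh.integrable_mul_of_hasCompactSupport hkc hks), rightModulus, ← integral_const_mul]
  have hi : Integrable (fun y => ‖rightTranslate x k y - k y‖ * ω y) (Measure.haar : Measure G) :=
    ((hkx.sub hkc).norm.mul ω.continuous').integrable_of_hasCompactSupport
      (hkxs.sub hks).norm.mul_right
  refine norm_integral_le_of_norm_le (hi.const_mul C) (Eventually.of_forall fun y => ?_)
  rw [← sub_mul, norm_mul, mul_left_comm]
  exact mul_le_mul_of_nonneg_left (hC y) (norm_nonneg _)

variable [T2Space G]

theorem tendsto_locallyAE {φ : G → G} (hφ : Continuous φ)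
    (hμ : Measure.QuasiMeasurePreserving φ (Measure.haar : Measure G) Measure.haar) :
    Tendsto φ (locallyAE G) (locallyAE G) := by
  intro s hs
  have hs' : ∀ᶠ x in locallyAE G, x ∈ s := hs
  rw [eventually_locallyAE] at hs'
  change ∀ᶠ x in locallyAE G, φ x ∈ s
  rw [eventually_locallyAE]
  intro K hK
  have hK' := hK.image hφ
  rw [ae_restrict_iff' hK.measurableSet]
  filter_upwards [hμ.ae ((ae_restrict_iff' hK'.measurableSet).1 (hs' _ hK'))] with x hx hxK
  exact hx ⟨x, hxK, rfl⟩

theorem tendsto_mul_right_locallyAE (y : G) : Tendsto (· * y) (locallyAE G) (locallyAE G) :=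
  tendsto_locallyAE (continuous_mul_const y) ⟨(continuous_mul_const y).measurable, by
    rw [map_mul_right_haar]
    exact Measure.smul_absolutelyContinuous⟩

theorem tendsto_mul_left_locallyAE (y : G) : Tendsto (y * ·) (locallyAE G) (locallyAE G) :=
  tendsto_locallyAE (continuous_const_mul y)
    (measurePreserving_mul_left Measure.haar y).quasiMeasurePreserving

end RightTranslation

section Approximation

variable {G : Type*} [Group G] [TopologicalSpace G] [IsTopologicalGroup G]
  [LocallyCompactSpace G] [MeasurableSpace G] [BorelSpace G] {ω : Weight G}

/-- `E` behaves like a probability density on `U`: a function that is `ε`-close to `c` on `U` pairs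
with `E` to a number `ε`-close to `c`. Such `E` for small `U` form an approximate identity. -/
def IsAverage (U : Set G) (E : L1 ω) : Prop :=
  ∀ q : G → ℂ, WBounded ω q → ∀ (c : ℂ) (ε : ℝ), (∀ x ∈ U, ‖q x - c‖ ≤ ε) → ‖pair q E - c‖ ≤ ε

theorem IsAverage.mono {U V : Set G} {E : L1 ω} (hE : IsAverage V E) (h : V ⊆ U) :
    IsAverage U E := fun q hq c ε hε => hE q hq c ε fun x hx => hε x (h hx)

theorem IsAverage.tensor {H : Type*} [Group H] [TopologicalSpace H] [IsTopologicalGroup H]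
    [LocallyCompactSpace H] [MeasurableSpace H] [BorelSpace H] {ω' : Weight H} [T2Space G]
    [T2Space H] {U : Set G} {V : Set H} {E : L1 ω} {F : L1 ω'} (hE : IsAverage U E)
    (hF : IsAverage V F) :
    IsAverage (rect U V) ((productConst G H : ℂ)⁻¹ • Beurling.tensor E F) := by
  intro q hq c ε hε
  rw [pair_smul hq, pair_tensor hq, inv_mul_cancel_left₀ (coe_productConst_ne_zero G H)]
  refine hE _ (hq.pair_section F) c ε fun x hx => ?_
  exact hF _ (hq.section x) c ε fun y hy => hε (BProd.mk x y) ⟨hx, hy⟩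

variable [T2Space G]

theorem exists_isAverage (ω : Weight G) {U : Set G} (hU : U ∈ 𝓝 (1 : G)) :
    ∃ E : L1 ω, IsAverage U E ∧ ∀ C, (∀ x ∈ U, ω x ≤ C) → ‖E‖ ≤ C := by
  obtain ⟨K, hK1, hKU, hK⟩ := local_compact_nhds hU
  have hμ0 : (Measure.haar : Measure G) K ≠ 0 := (Measure.measure_pos_of_mem_nhds _ hK1).ne'
  have hμ1 : (Measure.haar : Measure G) K ≠ ∞ := hK.measure_lt_top.ne
  let t : ℝ := (Measure.haar : Measure G).real K
  have ht : 0 ≤ t := measureReal_nonneg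
  have hm : MemLp (K.indicator fun _ => ((t⁻¹ : ℝ) : ℂ)) 1 (wMeasure ω) :=
    memLp_indicator_of_isCompact hK measurable_const fun _ => le_rfl
  have hpair (q : G → ℂ) : pair q (L1.mk ω _ hm) = ⨍ x in K, q x ∂Measure.haar := by
    rw [pair_mk_indicator hK.measurableSet, setAverage_eq, integral_const_mul, Complex.real_smul]
  have hnorm : ‖L1.mk ω _ hm‖ = ⨍ x in K, ω x ∂Measure.haar := by
    rw [L1.norm_mk_indicator hK.measurableSet, setAverage_eq, smul_eq_mul, ← integral_const_mul]
    simp only [Complex.norm_of_nonneg (inv_nonneg.2 ht), mul_comm, t]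
  refine ⟨L1.mk ω _ hm, fun q hq c ε hε => ?_, fun C hC => ?_⟩
  · rw [hpair, ← mem_closedBall_iff_norm]
    refine (convex_closedBall c ε).set_average_mem Metric.isClosed_closedBall hμ0 hμ1 ?_
      (hq.integrableOn_of_isCompact hK)
    filter_upwards [ae_restrict_mem hK.measurableSet] with x hx
    exact mem_closedBall_iff_norm.2 (hε x (hKU hx))
  · rw [hnorm]
    refine (convex_Iic C).set_average_mem isClosed_Iic hμ0 hμ1 ?_
      (ω.continuous'.continuousOn.integrableOn_compact hK)
    filter_upwards [ae_restrict_mem hK.measurableSet] with x hx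
    exact hC x (hKU hx)

theorem exists_nhds_norm_mul_sub_le {k : G → ℂ} (hk : MemLp k 1 (wMeasure ω))
    (hkc : Continuous k) (hks : HasCompactSupport k) {ε : ℝ} (hε : 0 < ε) :
    ∃ U ∈ 𝓝 (1 : G), ∀ E : L1 ω, IsAverage U E →
      ‖L1.mk ω k hk * E - L1.mk ω k hk‖ ≤ ε := by
  refine ⟨{x | rightModulus ω k x < ε},
    (tendsto_rightModulus ω hkc hks).eventually_lt_const hε, fun E hE => ?_⟩
  refine NormedSpace.norm_le_dual_bound ℂ _ hε.le fun z => ?_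
  obtain ⟨h, hm, hb, hz⟩ := exists_wBounded_density z
  have hh : WBounded ω h := ⟨hm, _, hb⟩
  rw [map_sub, hz, hz, pair_mul_swap hh, mul_comm ε]
  refine hE _ (hh.pair_mul_left _) _ _ fun x hx => ?_
  exact (norm_pair_mul_right_sub_le hm hb hk hkc hks x).trans
    (mul_le_mul_of_nonneg_left (le_of_lt hx) (norm_nonneg z))

theorem exists_approximateUnit (ω : Weight G) : ∃ F : Filter (L1 ω), F.NeBot ∧
    (∀ᶠ E in F, ‖E‖ ≤ 2) ∧ ∀ f : L1 ω, Tendsto (fun E => f * E) F (𝓝 f) := by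
  let S (U : Set G) : Set (L1 ω) := {E | IsAverage U E ∧ ‖E‖ ≤ 2}
  have hS : Monotone S := fun U V h E hE => ⟨hE.1.mono h, hE.2⟩
  have hW : {x | ω x < 2} ∈ 𝓝 (1 : G) :=
    ω.continuous'.continuousAt.eventually_lt_const (by rw [ω.map_one']; norm_num)
  have hb : ∀ᶠ E in (𝓝 (1 : G)).lift' S, ‖E‖ ≤ 2 :=
    mem_of_superset (mem_lift' univ_mem) fun E hE => hE.2
  refine ⟨(𝓝 1).lift' S, (lift'_neBot_iff hS).2 fun U hU => ?_, hb, fun f => ?_⟩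
  · obtain ⟨E, hE, hEb⟩ := exists_isAverage ω (inter_mem hU hW)
    exact ⟨E, hE.mono Set.inter_subset_left, hEb 2 fun x hx => hx.2.le⟩
  · refine Metric.tendsto_nhds.2 fun ε hε => ?_
    obtain ⟨k, hk, hkc, hks, hle⟩ := exists_compactSupport ω f (ε := ε / 8) (by positivity)
    obtain ⟨U, hU, hUE⟩ := exists_nhds_norm_mul_sub_le hk hkc hks (ε := ε / 8) (by positivity)
    filter_upwards [hb, mem_lift' hU] with E hE hEU
    let g := L1.mk ω k hk
    have hsplit : f * E - f = (f - g) * E + (g * E - g) - (f - g) := by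
      rw [sub_mul]
      abel
    calc dist (f * E) f = ‖(f - g) * E + (g * E - g) - (f - g)‖ := by rw [dist_eq_norm, hsplit]
      _ ≤ ‖f - g‖ * ‖E‖ + ‖g * E - g‖ + ‖f - g‖ := by
        grw [norm_sub_le, norm_add_le, norm_mul_le]
      _ ≤ ε / 8 * 2 + ε / 8 + ε / 8 := by
        gcongr
        exact hUE E hEU.1
      _ < ε := by linarith

end Approximation

section TensorDense

variable {G H : Type*} [Group G] [TopologicalSpace G] [IsTopologicalGroup G]
  [LocallyCompactSpace G] [T2Space G] [MeasurableSpace G] [BorelSpace G]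
  [Group H] [TopologicalSpace H] [IsTopologicalGroup H]
  [LocallyCompactSpace H] [T2Space H] [MeasurableSpace H] [BorelSpace H]
  {ω : Weight G} {ω' : Weight H} {P : BProd G H → ℂ}

theorem pair_mul_tensor_eq_zero (hP : WBounded (ω.prod ω') P)
    (h : ∀ (f : L1 ω) (g : L1 ω'), pair P (tensor f g) = 0) (F : L1 (ω.prod ω')) (c : ℂ)
    (f : L1 ω) (g : L1 ω') : pair P (F * (c • tensor f g)) = 0 := by
  have h0 (p : BProd G H) : pair (fun q => P (p * q)) (c • tensor f g) = 0 := by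
    have h1 := h (translate ω p.fst f) (translate ω' p.snd g)
    rw [pair_tensor hP, pair_translate] at h1
    simp only [pair_translate] at h1
    rw [pair_smul (hP.comp_mul_left p), pair_tensor (hP.comp_mul_left p)]
    exact mul_eq_zero_of_right _ h1
  rw [pair_mul hP]
  simp only [h0, zero_pair]

theorem pair_eq_zero_of_tensor (hP : WBounded (ω.prod ω') P)
    (h : ∀ (f : L1 ω) (g : L1 ω'), pair P (tensor f g) = 0) (F : L1 (ω.prod ω')) :
    pair P F = 0 := by
  let z : StrongDual ℂ (L1 (ω.prod ω')) := toDual _ (Linf.mk _ P hP.memLinf)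
  have hz (F : L1 (ω.prod ω')) : z F = pair P F := toDual_mk hP.memLinf F
  rw [← hz]
  refine eq_zero_of_compactSupport z (fun k hk hkc hks => ?_) F
  have hclosed : IsClosed {F | z F = 0} := isClosed_eq z.continuous continuous_const
  refine hclosed.closure_subset (Metric.mem_closure_iff.2 fun ε hε => ?_)
  obtain ⟨U, hU, hUE⟩ := exists_nhds_norm_mul_sub_le hk hkc hks (half_pos hε)
  obtain ⟨V, hV, W, hW, hVW⟩ : ∃ V ∈ 𝓝 (1 : G), ∃ W ∈ 𝓝 (1 : H), rect V W ⊆ U :=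
    mem_nhds_prod_iff.1 hU
  obtain ⟨E, hE, -⟩ := exists_isAverage ω hV
  obtain ⟨E', hE', -⟩ := exists_isAverage ω' hW
  refine ⟨L1.mk _ k hk * ((productConst G H : ℂ)⁻¹ • tensor E E'),
    (hz _).trans (pair_mul_tensor_eq_zero hP h _ _ E E'), ?_⟩
  rw [dist_comm, dist_eq_norm]
  exact (hUE _ ((hE.tensor hE').mono hVW)).trans_lt (half_lt_self hε)

theorem eventually_eq_zero_of_tensor (hP : WBounded (ω.prod ω') P)
    (h : ∀ (f : L1 ω) (g : L1 ω'), pair P (tensor f g) = 0) :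
    ∀ᶠ p in locallyAE (BProd G H), P p = 0 :=
  hP.eventually_eq_zero (pair_eq_zero_of_tensor hP h)

theorem eventually_locallyAE_mul (ω : Weight G) {N : Set G} (hN : MeasurableSet N)
    (h : ∀ᶠ x in locallyAE G, x ∉ N) : ∀ᶠ p in locallyAE (BProd G G),
      p.fst * p.snd ∉ N ∧ p.snd * p.fst ∉ N := by
  let q : G → ℂ := N.indicator fun _ => 1
  have hq : WBounded ω q := by
    refine ⟨measurable_const.indicator hN, 1, fun x => ?_⟩
    grw [norm_indicator_le_norm_self, norm_one, one_mul]
    exact ω.one_le' x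
  have hq0 : q =ᶠ[locallyAE G] fun _ => 0 := h.mono fun x hx => Set.indicator_of_notMem hx _
  have hpair (x : G) (f : L1 ω) : pair (fun y => q (x * y)) f = 0 := by
    rw [← pair_translate, pair_congr hq0, zero_pair]
  have h1 : ∀ᶠ p in locallyAE (BProd G G), q (p.fst * p.snd) = 0 :=
    eventually_eq_zero_of_tensor hq.comp_mul fun f g => by
      rw [pair_tensor hq.comp_mul]
      simp only [BProd.fst_mk, BProd.snd_mk, hpair, zero_pair, mul_zero]
  have h2 : ∀ᶠ p in locallyAE (BProd G G), q (p.snd * p.fst) = 0 :=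
    eventually_eq_zero_of_tensor hq.comp_mul_swap fun f g => by
      rw [pair_tensor_swap hq.comp_mul_swap]
      simp only [BProd.fst_mk, BProd.snd_mk, hpair, zero_pair, mul_zero]
  have hmem (x : G) (hx : q x = 0) : x ∉ N := fun hxN =>
    one_ne_zero ((Set.indicator_of_mem hxN _).symm.trans hx)
  filter_upwards [h1, h2] with p h1 h2
  exact ⟨hmem _ h1, hmem _ h2⟩

end TensorDense

section Bilinear

theorem exists_dual_eq_of_tendsto {𝕜 X ι : Type*} [NontriviallyNormedField 𝕜] [ProperSpace 𝕜]
    [SeminormedAddCommGroup X] [NormedSpace 𝕜 X] {F : Filter ι} [F.NeBot]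
    {Z : ι → StrongDual 𝕜 X} {M : ℝ} (hZ : ∀ᶠ i in F, ‖Z i‖ ≤ M) :
    ∃ z : StrongDual 𝕜 X, ∀ x c, Tendsto (fun i => Z i x) F (𝓝 c) → z x = c := by
  obtain ⟨z, -, hz⟩ := (WeakDual.isCompact_closedBall (𝕜 := 𝕜)
    (0 : StrongDual 𝕜 X) M).ultrafilter_le_nhds
    ((Ultrafilter.of F).map fun i => StrongDual.toWeakDual (Z i))
    (le_principal_iff.2 (Ultrafilter.of_le F (hZ.mono fun i hi => mem_closedBall_zero_iff.2 hi)))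
  refine ⟨WeakDual.toStrongDual z, fun x c hc => ?_⟩
  exact tendsto_nhds_unique (((WeakDual.eval_continuous x).tendsto z).comp hz)
    (hc.mono_left (Ultrafilter.of_le F))

variable {G H : Type*} [Group G] [TopologicalSpace G] [IsTopologicalGroup G]
  [LocallyCompactSpace G] [MeasurableSpace G] [BorelSpace G]
  [Group H] [TopologicalSpace H] [IsTopologicalGroup H]
  [LocallyCompactSpace H] [MeasurableSpace H] [BorelSpace H]
  {ω : Weight G} {ω' : Weight H}

theorem norm_apply_translate_le (B : L1 ω →L[ℂ] StrongDual ℂ (L1 ω')) (E : L1 ω) (E' : L1 ω')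
    (p : BProd G H) : ‖B (translate ω p.fst E) (translate ω' p.snd E')‖ ≤
      ‖B‖ * ‖E‖ * ‖E'‖ * ω.prod ω' p := by
  have := ω.pos p.fst
  calc _ ≤ ‖B‖ * ‖translate ω p.fst E‖ * ‖translate ω' p.snd E'‖ := B.le_opNorm₂ _ _
    _ ≤ ‖B‖ * (ω p.fst * ‖E‖) * (ω' p.snd * ‖E'‖) := by
      gcongr
      exacts [norm_translate_le ω p.fst E, norm_translate_le ω' p.snd E']
    _ = ‖B‖ * ‖E‖ * ‖E'‖ * (ω p.fst * ω' p.snd) := by ring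

theorem wBounded_translate (B : L1 ω →L[ℂ] StrongDual ℂ (L1 ω')) (E : L1 ω) (E' : L1 ω') :
    WBounded (ω.prod ω') fun p => B (translate ω p.fst E) (translate ω' p.snd E') := by
  have hc : Continuous fun p : BProd G H => B (translate ω p.fst E) (translate ω' p.snd E') :=
    (B.continuous.comp ((continuous_translate ω E).comp BProd.continuous_fst)).clm_apply
      ((continuous_translate ω' E').comp BProd.continuous_snd)
  exact ⟨hc.measurable, _, norm_apply_translate_le B E E'⟩

variable [T2Space G] [T2Space H]

theorem pair_translate_tensor (B : L1 ω →L[ℂ] StrongDual ℂ (L1 ω')) (E : L1 ω) (E' : L1 ω')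
    (f : L1 ω) (g : L1 ω') :
    pair (fun p : BProd G H => B (translate ω p.fst E) (translate ω' p.snd E')) (tensor f g) =
      productConst G H * B (f * E) (g * E') := by
  rw [pair_tensor (wBounded_translate B E E')]
  simp only [BProd.fst_mk, BProd.snd_mk, ← apply_mul_eq]
  exact congrArg _ (apply_mul_eq (B.flip (g * E')) f E).symm

theorem exists_wBounded_bilinear (B : L1 ω →L[ℂ] StrongDual ℂ (L1 ω')) :
    ∃ P : BProd G H → ℂ, WBounded (ω.prod ω') P ∧ ∀ f g, pair P (tensor f g) = B f g := by
  obtain ⟨F, _, hFb, hFt⟩ := exists_approximateUnit ω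
  obtain ⟨F', _, hFb', hFt'⟩ := exists_approximateUnit ω'
  let Z (E : L1 ω × L1 ω') : StrongDual ℂ (L1 (ω.prod ω')) :=
    toDual _ (Linf.mk _ _ (wBounded_translate B E.1 E.2).memLinf)
  have hZ (E : L1 ω × L1 ω') (K : L1 (ω.prod ω')) : Z E K =
      pair (fun p : BProd G H => B (translate ω p.fst E.1) (translate ω' p.snd E.2)) K :=
    toDual_mk (wBounded_translate B E.1 E.2).memLinf K
  have hZ_le : ∀ᶠ E in F ×ˢ F', ‖Z E‖ ≤ ‖B‖ * 2 * 2 := by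
    refine (hFb.prod_mk hFb').mono fun E hE => ?_
    refine ContinuousLinearMap.opNorm_le_bound _ (by positivity) fun K => ?_
    rw [hZ]
    refine norm_pair_le (fun p => (norm_apply_translate_le B E.1 E.2 p).trans
      (mul_le_mul_of_nonneg_right ?_ ((ω.prod ω').pos p).le)) K
    gcongr
    exacts [hE.1, hE.2]
  obtain ⟨z, hz⟩ := exists_dual_eq_of_tendsto hZ_le
  obtain ⟨P, hPm, hPb, hP⟩ := exists_wBounded_density z
  have hPw : WBounded (ω.prod ω') P := ⟨hPm, _, hPb⟩
  refine ⟨fun p => (productConst G H : ℂ)⁻¹ * P p, hPw.const_mul _, fun f g => ?_⟩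
  have hlim : Tendsto (fun E => Z E (tensor f g)) (F ×ˢ F') (𝓝 (productConst G H * B f g)) := by
    simp only [hZ, pair_translate_tensor]
    exact ((isBoundedBilinearMap_apply.continuous.tendsto (B f, g)).comp
      (((B.continuous.tendsto f).comp ((hFt f).comp tendsto_fst)).prodMk_nhds
        ((hFt' g).comp tendsto_snd))).const_mul _
  rw [const_mul_pair, ← hP, hz _ _ hlim, inv_mul_cancel_left₀ (coe_productConst_ne_zero G H)]

theorem exists_bilinear_of_wBounded {P : BProd G H → ℂ} (hP : WBounded (ω.prod ω') P) :
    ∃ B : L1 ω →L[ℂ] StrongDual ℂ (L1 ω'), ∀ f g, pair P (tensor f g) = B f g := by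
  obtain ⟨C, hC⟩ := hP.bound
  refine ⟨LinearMap.mkContinuous₂ (LinearMap.mk₂ ℂ (fun f g => pair P (tensor f g)) ?_ ?_ ?_ ?_)
    (productConst G H * C) ?_, fun f g => rfl⟩
  · intro f f' g
    simp only [pair_tensor hP, pair_add (hP.pair_section g), mul_add]
  · intro c f g
    simp only [pair_tensor hP, pair_smul (hP.pair_section g), smul_eq_mul, mul_left_comm]
  · intro f g g'
    simp only [pair_tensor_swap hP, pair_add (hP.pair_section_left f), mul_add]
  · intro c f g
    simp only [pair_tensor_swap hP, pair_smul (hP.pair_section_left f), smul_eq_mul,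
      mul_left_comm]
  · intro f g
    have hy (x : G) : ‖pair (fun y => P (BProd.mk x y)) g‖ ≤ C * ‖g‖ * ω x :=
      (norm_pair_le (C := C * ω x) (fun y => (hC _).trans_eq (mul_assoc _ _ _).symm) g).trans_eq
        (by ring)
    calc ‖pair P (tensor f g)‖
        = productConst G H * ‖pair (fun x => pair (fun y => P (BProd.mk x y)) g) f‖ := by
          rw [pair_tensor hP, norm_mul, Complex.norm_real, NNReal.norm_eq]
      _ ≤ productConst G H * (C * ‖g‖ * ‖f‖) :=
          mul_le_mul_of_nonneg_left (norm_pair_le hy f) NNReal.zero_le_coe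
      _ = productConst G H * C * ‖f‖ * ‖g‖ := by ring

end Bilinear

section TripleTensor

variable {G H K : Type*} [Group G] [TopologicalSpace G] [IsTopologicalGroup G]
  [LocallyCompactSpace G] [T2Space G] [MeasurableSpace G] [BorelSpace G]
  [Group H] [TopologicalSpace H] [IsTopologicalGroup H]
  [LocallyCompactSpace H] [T2Space H] [MeasurableSpace H] [BorelSpace H]
  [Group K] [TopologicalSpace K] [IsTopologicalGroup K]
  [LocallyCompactSpace K] [T2Space K] [MeasurableSpace K] [BorelSpace K]
  {ω : Weight G} {ω' : Weight H} {ω'' : Weight K}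

theorem eventually_eq_zero_of_tensor_tensor {Q : BProd G (BProd H K) → ℂ}
    (hQ : WBounded (ω.prod (ω'.prod ω'')) Q)
    (h : ∀ (f : L1 ω) (k : L1 ω') (g : L1 ω''), pair Q (tensor f (tensor k g)) = 0) :
    ∀ᶠ t in locallyAE (BProd G (BProd H K)), Q t = 0 := by
  refine eventually_eq_zero_of_tensor hQ fun f F => ?_
  have hf : (fun q => pair (fun x => Q (BProd.mk x q)) f) =ᶠ[locallyAE (BProd H K)] fun _ => 0 :=
    eventually_eq_zero_of_tensor (hQ.pair_section_left f) fun k g => by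
      have hfkg := h f k g
      rw [pair_tensor_swap hQ] at hfkg
      exact (mul_eq_zero.1 hfkg).resolve_left (coe_productConst_ne_zero G (BProd H K))
  rw [pair_tensor_swap hQ, pair_congr hf, zero_pair, mul_zero]

end TripleTensor

section QuasiAdditive

variable {G : Type*} [Group G] [TopologicalSpace G]

/-- The deviation `p(xy, z) - p(x, yz) - p(y, zx)` from quasi-additivity. -/
def quasiDefect (p : BProd G G → ℂ) (t : BProd G (BProd G G)) : ℂ :=
  p (BProd.mk (t.fst * t.snd.fst) t.snd.snd) - p (BProd.mk t.fst (t.snd.fst * t.snd.snd)) -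
    p (BProd.mk t.snd.fst (t.snd.snd * t.fst))

theorem eventually_quasiDefect_eq_zero_iff [IsTopologicalGroup G] [LocallyCompactSpace G]
    {p : BProd G G → ℂ} : (∀ᶠ t in locallyAE (BProd G (BProd G G)), quasiDefect p t = 0) ↔
      ∀ᶠ t in locallyAE (G × G × G),
        p (t.1 * t.2.1, t.2.2) = p (t.1, t.2.1 * t.2.2) + p (t.2.1, t.2.2 * t.1) :=
  eventually_congr (Eventually.of_forall fun _ => by
    rw [quasiDefect, sub_sub, sub_eq_zero]
    rfl)

variable {ω : Weight G} {p : BProd G G → ℂ}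

theorem supConst_lt_top_iff : supConst ω p < ∞ ↔ ∃ C, ∀ t, ‖p t‖ ≤ C * ω.prod ω t := by
  constructor
  · intro h
    refine ⟨(supConst ω p).toReal, fun t => ?_⟩
    have ht : ENNReal.ofReal (‖p t‖ / (ω t.fst * ω t.snd)) ≤ supConst ω p :=
      le_iSup₂ (f := fun x y => ENNReal.ofReal (‖p (x, y)‖ / (ω x * ω y))) t.fst t.snd
    exact (div_le_iff₀ ((ω.prod ω).pos t)).1 ((ENNReal.ofReal_le_iff_le_toReal h.ne).1 ht)
  · rintro ⟨C, hC⟩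
    refine (iSup₂_le fun x y => ?_).trans_lt (ENNReal.ofReal_lt_top (r := C))
    exact ENNReal.ofReal_le_ofReal
      ((div_le_iff₀ ((ω.prod ω).pos (BProd.mk x y))).2 (hC (BProd.mk x y)))

theorem wBounded_prod_iff : WBounded (ω.prod ω) p ↔ BorelFun p ∧ supConst ω p < ∞ := by
  rw [borelFun_iff, supConst_lt_top_iff]
  exact ⟨fun h => ⟨h.1, h.2⟩, fun h => ⟨h.1, h.2⟩⟩

variable [IsTopologicalGroup G]

theorem WBounded.comp_mul_fst (hp : WBounded (ω.prod ω) p) : WBounded (ω.prod (ω.prod ω))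
    fun t : BProd G (BProd G G) => p (BProd.mk (t.fst * t.snd.fst) t.snd.snd) :=
  hp.comp (BProd.continuous_mk
    (BProd.continuous_fst.mul (BProd.continuous_fst.comp BProd.continuous_snd))
    (BProd.continuous_snd.comp BProd.continuous_snd)).measurable (D := 1) fun t => by
      calc _ ≤ ω t.fst * ω t.snd.fst * ω t.snd.snd :=
            mul_le_mul_of_nonneg_right (ω.mul_le' _ _) (ω.pos _).le
        _ = 1 * (ω t.fst * (ω t.snd.fst * ω t.snd.snd)) := by ring

theorem WBounded.comp_mul_snd (hp : WBounded (ω.prod ω) p) : WBounded (ω.prod (ω.prod ω))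
    fun t : BProd G (BProd G G) => p (BProd.mk t.fst (t.snd.fst * t.snd.snd)) :=
  hp.comp (BProd.continuous_mk BProd.continuous_fst
    ((BProd.continuous_fst.comp BProd.continuous_snd).mul
      (BProd.continuous_snd.comp BProd.continuous_snd))).measurable (D := 1) fun t => by
      calc _ ≤ ω t.fst * (ω t.snd.fst * ω t.snd.snd) :=
            mul_le_mul_of_nonneg_left (ω.mul_le' _ _) (ω.pos _).le
        _ = 1 * (ω t.fst * (ω t.snd.fst * ω t.snd.snd)) := (one_mul _).symm

theorem WBounded.comp_mul_rotate (hp : WBounded (ω.prod ω) p) : WBounded (ω.prod (ω.prod ω))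
    fun t : BProd G (BProd G G) => p (BProd.mk t.snd.fst (t.snd.snd * t.fst)) :=
  hp.comp (BProd.continuous_mk (BProd.continuous_fst.comp BProd.continuous_snd)
    ((BProd.continuous_snd.comp BProd.continuous_snd).mul
      BProd.continuous_fst)).measurable (D := 1) fun t => by
      calc _ ≤ ω t.snd.fst * (ω t.snd.snd * ω t.fst) :=
            mul_le_mul_of_nonneg_left (ω.mul_le' _ _) (ω.pos _).le
        _ = 1 * (ω t.fst * (ω t.snd.fst * ω t.snd.snd)) := by ring

theorem WBounded.quasiDefect (hp : WBounded (ω.prod ω) p) :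
    WBounded (ω.prod (ω.prod ω)) (quasiDefect p) :=
  (hp.comp_mul_fst.sub hp.comp_mul_snd).sub hp.comp_mul_rotate

variable [LocallyCompactSpace G] [T2Space G] [MeasurableSpace G] [BorelSpace G]

theorem pair_comp_mul_fst (hp : WBounded (ω.prod ω) p) (f k g : L1 ω) :
    pair (fun t : BProd G (BProd G G) => p (BProd.mk (t.fst * t.snd.fst) t.snd.snd))
      (tensor f (tensor k g)) = productConst G (BProd G G) * pair p (tensor (f * k) g) := by
  have hx := fun x => pair_tensor (hp.comp_mul_fst.section x) k g
  simp only [BProd.fst_mk, BProd.snd_mk] at hx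
  rw [pair_tensor hp.comp_mul_fst, pair_tensor hp, pair_mul (hp.pair_section g)]
  simp only [BProd.fst_mk, BProd.snd_mk, hx, const_mul_pair]

theorem pair_comp_mul_snd (hp : WBounded (ω.prod ω) p) (f k g : L1 ω) :
    pair (fun t : BProd G (BProd G G) => p (BProd.mk t.fst (t.snd.fst * t.snd.snd)))
      (tensor f (tensor k g)) = productConst G (BProd G G) * pair p (tensor f (k * g)) := by
  have hx := fun x => pair_tensor (hp.comp_mul_snd.section x) k g
  simp only [BProd.fst_mk, BProd.snd_mk] at hx
  have hm := fun x => pair_mul (hp.section x) k g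
  rw [pair_tensor hp.comp_mul_snd, pair_tensor hp]
  simp only [BProd.fst_mk, BProd.snd_mk, hx, const_mul_pair, hm]

theorem pair_comp_mul_rotate (hp : WBounded (ω.prod ω) p) (f k g : L1 ω) :
    pair (fun t : BProd G (BProd G G) => p (BProd.mk t.snd.fst (t.snd.snd * t.fst)))
      (tensor f (tensor k g)) = productConst G (BProd G G) * pair p (tensor k (g * f)) := by
  have hm := fun x => pair_mul (hp.section x) g f
  rw [pair_tensor_swap hp.comp_mul_rotate, pair_tensor (hp.comp_mul_rotate.pair_section_left f),
    pair_tensor hp]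
  simp only [BProd.fst_mk, BProd.snd_mk, hm]

theorem pair_quasiDefect (hp : WBounded (ω.prod ω) p) (f k g : L1 ω) :
    pair (quasiDefect p) (tensor f (tensor k g)) = productConst G (BProd G G) *
      (pair p (tensor (f * k) g) - pair p (tensor f (k * g)) - pair p (tensor k (g * f))) :=
  calc _ = productConst G (BProd G G) * pair p (tensor (f * k) g) -
        productConst G (BProd G G) * pair p (tensor f (k * g)) -
        productConst G (BProd G G) * pair p (tensor k (g * f)) := by
        rw [← pair_comp_mul_fst hp, ← pair_comp_mul_snd hp, ← pair_comp_mul_rotate hp,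
          ← sub_pair hp.comp_mul_fst hp.comp_mul_snd,
          ← sub_pair (hp.comp_mul_fst.sub hp.comp_mul_snd) hp.comp_mul_rotate]
        rfl
    _ = _ := by ring

theorem quasiAdditive_iff (hp : WBounded (ω.prod ω) p) : QuasiAdditive (G := G) p ↔
    ∀ f k g : L1 ω, pair p (tensor (f * k) g) =
      pair p (tensor f (k * g)) + pair p (tensor k (g * f)) := by
  have hdef : QuasiAdditive (G := G) p ↔
      ∀ᶠ t in locallyAE (BProd G (BProd G G)), quasiDefect p t = 0 :=
    (and_iff_right (wBounded_prod_iff.1 hp).1).trans eventually_quasiDefect_eq_zero_iff.symm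
  rw [hdef]
  constructor
  · intro h f k g
    have hd := pair_quasiDefect hp f k g
    rw [pair_congr (k := fun _ => 0) h, zero_pair] at hd
    have hc := coe_productConst_ne_zero G (BProd G G)
    linear_combination (mul_eq_zero.1 hd.symm).resolve_left hc
  · intro h
    refine eventually_eq_zero_of_tensor_tensor hp.quasiDefect fun f k g => ?_
    rw [pair_quasiDefect hp, h]
    ring

theorem pair_commutator {h : G → ℂ} (hh : WBounded ω h) (f g : L1 ω) :
    pair (fun t : BProd G G => h (t.fst * t.snd) - h (t.snd * t.fst)) (tensor f g) =
      productConst G G * (pair h (f * g) - pair h (g * f)) := by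
  rw [sub_pair hh.comp_mul hh.comp_mul_swap, pair_tensor hh.comp_mul,
    pair_tensor hh.comp_mul_swap, pair_mul hh, pair_mul_swap hh, mul_sub]
  simp only [BProd.fst_mk, BProd.snd_mk]

theorem hasKernel_iff (hp : WBounded (ω.prod ω) p) {h : G → ℂ} (hh : WBounded ω h) :
    HasKernel (G := G) p h ↔ ∀ f g : L1 ω, pair p (tensor f g) =
      productConst G G * (pair h (f * g) - pair h (g * f)) := by
  have hk := hh.comp_mul.sub hh.comp_mul_swap
  constructor
  · intro H f g
    have e : p =ᶠ[locallyAE (BProd G G)] fun t => h (t.fst * t.snd) - h (t.snd * t.fst) := H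
    rw [← pair_commutator hh, pair_congr e]
  · intro H
    have h0 := eventually_eq_zero_of_tensor (hp.sub hk) fun f g => by
      rw [sub_pair hp hk, H, pair_commutator hh, sub_self]
    exact h0.mono fun t ht => sub_eq_zero.1 ht

theorem HasKernel.congr (ω : Weight G) {p : G × G → ℂ} {h k : G → ℂ} (hh : Measurable h)
    (hk : Measurable k) (e : h =ᶠ[locallyAE G] k) (H : HasKernel p h) : HasKernel p k := by
  have hN := eventually_locallyAE_mul ω (measurableSet_eq_fun hh hk).compl
    (e.mono fun x hx hx' => hx' hx)
  refine (Eventually.and H hN).mono fun t ht => ?_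
  have hxy : h (t.1 * t.2) = k (t.1 * t.2) := not_not.1 ht.2.1
  have hyx : h (t.2 * t.1) = k (t.2 * t.1) := not_not.1 ht.2.2
  rw [ht.1, hxy, hyx]

end QuasiAdditive

section Kernel

variable {G : Type*} [Group G] [TopologicalSpace G] [IsTopologicalGroup G]
  [LocallyCompactSpace G] [MeasurableSpace G] [BorelSpace G]

theorem quasiAdditive_commutator {h : G → ℂ} (hh : Measurable h) :
    QuasiAdditive fun t : G × G => h (t.1 * t.2) - h (t.2 * t.1) := by
  have hm : Measurable fun t : BProd G G => h (t.fst * t.snd) - h (t.snd * t.fst) :=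
    (hh.comp (BProd.continuous_fst.mul BProd.continuous_snd).measurable).sub
      (hh.comp (BProd.continuous_snd.mul BProd.continuous_fst).measurable)
  refine ⟨borelFun_iff (X := BProd G G).2 hm, Eventually.of_forall fun t => ?_⟩
  simp only [mul_assoc]
  ring

variable [T2Space G] {ω : Weight G}

theorem integral_integral_kernel_congr {h k : G → ℂ} (e : h =ᶠ[locallyAE G] k) (f g : L1 ω) :
    ∫ y, ∫ x, f x * g y * (h (x * y) - h (y * x)) ∂(Measure.haar : Measure G)
      ∂(Measure.haar : Measure G) =
    ∫ y, ∫ x, f x * g y * (k (x * y) - k (y * x)) ∂(Measure.haar : Measure G)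
      ∂(Measure.haar : Measure G) := by
  congr 1
  funext y
  refine integral_congr_ae ?_
  filter_upwards [f.ae_of_locallyAE ((tendsto_mul_right_locallyAE y).eventually e),
    f.ae_of_locallyAE ((tendsto_mul_left_locallyAE y).eventually e)] with x hxy hyx
  rcases eq_or_ne (f x) 0 with h0 | h0
  · simp only [h0, zero_mul]
  · rw [hxy h0, hyx h0]

end Kernel

section Duality

variable {G : Type*} [Group G] [TopologicalSpace G] [IsTopologicalGroup G]
  [LocallyCompactSpace G] [T2Space G] [MeasurableSpace G] [BorelSpace G] {ω : Weight G}

theorem norm_toDual (h : Linf ω) : ‖toDual ω h‖ = ‖h‖ := by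
  refine le_antisymm
    (ContinuousLinearMap.opNorm_le_bound _ (norm_nonneg h) (norm_pairing_le h)) ?_
  obtain ⟨k, hk, e⟩ := h.memLinf.exists_wBounded
  have hkb := hk.eventually_norm_le (norm_nonneg (toDual ω h)) fun f => by
    rw [← toDual_eq_pair e]
    exact (toDual ω h).le_opNorm f
  refine h.norm_le (norm_nonneg _) ?_
  filter_upwards [e, hkb] with x hx hkx
  rwa [hx]

theorem exists_wBounded_pair_eq (z : StrongDual ℂ (L1 ω)) :
    ∃ h, WBounded ω h ∧ ∀ f, z f = pair h f :=
  let ⟨h, hm, hb, hz⟩ := exists_wBounded_density z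
  ⟨h, ⟨hm, _, hb⟩, hz⟩

theorem toDual_surjective : Function.Surjective (toDual ω) := fun z =>
  let ⟨h, hh, hz⟩ := exists_wBounded_pair_eq z
  ⟨Linf.mk ω h hh.memLinf,
    ContinuousLinearMap.ext fun f => (toDual_mk hh.memLinf f).trans (hz f).symm⟩

variable (ω) in
/-- The identification of `L^∞(G, 1/ω)` with the dual of `L^1(G, ω)`. -/
noncomputable def dualEquiv : Linf ω ≃ₗᵢ[ℂ] StrongDual ℂ (L1 ω) :=
  LinearIsometryEquiv.ofSurjective ⟨(toDual ω).toLinearMap, norm_toDual⟩ toDual_surjective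

theorem toDual_dualEquiv_symm (z : StrongDual ℂ (L1 ω)) : toDual ω ((dualEquiv ω).symm z) = z :=
  (dualEquiv ω).apply_symm_apply z

end Duality

section Derivation

variable {G : Type*} [Group G] [TopologicalSpace G] [IsTopologicalGroup G]
  [LocallyCompactSpace G] [MeasurableSpace G] [BorelSpace G] {ω : Weight G}
  {p : BProd G G → ℂ} {B : L1 ω →L[ℂ] StrongDual ℂ (L1 ω)}

theorem isDerivation_iff : IsDerivation B ↔
    ∀ f k g : L1 ω, B (f * k) g = B f (k * g) + B k (g * f) :=
  forall₂_congr fun _ _ => ContinuousLinearMap.ext_iff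

variable [T2Space G]

theorem isInnerDerivation_iff : IsInnerDerivation B ↔
    ∃ h, WBounded ω h ∧ ∀ f g : L1 ω, B f g = pair h (f * g) - pair h (g * f) := by
  constructor
  · rintro ⟨z, hz⟩
    obtain ⟨h, hh, hzh⟩ := exists_wBounded_pair_eq z
    refine ⟨h, hh, fun f g => ?_⟩
    rw [hz, ← hzh, ← hzh]
    rfl
  · rintro ⟨h, hh, hB⟩
    refine ⟨toDual ω (Linf.mk ω h hh.memLinf), fun f => ContinuousLinearMap.ext fun g => ?_⟩
    rw [hB, ← toDual_mk hh.memLinf, ← toDual_mk hh.memLinf]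
    rfl

theorem isDerivation_iff_quasiAdditive (hp : WBounded (ω.prod ω) p)
    (hB : ∀ f g, pair p (tensor f g) = B f g) : IsDerivation B ↔ QuasiAdditive (G := G) p := by
  simp only [isDerivation_iff, quasiAdditive_iff hp, hB]

theorem MemLinf.exists_wBounded_hasKernel {p : G × G → ℂ} {h : G → ℂ} (hh : MemLinf ω h)
    (H : HasKernel p h) : ∃ k, WBounded ω k ∧ HasKernel p k := by
  obtain ⟨k, hk, e⟩ := hh.exists_wBounded
  exact ⟨k, hk, H.congr ω (borelFun_iff.1 hh.1) hk.measurable e⟩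

theorem isInnerDerivation_iff_hasKernel (hp : WBounded (ω.prod ω) p)
    (hB : ∀ f g, pair p (tensor f g) = B f g) :
    IsInnerDerivation B ↔ ∃ h : G → ℂ, MemLinf ω h ∧ HasKernel (G := G) p h := by
  rw [isInnerDerivation_iff]
  constructor
  · rintro ⟨h, hh, hBh⟩
    refine ⟨_, (hh.const_mul (productConst G G : ℂ)⁻¹).memLinf,
      (hasKernel_iff hp (hh.const_mul _)).2 fun f g => ?_⟩
    rw [hB, hBh, const_mul_pair, const_mul_pair, ← mul_sub,
      mul_inv_cancel_left₀ (coe_productConst_ne_zero G G)]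
  · rintro ⟨h, hh, H⟩
    obtain ⟨k, hk, Hk⟩ := hh.exists_wBounded_hasKernel H
    refine ⟨_, hk.const_mul (productConst G G : ℂ), fun f g => ?_⟩
    rw [← hB, (hasKernel_iff hp hk).1 Hk, const_mul_pair, const_mul_pair, mul_sub]

theorem isInnerDerivation_iff_integral {D : L1 ω →L[ℂ] Linf ω} :
    IsInnerDerivation ((toDual ω).comp D) ↔ ∃ h : G → ℂ, MemLinf ω h ∧ ∀ f g : L1 ω,
      toDual ω (D f) g = ∫ y, ∫ x, f x * g y * (h (x * y) - h (y * x))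
        ∂(Measure.haar : Measure G) ∂(Measure.haar : Measure G) := by
  rw [isInnerDerivation_iff]
  constructor
  · rintro ⟨h, hh, hD⟩
    exact ⟨h, hh.memLinf, fun f g => (hD f g).trans (integral_integral_kernel hh f g).symm⟩
  · rintro ⟨h, hh, hD⟩
    obtain ⟨k, hk, e⟩ := hh.exists_wBounded
    refine ⟨k, hk, fun f g => (hD f g).trans ?_⟩
    rw [integral_integral_kernel_congr e, integral_integral_kernel hk]

end Derivation

section WeakAmenability

variable {G : Type*} [Group G] [TopologicalSpace G] [IsTopologicalGroup G]
  [LocallyCompactSpace G]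

theorem classes_subset_iff {ω : Weight G} : classes (boundedQA ω) ⊆ classes (innerQA ω) ↔
    ∀ p ∈ boundedQA ω, ∃ h : G → ℂ, MemLinf ω h ∧ HasKernel p h := by
  constructor
  · intro hs p hp
    obtain ⟨q, ⟨-, h, hh, H⟩, e⟩ := hs ⟨p, hp, rfl⟩
    exact ⟨h, hh, (Germ.coe_eq.1 e.symm).trans H⟩
  · rintro hc _ ⟨p, hp, rfl⟩
    exact ⟨p, ⟨hp.1, hc p hp⟩, rfl⟩

variable [T2Space G] [MeasurableSpace G] [BorelSpace G] {ω : Weight G}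

theorem classes_innerQA_subset : classes (innerQA ω) ⊆ classes (boundedQA ω) := by
  rintro _ ⟨p, ⟨-, h, hh, H⟩, rfl⟩
  obtain ⟨k, hk, Hk⟩ := hh.exists_wBounded_hasKernel H
  have hw := hk.comp_mul.sub hk.comp_mul_swap
  exact ⟨fun t => k (t.1 * t.2) - k (t.2 * t.1),
    ⟨quasiAdditive_commutator hk.measurable, (wBounded_prod_iff.1 hw).2⟩,
    Germ.coe_eq.2 (EventuallyEq.symm Hk)⟩

theorem weaklyAmenable_iff_forall_linf : WeaklyAmenable (L1 ω) ↔
    ∀ D : L1 ω →L[ℂ] Linf ω, IsDerivation ((toDual ω).comp D) →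
      IsInnerDerivation ((toDual ω).comp D) := by
  refine ⟨fun ha D hD => ha _ hD, fun hb B hB => ?_⟩
  let D : L1 ω →L[ℂ] Linf ω := ((dualEquiv ω).symm : StrongDual ℂ (L1 ω) →L[ℂ] Linf ω).comp B
  have hD : (toDual ω).comp D = B :=
    ContinuousLinearMap.ext fun f => toDual_dualEquiv_symm (B f)
  exact hD ▸ hb D (hD.symm ▸ hB)

theorem weaklyAmenable_iff_forall_hasKernel : WeaklyAmenable (L1 ω) ↔
    ∀ p ∈ boundedQA ω, ∃ h : G → ℂ, MemLinf ω h ∧ HasKernel p h := by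
  constructor
  · rintro ha p ⟨hp, hpb⟩
    have hw : WBounded (G := BProd G G) (ω.prod ω) p := wBounded_prod_iff.2 ⟨hp.1, hpb⟩
    obtain ⟨B, hB⟩ := exists_bilinear_of_wBounded hw
    exact (isInnerDerivation_iff_hasKernel hw hB).1
      (ha B ((isDerivation_iff_quasiAdditive hw hB).2 hp))
  · intro hc B hBd
    obtain ⟨p, hw, hB⟩ := exists_wBounded_bilinear B
    exact (isInnerDerivation_iff_hasKernel hw hB).2
      (hc p ⟨(isDerivation_iff_quasiAdditive hw hB).1 hBd, (wBounded_prod_iff.1 hw).2⟩)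

end WeakAmenability

end Beurling

theorem theorem2p4 (G : Type*) [Group G] [TopologicalSpace G] [IsTopologicalGroup G]
    [LocallyCompactSpace G] [T2Space G] [Infinite G] [MeasurableSpace G] [BorelSpace G]
    (ω : Beurling.Weight G) :
    List.TFAE [
      -- (a) weak amenability
      Beurling.WeaklyAmenable (Beurling.L1 ω),
      -- (b) every bounded derivation into the bimodule `L^∞(G, 1/ω)` is given by a kernel
      ∀ D : Beurling.L1 ω →L[ℂ] Beurling.Linf ω,
        Beurling.IsDerivation ((Beurling.toDual ω).comp D) →
          ∃ h : G → ℂ, Beurling.MemLinf ω h ∧ ∀ f g : Beurling.L1 ω,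
            Beurling.toDual ω (D f) g =
              ∫ y, ∫ x, f x * g y * (h (x * y) - h (y * x)) ∂(Measure.haar : Measure G)
                ∂(Measure.haar : Measure G),
      -- (c)
      ∀ p ∈ Beurling.boundedQA ω, ∃ h : G → ℂ, Beurling.MemLinf ω h ∧ Beurling.HasKernel p h,
      -- (d)
      ∀ p : G × G → ℂ, Beurling.QuasiAdditive p → Beurling.supConst ω p < ∞ →
        p ∈ Beurling.innerQA ω,
      -- (e)
      ∀ p : G × G → ℂ, Beurling.QuasiAdditive p → p ∉ Beurling.innerQA ω →
        Beurling.supConst ω p = ∞,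
      -- (f)
      Beurling.classes (Beurling.boundedQA ω) = Beurling.classes (Beurling.innerQA ω)] := by
  tfae_have 1 ↔ 2 := by
    simp only [Beurling.weaklyAmenable_iff_forall_linf, Beurling.isInnerDerivation_iff_integral]
  tfae_have 1 ↔ 3 := Beurling.weaklyAmenable_iff_forall_hasKernel
  tfae_have 3 ↔ 4 :=
    ⟨fun hc p hp hb => ⟨hp, hc p ⟨hp, hb⟩⟩, fun hd p hp => (hd p hp.1 hp.2).2⟩
  tfae_have 4 ↔ 5 := by
    refine forall₂_congr fun p _ => ?_
    rw [← not_imp_not, lt_top_iff_ne_top, not_not]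
  tfae_have 3 ↔ 6 := by
    rw [← Beurling.classes_subset_iff]
    exact ⟨fun h => h.antisymm Beurling.classes_innerQA_subset, fun h => h.subset⟩
  tfae_finish
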